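/- Let $0<s<1$ and let $\varphi:\mathbf R\to(0,\infty)$ be smooth with $\varphi(r)=1$ for $r\le 1$ and $\varphi(r)=r^{s-1}$ for $r>2$. For $N\ge 1$ let $I=I_N$ be the Fourier multiplier on $\mathbf R^2$ with symbol $m_N(\xi)=\varphi(|\xi|/N)$, so that $m_N(\xi)=1$ for $|\xi|\le N$ and $m_N(\xi)=(|\xi|/N)^{s-1}$ for $|\xi|>2N$. For every $\varepsilon>0$ there is a constant $C$, depending only on $s$, $\varphi$ and $\varepsilon$, such that the following holds for all $N\ge1$ and $T>0$. Let $u_0\in H^s(\mathbf R^2)$ and let $u\in C([0,T];H^s(\mathbf R^2))\cap L^4_{t,x}([0,T]\times\mathbf R^2)$ solve $$i u_t+\Delta u=|u|^2u,\qquad u(0)=u_0$$ in the sense of distributions. For an interval $J\subset[0,T]$ put $$Z_I(J)=\sup\Big\{\|\langle D\rangle Iu\|_{L^q_tL^r_x(J\times\mathbf R^2)}\;:\;2<q\le\infty,\ \tfrac2q=2\big(\tfrac12-\tfrac1r\big)\Big\}\in[0,\infty],\qquad \langle D\rangle=(1-\Delta)^{1/2}.$$ Then for every partition of $[0,T]$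 into finitely many consecutive intervals $J_1,\dots,J_n$, $$\|Iu\|_{L^4_{t,x}([0,T]\times\mathbf R^2)}^4\le C\Big(T^{1/3}\|u_0\|_{L^2}^3\,\|Iu\|_{L^\infty_t([0,T];\dot H^1(\mathbf R^2))}+T^{1/3}\|u_0\|_{L^2}^4+T^{1/3}\sum_{k=1}^n\frac{Z_I(J_k)^6}{N^{2-\varepsilon}}\Big).$$ -/

import Mathlib

open MeasureTheory Set Filter Topology
open scoped ENNReal NNReal FourierTransform SchwartzMap Laplacian ContDiff

noncomputable section

/-- The Euclidean plane `ℝ²`. -/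
abbrev Plane : Type := EuclideanSpace ℝ (Fin 2)

/-- Complex-valued `L²(ℝ²)`. -/
abbrev L2Plane : Type := Lp ℂ 2 (volume : Measure Plane)

/-- The function `ξ ↦ σ(2πξ) (𝓕 f)(ξ)`. Mathlib's Fourier transform uses the character
`exp (-2πi x·ξ)`, so Mathlib's frequency `ξ` is the frequency `2πξ` of the convention
`∫ exp (-i x·ξ) f(x) dx`; the symbol `σ` is written in the latter convention, in which `∇` has
the symbol `iξ`. -/
def symbolMul (σ : Plane → ℝ) (f : L2Plane) (ξ : Plane) : ℂ :=
  (σ ((2 * Real.pi) • ξ) : ℂ) * (𝓕 f : L2Plane) ξ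

open Classical in
/-- The Fourier multiplier with real symbol `σ`, as an operator in `L²(ℝ²)` with its natural domain
`{f | σ f̂ ∈ L²}` (and the value `0` outside of that domain). -/
def fourierMul (σ : Plane → ℝ) (f : L2Plane) : L2Plane :=
  if h : MemLp (symbolMul σ f) 2 volume then 𝓕⁻ (h.toLp (symbolMul σ f)) else 0

/-- The Japanese bracket `⟨ξ⟩ = (1 + |ξ|²)^(1/2)`. -/
def japaneseBracket (ξ : Plane) : ℝ := Real.sqrt (1 + ‖ξ‖ ^ 2)

/-- The norm of `H^s(ℝ²)`, with values in `[0, ∞]`: the `L²` norm of `⟨ξ⟩^s f̂(ξ)`. -/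
def sobolevNorm (s : ℝ) (f : L2Plane) : ℝ≥0∞ :=
  eLpNorm (symbolMul (fun ξ => japaneseBracket ξ ^ s) f) 2 volume

/-- The norm of the homogeneous space `Ḣ¹(ℝ²)`, with values in `[0, ∞]`: the `L²` norm of
`|ξ| f̂(ξ)`. -/
def homSobolevNormOne (f : L2Plane) : ℝ≥0∞ :=
  eLpNorm (symbolMul (fun ξ => ‖ξ‖) f) 2 volume

/-- The mixed norm `‖f‖_{L^q_t L^r_x(J × ℝ²)}`. -/
def mixedNorm (q r : ℝ≥0∞) (J : Set ℝ) (f : ℝ → L2Plane) : ℝ≥0∞ :=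
  eLpNorm (fun t => eLpNorm (f t) r (volume : Measure Plane)) q (volume.restrict J)

/-- `u` is a solution on `[0, T]` of `i u_t + Δ u = |u|² u`, `u(0) = u₀ ∈ H^s(ℝ²)`: it lies in
`C([0, T]; H^s(ℝ²)) ∩ L⁴([0, T] × ℝ²)` and satisfies the equation in the sense of distributions,
integrated in time. -/
structure IsCubicNLSSolution (s T : ℝ) (u₀ : L2Plane) (u : ℝ → L2Plane) : Prop where
  initial : u 0 = u₀
  mem_sobolev : ∀ t ∈ Icc 0 T, sobolevNorm s (u t) < ⊤
  continuous_sobolev : ∀ t ∈ Icc 0 T,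
    Tendsto (fun t' => sobolevNorm s (u t' - u t)) (𝓝[Icc 0 T] t) (𝓝 0)
  mem_L4 : mixedNorm 4 4 (Icc 0 T) u < ⊤
  equation : ∀ ψ : 𝓢(Plane, ℂ), ∀ t ∈ Icc 0 T,
    Complex.I * ((∫ x, u t x * ψ x) - ∫ x, u₀ x * ψ x)
      + ∫ τ in (0 : ℝ)..t, ((∫ x, u τ x * (Δ ψ) x) - ∫ x, ((‖u τ x‖ ^ 2 : ℝ) : ℂ) * u τ x * ψ x)
      = 0

/-- `φ` is a radial profile for the `I`-operators of regularity `s`: it is smooth and positive,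
`φ(r) = 1` for `r ≤ 1` and `φ(r) = r^(s-1)` for `r > 2`. -/
structure IsIProfile (s : ℝ) (φ : ℝ → ℝ) : Prop where
  smooth : ContDiff ℝ ∞ φ
  pos : ∀ r, 0 < φ r
  eq_one : ∀ r ≤ 1, φ r = 1
  eq_rpow : ∀ r, 2 < r → φ r = r ^ (s - 1)

/-- The operator `I_N`, with symbol `m_N(ξ) = φ(|ξ|/N)`. The symbol is bounded, so that `I_N` is
defined on all of `L²(ℝ²)`. -/
def iOperator (φ : ℝ → ℝ) (N : ℝ) (f : L2Plane) : L2Plane :=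
  fourierMul (fun ξ => φ (‖ξ‖ / N)) f

/-- Admissible pairs in dimension two: `2/q = 2(1/2 - 1/r)` and `q > 2`. -/
def IsAdmissible (q r : ℝ≥0∞) : Prop := 2 < q ∧ 2 / q + 2 / r = 1

/-- `Z_I(J)`, the supremum over all admissible pairs `(q, r)` of
`‖⟨D⟩ I_N u‖_{L^q_t L^r_x(J × ℝ²)}`. -/
def strichartzZ (φ : ℝ → ℝ) (N : ℝ) (u : ℝ → L2Plane) (J : Set ℝ) : ℝ≥0∞ :=
  ⨆ (q : ℝ≥0∞) (r : ℝ≥0∞) (_ : IsAdmissible q r),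
    mixedNorm q r J (fun t => fourierMul japaneseBracket (iOperator φ N (u t)))

end

/-!
The estimate is an interaction Morawetz inequality for `w = I u`. This function solves
`i w_t + Δ w = |w|² w + E` with `E = I (|u|² u) - |I u|² I u`, and everything rests on two facts: the
Morawetz inequality holds up to an error linear in `E`, and `E` is small in `L²`. The operator `I` is
first replaced by its truncations to frequencies below `2 ^ J N`, up to a constant, which are
convolutions with Schwartz functions (`truncKernel`); the bounds are uniform in `J`, and Fatou's
lemma restores `I` (`mixedNorm_iOperator_le`).

*Smallness of `E`.* By `exists_cubic_commutator_bound`, `‖E‖_2 ≤ C N ^ (-2 + ε) ‖⟨D⟩ I u‖_6 ^ 3` at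
each fixed time. Split `u = l + h` by a smooth cutoff between the frequencies `N / 8` and `N / 4`.
The operator is the identity on `l` and on `|l|² l`, whose frequencies lie below `N`, so the terms
without `h` cancel. Since `⟨D⟩ I` can be inverted on `h` with gain `N⁻¹`, the terms with at least two
factors `h` are bounded by Hölder's inequality. The terms with one factor `h` are commutators of `I`
with a product of two low-frequency functions: the first moment of the kernel of `I` gains the second
factor `N⁻¹`, and the derivative that falls on `l` costs `N ^ ε`. All that is needed of the
multipliers is the `L¹` norm or the first moment of their kernels. These are obtained by telescoping
over dyadic cutoffs, consecutive ones differing by a dilate of a fixed symbol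
(`exists_bound_iSymbol`, `exists_bound_highSymbol`, `exists_bound_lowSymbol`,
`exists_bound_lowSymbol_deriv`); no Littlewood–Paley theory enters.

*The Morawetz inequality.* For a unit vector `e`, consider the momentum of `w` in the direction `e`
at `x` against its mass at `y`, weighted by `χ(⟨x - y, e⟩)`, where `χ` is odd with an even and
nonnegative derivative `κ`. By `interaction_morawetz`, the time derivative of this functional is, up
to the error, at least `∫∫ κ ∂ₑρ ∂ₑρ` with `ρ = |w|²`; the remaining terms have a sign. The time
derivative makes sense for a distributional solution because the mollified solution is the primitive
of a Bochner integrable function (`isPrimitive_schwartzConvL`), and primitives obey the product rule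
(`IsPrimitive.bilin`). With `κ` a Gaussian, `∫∫ κ ∂ₑρ ∂ₑρ` is an integral of `σ² |ρ̂(σ e)|²`, with a
damping factor that disappears as the Gaussian concentrates; integration over all directions `e`
bounds `∫∫ |ξ| |ρ̂(ξ)|² dξ dt` (`lintegral_norm_mul_le_of_lines`). Interpolation with the mass, which
is conserved (`IsMildSolution.norm_eq`), at the frequency `T ^ (-1/3)` yields the space-time `L⁴` norm
of `w` (`lintegral_enorm_sq_le_interpolation`, `IsMildSolution.lintegral_eLpNorm_four_le`).

*The role of `Z_I`.* Only the admissible pairs `(3, 6)` and `(∞, 2)` are used: three factors in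
`L³ L⁶` bound `E` in `L¹ L²`, and three factors in `L^∞ L²` accompany it in the error. When all
`Z_I(J_k)` are finite, `u` lies in `L³ L⁶`, so that `|u|² u` is Bochner integrable in `L²`
(`IsCubicNLSSolution.isMildSolution`); when one of them is infinite there is nothing to prove.
-/

open scoped ComplexConjugate

/-! ### A weighted Minkowski inequality and convolution with Schwartz functions -/

/-- Jensen's inequality followed by Tonelli's theorem: an average, with weight `κ`, of functions
whose `L^p` norm is at most `B` has `L^p` norm at most `(∫ κ) * B`. -/
theorem eLpNorm_le_of_enorm_le_lintegral {α β E : Type*} [MeasurableSpace α] [MeasurableSpace β]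
    [NormedAddCommGroup E] {μ : Measure α} {ν : Measure β} [SFinite μ] [SFinite ν]
    {p : ℝ≥0∞} (hp1 : 1 ≤ p) (hpt : p ≠ ⊤) {F : α → E} {κ : β → ℝ≥0∞} (hκ : Measurable κ)
    {H : β → α → ℝ≥0∞} (hH : Measurable (Function.uncurry H)) {B : ℝ≥0∞}
    (hF : ∀ᵐ x ∂μ, ‖F x‖ₑ ≤ ∫⁻ z, κ z * H z x ∂ν)
    (hB : ∀ z, eLpNorm (H z) p μ ≤ B) :
    eLpNorm F p μ ≤ (∫⁻ z, κ z ∂ν) * B := by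
  have hp0 : p ≠ 0 := (zero_lt_one.trans_le hp1).ne'
  set r := p.toReal with hr
  have hr1 : 1 ≤ r := by
    have := ENNReal.toReal_mono hpt hp1
    simpa using this
  have hr0 : 0 < r := by linarith
  have hHx : ∀ x, Measurable fun z => H z x := fun x => hH.of_uncurry_right
  set ν' := ν.withDensity κ with hν'
  have hden : ∀ f : β → ℝ≥0∞, Measurable f → ∫⁻ z, f z ∂ν' = ∫⁻ z, κ z * f z ∂ν := fun f hf =>
    lintegral_withDensity_eq_lintegral_mul _ hκ hf
  have hun : ν' univ = ∫⁻ z, κ z ∂ν := by simp [hν']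
  have hsig : SFinite ν' := inferInstance
  -- Jensen's inequality for the finite measure `κ ν`
  have key : ∀ x, (∫⁻ z, H z x ∂ν') ^ r ≤ ν' univ ^ (r - 1) * ∫⁻ z, H z x ^ r ∂ν' := by
    intro x
    have h := eLpNorm_le_eLpNorm_mul_rpow_measure_univ (μ := ν') hp1
      (hHx x).aestronglyMeasurable
    rw [eLpNorm_one_eq_lintegral_enorm, eLpNorm_eq_lintegral_rpow_enorm_toReal hp0 hpt] at h
    simp only [enorm_eq_self, ENNReal.toReal_one] at h
    calc (∫⁻ z, H z x ∂ν') ^ r ≤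
          ((∫⁻ z, H z x ^ r ∂ν') ^ (1 / r) * ν' univ ^ (1 / 1 - 1 / r)) ^ r :=
          ENNReal.rpow_le_rpow h hr0.le
      _ = _ := by
        rw [ENNReal.mul_rpow_of_nonneg _ _ hr0.le, ← ENNReal.rpow_mul, ← ENNReal.rpow_mul,
          one_div_mul_cancel hr0.ne', ENNReal.rpow_one, mul_comm]
        congr 2
        field_simp
  have hint : ∫⁻ x, ‖F x‖ₑ ^ r ∂μ ≤ ((∫⁻ z, κ z ∂ν) * B) ^ r := by
    calc ∫⁻ x, ‖F x‖ₑ ^ r ∂μ ≤ ∫⁻ x, ν' univ ^ (r - 1) * ∫⁻ z, H z x ^ r ∂ν' ∂μ := by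
          refine lintegral_mono_ae ?_
          filter_upwards [hF] with x hx
          refine le_trans (ENNReal.rpow_le_rpow ?_ hr0.le) (key x)
          rwa [hden _ (hHx x)]
      _ = ν' univ ^ (r - 1) * ∫⁻ x, ∫⁻ z, H z x ^ r ∂ν' ∂μ := by
          refine lintegral_const_mul _ ?_
          refine Measurable.lintegral_prod_right' (f := fun q : α × β => H q.2 q.1 ^ r) ?_
          exact (hH.comp measurable_swap).pow_const r
      _ = ν' univ ^ (r - 1) * ∫⁻ z, ∫⁻ x, H z x ^ r ∂μ ∂ν' := by
          rw [lintegral_lintegral_swap]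
          exact ((hH.comp measurable_swap).pow_const r).aemeasurable
      _ ≤ ν' univ ^ (r - 1) * ∫⁻ z, B ^ r ∂ν' := by
          gcongr with z
          have h := hB z
          rw [eLpNorm_eq_lintegral_rpow_enorm_toReal hp0 hpt] at h
          simp only [enorm_eq_self] at h
          have h2 := ENNReal.rpow_le_rpow h hr0.le
          rwa [← ENNReal.rpow_mul, one_div_mul_cancel hr0.ne', ENNReal.rpow_one] at h2
      _ = _ := by
          rw [lintegral_const, ENNReal.mul_rpow_of_nonneg _ _ hr0.le, ← hun]
          rw [mul_comm (B ^ r), ← mul_assoc]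
          congr 1
          nth_rewrite 2 [← ENNReal.rpow_one (ν' univ)]
          rw [← ENNReal.rpow_add_of_nonneg _ _ (by linarith) zero_le_one]
          congr 1; ring
  rw [eLpNorm_eq_lintegral_rpow_enorm_toReal hp0 hpt]
  calc (∫⁻ x, ‖F x‖ₑ ^ r ∂μ) ^ (1 / r) ≤ (((∫⁻ z, κ z ∂ν) * B) ^ r) ^ (1 / r) :=
        ENNReal.rpow_le_rpow hint (by positivity)
    _ = _ := by rw [← ENNReal.rpow_mul, mul_one_div_cancel hr0.ne', ENNReal.rpow_one]

/-- The convolution `k * f` of a Schwartz function with a function on the plane. -/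
noncomputable def schwartzConv (k : 𝓢(Plane, ℂ)) (f : Plane → ℂ) (x : Plane) : ℂ :=
  ∫ y, k (x - y) * f y

theorem schwartzConv_eq (k : 𝓢(Plane, ℂ)) (f : Plane → ℂ) (x : Plane) :
    schwartzConv k f x = ∫ z, k z * f (x - z) := by
  rw [schwartzConv, ← integral_sub_left_eq_self _ volume x]
  simp

theorem schwartzConv_congr (k : 𝓢(Plane, ℂ)) {f g : Plane → ℂ} (h : f =ᵐ[volume] g) :
    schwartzConv k f = schwartzConv k g := by
  ext x
  exact integral_congr_ae (h.mono fun y hy => by simp [hy])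

theorem memLp_comp_sub_left {E : Type*} [NormedAddCommGroup E] {p : ℝ≥0∞} {f : Plane → E}
    (hf : MemLp f p) (x : Plane) : MemLp (fun y => f (x - y)) p :=
  hf.comp_measurePreserving (Measure.measurePreserving_sub_left volume x)

theorem eLpNorm_comp_sub_left {E : Type*} [NormedAddCommGroup E] {p : ℝ≥0∞} {f : Plane → E}
    (hf : AEStronglyMeasurable f) (x : Plane) :
    eLpNorm (fun y => f (x - y)) p = eLpNorm f p :=
  eLpNorm_comp_measurePreserving hf (Measure.measurePreserving_sub_left volume x)

theorem eLpNorm_comp_sub_right {E : Type*} [NormedAddCommGroup E] {p : ℝ≥0∞} {f : Plane → E}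
    (hf : AEStronglyMeasurable f) (z : Plane) :
    eLpNorm (fun y => f (y - z)) p = eLpNorm f p :=
  eLpNorm_comp_measurePreserving hf (measurePreserving_sub_right volume z)

/-- Young's inequality `‖k * f‖_p ≤ ‖k‖_1 ‖f‖_p`. -/
theorem eLpNorm_schwartzConv_le {p : ℝ≥0∞} (hp1 : 1 ≤ p) (hpt : p ≠ ⊤) (k : 𝓢(Plane, ℂ))
    {f : Plane → ℂ} (hf : Measurable f) :
    eLpNorm (schwartzConv k f) p ≤ (∫⁻ z, ‖k z‖ₑ) * eLpNorm f p := by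
  refine eLpNorm_le_of_enorm_le_lintegral hp1 hpt (κ := fun z => ‖k z‖ₑ)
    (H := fun z x => ‖f (x - z)‖ₑ) ?_ ?_ ?_ ?_
  · exact k.continuous.measurable.enorm
  · exact (hf.comp (measurable_snd.sub measurable_fst)).enorm
  · refine Eventually.of_forall fun x => ?_
    rw [schwartzConv_eq]
    refine (enorm_integral_le_lintegral_enorm _).trans (le_of_eq ?_)
    simp [enorm_mul]
  · intro z
    rw [show (fun x => ‖f (x - z)‖ₑ) = fun x => ‖(fun y => f (y - z)) x‖ₑ from rfl, eLpNorm_enorm,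
      eLpNorm_comp_sub_right hf.aestronglyMeasurable]

theorem schwartz_lintegral_lt_top (k : 𝓢(Plane, ℂ)) : ∫⁻ z, ‖k z‖ₑ < ⊤ :=
  k.integrable.hasFiniteIntegral

theorem schwartzConv_integrable (k : 𝓢(Plane, ℂ)) {f : Plane → ℂ} (hf : MemLp f 2) (x : Plane) :
    Integrable fun y => k (x - y) * f y :=
  (memLp_comp_sub_left (k.memLp 2) x).integrable_mul hf

theorem enorm_integral_mul_le_of_two {f g : Plane → ℂ} (hf : AEStronglyMeasurable f)
    (hg : AEStronglyMeasurable g) :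
    ∫⁻ x, ‖f x * g x‖ₑ ≤ eLpNorm f 2 * eLpNorm g 2 := by
  rw [← eLpNorm_one_eq_lintegral_enorm]
  have := eLpNorm_le_eLpNorm_mul_eLpNorm_of_nnnorm (p := 2) (q := 2) (r := 1) hf hg
    (fun a b => a * b) 1 (by simp)
  simpa using this

theorem enorm_schwartzConv_le (k : 𝓢(Plane, ℂ)) {f : Plane → ℂ} (hf : AEStronglyMeasurable f)
    (x : Plane) : ‖schwartzConv k f x‖ₑ ≤ eLpNorm k 2 * eLpNorm f 2 := by
  refine (enorm_integral_le_lintegral_enorm _).trans ?_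
  have hk : AEStronglyMeasurable (k : Plane → ℂ) := k.continuous.aestronglyMeasurable
  refine (enorm_integral_mul_le_of_two (f := fun y => k (x - y)) ?_ hf).trans ?_
  · exact (k.continuous.comp (by fun_prop)).aestronglyMeasurable
  · rw [eLpNorm_comp_sub_left hk]

theorem schwartzConv_add (k : 𝓢(Plane, ℂ)) {f g : Plane → ℂ} (hf : MemLp f 2) (hg : MemLp g 2) :
    schwartzConv k (f + g) = schwartzConv k f + schwartzConv k g := by
  ext x
  simp only [schwartzConv, Pi.add_apply, mul_add]
  exact integral_add (schwartzConv_integrable k hf x) (schwartzConv_integrable k hg x)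

theorem schwartzConv_sub (k : 𝓢(Plane, ℂ)) {f g : Plane → ℂ} (hf : MemLp f 2) (hg : MemLp g 2) :
    schwartzConv k (f - g) = schwartzConv k f - schwartzConv k g := by
  ext x
  simp only [schwartzConv, Pi.sub_apply, mul_sub]
  exact integral_sub (schwartzConv_integrable k hf x) (schwartzConv_integrable k hg x)

theorem schwartzConv_add_left (k l : 𝓢(Plane, ℂ)) {f : Plane → ℂ} (hf : MemLp f 2) :
    schwartzConv (k + l) f = schwartzConv k f + schwartzConv l f := by
  ext x
  simp only [schwartzConv, Pi.add_apply, add_apply, add_mul]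
  exact integral_add (schwartzConv_integrable k hf x) (schwartzConv_integrable l hf x)

theorem schwartz_fderiv_decay (k : 𝓢(Plane, ℂ)) :
    ∃ C : ℝ, 0 ≤ C ∧ ∀ x, ‖fderiv ℝ k x‖ ≤ C * (1 + ‖x‖) ^ (-3 : ℝ) := by
  have h := SchwartzMap.one_add_le_sup_seminorm_apply (𝕜 := ℝ) (m := (3, 1)) (k := 3) (n := 1)
    le_rfl le_rfl k
  set A : ℝ := 2 ^ (3, 1).1 * (Finset.Iic (3, 1)).sup (fun m => SchwartzMap.seminorm ℝ m.1 m.2) k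
  refine ⟨A, by positivity, fun x => ?_⟩
  have hx := h x
  rw [← norm_iteratedFDeriv_one]
  have hpos : (0 : ℝ) < (1 + ‖x‖) ^ 3 := by positivity
  rw [Real.rpow_neg (by positivity), show ((3 : ℝ)) = ((3 : ℕ) : ℝ) by norm_num, Real.rpow_natCast,
    ← div_eq_mul_inv, le_div_iff₀ hpos, mul_comm]
  exact hx

theorem memLp_two_one_add_norm : MemLp (fun x : Plane => (1 + ‖x‖) ^ (-3 : ℝ)) 2 := by
  rw [memLp_two_iff_integrable_sq]
  · have : Integrable (fun x : Plane => (1 + ‖x‖) ^ (-6 : ℝ)) :=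
      integrable_one_add_norm (by simp; norm_num)
    refine this.congr (Eventually.of_forall fun x => ?_)
    simp only
    rw [← Real.rpow_natCast, ← Real.rpow_mul (by positivity)]
    norm_num
  · refine Continuous.aestronglyMeasurable ?_
    refine Continuous.rpow_const (by fun_prop) fun x => Or.inl ?_
    positivity

open LineDeriv in
theorem schwartzConv_hasFDerivAt (k : 𝓢(Plane, ℂ)) {f : Plane → ℂ} (hf : MemLp f 2) (x : Plane) :
    HasFDerivAt (schwartzConv k f) (∫ y, f y • fderiv ℝ k (x - y)) x := by
  obtain ⟨C, hC0, hC⟩ := schwartz_fderiv_decay k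
  -- the dominating function has to be uniform for `x` in a unit ball; the decay exponent `3` makes
  -- it square integrable on the plane
  have hsh : ∀ x' ∈ Metric.ball x 1, ∀ y, (1 + ‖x' - y‖) ^ (-3 : ℝ) ≤
      8 * (1 + ‖x - y‖) ^ (-3 : ℝ) := by
    intro x' hx' y
    have h1 : ‖x - y‖ ≤ ‖x' - y‖ + 1 := by
      have h2 : ‖x - y‖ ≤ ‖x' - y‖ + ‖x - x'‖ := by
        have := norm_add_le (x' - y) (x - x')
        simpa using this
      have h3 : ‖x - x'‖ < 1 := by rw [← dist_eq_norm]; exact Metric.mem_ball'.1 hx'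
      linarith
    have h4 : (1 + ‖x - y‖) / 2 ≤ 1 + ‖x' - y‖ := by
      have := norm_nonneg (x' - y)
      linarith
    have h5 : (8 : ℝ) * (1 + ‖x - y‖) ^ (-3 : ℝ) = ((1 + ‖x - y‖) / 2) ^ (-3 : ℝ) := by
      rw [Real.div_rpow (by positivity) (by norm_num), div_eq_mul_inv, mul_comm]
      congr 1
      rw [← Real.rpow_neg (by norm_num)]
      norm_num
    rw [h5]
    exact Real.rpow_le_rpow_of_nonpos (by positivity) h4 (by norm_num)
  refine hasFDerivAt_integral_of_dominated_of_fderiv_le (𝕜 := ℝ) (s := Metric.ball x 1)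
    (F := fun x y => k (x - y) * f y) (F' := fun x y => f y • fderiv ℝ k (x - y))
    (bound := fun y => ‖f y‖ * (C * (8 * (1 + ‖x - y‖) ^ (-3 : ℝ))))
    (Metric.ball_mem_nhds x one_pos) ?_ ?_ ?_ ?_ ?_ ?_
  · exact Eventually.of_forall fun x' => (schwartzConv_integrable k hf x').aestronglyMeasurable
  · exact schwartzConv_integrable k hf x
  · refine hf.aestronglyMeasurable.smul ?_
    refine Continuous.aestronglyMeasurable ?_
    exact ((k.smooth 1).continuous_fderiv one_ne_zero).comp (by fun_prop)
  · refine Eventually.of_forall fun y x' hx' => ?_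
    rw [norm_smul]
    gcongr
    exact (hC _).trans (by gcongr; exact hsh x' hx' y)
  · have h := (memLp_comp_sub_left memLp_two_one_add_norm x).integrable_mul hf.norm
    refine (h.const_mul (8 * C)).congr (Eventually.of_forall fun y => ?_)
    simp only [Pi.mul_apply]
    ring
  · refine Eventually.of_forall fun y x' _ => ?_
    have h1 : HasFDerivAt (fun x' : Plane => k (x' - y)) (fderiv ℝ k (x' - y)) x' := by
      have := (k.differentiableAt (x := x' - y)).hasFDerivAt
      exact this.comp x' ((hasFDerivAt_id x').sub_const y)
    exact h1.mul_const (f y)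

theorem schwartzConv_continuous (k : 𝓢(Plane, ℂ)) {f : Plane → ℂ} (hf : MemLp f 2) :
    Continuous (schwartzConv k f) :=
  continuous_iff_continuousAt.2 fun x => (schwartzConv_hasFDerivAt k hf x).continuousAt

open LineDeriv in
theorem schwartzConv_hasLineDerivAt (k : 𝓢(Plane, ℂ)) {f : Plane → ℂ} (hf : MemLp f 2)
    (x v : Plane) :
    HasLineDerivAt ℝ (schwartzConv k f) (schwartzConv (∂_{v} k) f x) x v := by
  have h := (schwartzConv_hasFDerivAt k hf x).hasLineDerivAt v
  have hint : Integrable fun y => f y • fderiv ℝ k (x - y) := by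
    have h1 : MemLp (fun y => fderiv ℝ k (x - y)) 2 := by
      refine memLp_comp_sub_left ?_ x
      exact (SchwartzMap.fderivCLM ℝ Plane ℂ k).memLp 2
    exact memLp_one_iff_integrable.1 (h1.smul hf)
  rw [ContinuousLinearMap.integral_apply hint] at h
  convert! h using 1
  refine integral_congr_ae (Eventually.of_forall fun y => ?_)
  simp [SchwartzMap.lineDerivOp_apply_eq_fderiv, mul_comm]

/-! ### Fourier multipliers with Schwartz symbols -/

theorem schwartzConv_coe_eq_convolution (k ψ : 𝓢(Plane, ℂ)) (x : Plane) :
    schwartzConv k ψ x = SchwartzMap.convolution (ContinuousLinearMap.mul ℂ ℂ) k ψ x := by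
  rw [SchwartzMap.convolution_apply, schwartzConv_eq]
  rfl

theorem memLp_schwartzConv (k : 𝓢(Plane, ℂ)) {f : Plane → ℂ} (hf : MemLp f 2) :
    MemLp (schwartzConv k f) 2 := by
  refine ⟨(schwartzConv_continuous k hf).aestronglyMeasurable, ?_⟩
  obtain ⟨g, hg, hfg⟩ := hf.aestronglyMeasurable
  rw [schwartzConv_congr k hfg]
  refine (eLpNorm_schwartzConv_le (by norm_num) (by norm_num) k hg.measurable).trans_lt ?_
  rw [← eLpNorm_congr_ae hfg]
  exact ENNReal.mul_lt_top (schwartz_lintegral_lt_top k) hf.eLpNorm_lt_top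

/-- On `L²`, convolution with the inverse Fourier transform of a Schwartz function `b` is the
Fourier multiplier with symbol `b`. -/
theorem schwartzConv_ae_eq_fourierInv (b : 𝓢(Plane, ℂ)) (f : L2Plane) :
    schwartzConv (𝓕⁻ b) f =ᵐ[volume]
      (𝓕⁻ ((ContinuousLinearMap.mul ℂ ℂ).holder 2 (b.toLp ⊤ volume) (𝓕 f : L2Plane)) :
        L2Plane) := by
  set R : L2Plane → L2Plane := fun f =>
    𝓕⁻ ((ContinuousLinearMap.mul ℂ ℂ).holder 2 (b.toLp ⊤ volume) (𝓕 f : L2Plane)) with hR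
  have hRc : Continuous R := by
    have h1 : Continuous fun f : L2Plane => (𝓕 f : L2Plane) :=
      FourierTransform.continuous_fourier
    have h2 : Continuous fun f : L2Plane => (𝓕⁻ f : L2Plane) :=
      FourierTransform.continuous_fourierInv
    exact h2.comp
      (((ContinuousLinearMap.mul ℂ ℂ).holderL volume ⊤ 2 2 (b.toLp ⊤ volume)).continuous.comp h1)
  set S : L2Plane → L2Plane := fun f => (memLp_schwartzConv (𝓕⁻ b) (Lp.memLp f)).toLp _ with hS
  have hSc : Continuous S := by
    have hlip : ∀ f g, edist (S f) (S g) ≤ (∫⁻ z, ‖(𝓕⁻ b : 𝓢(Plane, ℂ)) z‖ₑ) * edist f g := by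
      intro f g
      rw [hS, Lp.edist_toLp_toLp, ← schwartzConv_sub _ (Lp.memLp f) (Lp.memLp g),
        Lp.edist_def]
      refine eLpNorm_schwartzConv_le (by norm_num) (by norm_num) _ ?_
      exact ((Lp.stronglyMeasurable f).sub (Lp.stronglyMeasurable g)).measurable
    have hfin := (schwartz_lintegral_lt_top (𝓕⁻ b)).ne
    refine LipschitzWith.continuous (K := (∫⁻ z, ‖(𝓕⁻ b : 𝓢(Plane, ℂ)) z‖ₑ).toNNReal) ?_
    intro f g
    rw [ENNReal.coe_toNNReal hfin]
    exact hlip f g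
  -- both sides are continuous in `f` and agree on the dense set of Schwartz functions
  have hRS : S = R := by
    refine (SchwartzMap.denseRange_toLpCLM (E := Plane) (F := ℂ) (p := 2)
      (by norm_num)).equalizer hSc hRc ?_
    ext1 ψ
    simp only [Function.comp_apply, SchwartzMap.toLpCLM_apply, hS, hR]
    have h1 : ((ContinuousLinearMap.mul ℂ ℂ).holder 2 (b.toLp ⊤ volume)
          (𝓕 (ψ.toLp 2 volume) : L2Plane) : L2Plane) =
        (𝓕 (SchwartzMap.convolution (ContinuousLinearMap.mul ℂ ℂ) (𝓕⁻ b) ψ)).toLp 2 volume := by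
      rw [SchwartzMap.toLp_fourier_eq]
      ext1
      refine (ContinuousLinearMap.coeFn_holder (r := 2) _ _ _).trans ?_
      filter_upwards [b.coeFn_toLp ⊤ volume, (𝓕 ψ).coeFn_toLp 2 volume,
        (𝓕 (SchwartzMap.convolution (ContinuousLinearMap.mul ℂ ℂ) (𝓕⁻ b) ψ)).coeFn_toLp 2 volume]
        with x h1 h2 h3
      rw [h3, SchwartzMap.fourier_convolution_apply]
      have h4 := Real.fourier_bilin_convolution_eq (ContinuousLinearMap.mul ℂ ℂ)
        (𝓕⁻ b : 𝓢(Plane, ℂ)).integrable ψ.integrable x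
      rw [h4, ← SchwartzMap.fourier_coe, ← SchwartzMap.fourier_coe,
        FourierTransform.fourier_fourierInv_eq, h1, h2]
    rw [h1, ← SchwartzMap.toLp_fourier_eq, FourierTransform.fourierInv_fourier_eq]
    ext1
    refine (MemLp.coeFn_toLp _).trans ?_
    rw [schwartzConv_congr _ (ψ.coeFn_toLp 2 volume)]
    refine EventuallyEq.trans ?_ (SchwartzMap.coeFn_toLp _ 2 volume).symm
    exact Eventually.of_forall fun x => schwartzConv_coe_eq_convolution _ _ x
  have := congrFun hRS f
  refine (MemLp.coeFn_toLp (memLp_schwartzConv (𝓕⁻ b) (Lp.memLp f))).symm.trans ?_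
  change ⇑(S f) =ᵐ[volume] ⇑(R f)
  rw [this]

theorem schwartzConv_ae_eq {b : 𝓢(Plane, ℂ)} {f g : L2Plane}
    (h : ∀ᵐ ξ, (𝓕 g : L2Plane) ξ = b ξ * (𝓕 f : L2Plane) ξ) :
    schwartzConv (𝓕⁻ b) f =ᵐ[volume] g := by
  have h1 : (ContinuousLinearMap.mul ℂ ℂ).holder 2 (b.toLp ⊤ volume) (𝓕 f : L2Plane) =
      (𝓕 g : L2Plane) := by
    ext1
    refine (ContinuousLinearMap.coeFn_holder (r := 2) _ _ _).trans ?_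
    filter_upwards [b.coeFn_toLp ⊤ volume, h] with x h1 h2
    simp [h1, h2]
  refine (schwartzConv_ae_eq_fourierInv b f).trans ?_
  rw [h1, FourierTransform.fourierInv_fourier_eq]

theorem fourier_toLp_schwartzConv (b : 𝓢(Plane, ℂ)) (f : L2Plane) :
    (𝓕 ((memLp_schwartzConv (𝓕⁻ b) (Lp.memLp f)).toLp _) : L2Plane) =ᵐ[volume]
      fun ξ => b ξ * (𝓕 f : L2Plane) ξ := by
  have h1 : (memLp_schwartzConv (𝓕⁻ b) (Lp.memLp f)).toLp _ =
      (𝓕⁻ ((ContinuousLinearMap.mul ℂ ℂ).holder 2 (b.toLp ⊤ volume) (𝓕 f : L2Plane)) :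
          L2Plane) := by
    ext1
    exact (MemLp.coeFn_toLp _).trans (schwartzConv_ae_eq_fourierInv b f)
  rw [h1, FourierTransform.fourier_fourierInv_eq]
  refine (ContinuousLinearMap.coeFn_holder (r := 2) _ _ _).trans ?_
  filter_upwards [b.coeFn_toLp ⊤ volume] with x h1
  simp [h1]

theorem eLpNorm_schwartzConv_two (b : 𝓢(Plane, ℂ)) (f : L2Plane) :
    eLpNorm (schwartzConv (𝓕⁻ b) f) 2 = eLpNorm (fun ξ => b ξ * (𝓕 f : L2Plane) ξ) 2 := by
  rw [← eLpNorm_congr_ae (fourier_toLp_schwartzConv b f),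
    ← eLpNorm_congr_ae (MemLp.coeFn_toLp (memLp_schwartzConv (𝓕⁻ b) (Lp.memLp f))),
    ← Lp.enorm_def, ← Lp.enorm_def, ← ofReal_norm, ← ofReal_norm, Lp.norm_fourier_eq]

/-- If two functions of `L²` have Fourier transforms that differ by the factor `σ`, then a
multiplier applied to one of them can be traded for a multiplier applied to the other. -/
theorem schwartzConv_eq_of_symbol {b b' : 𝓢(Plane, ℂ)} {σ : Plane → ℂ} {f v : L2Plane}
    (hv : ∀ᵐ ξ, (𝓕 v : L2Plane) ξ = σ ξ * (𝓕 f : L2Plane) ξ) (hb : ∀ ξ, b ξ = b' ξ * σ ξ) :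
    schwartzConv (𝓕⁻ b) f = schwartzConv (𝓕⁻ b') v := by
  have h := schwartzConv_ae_eq (b := b) (f := f)
    (g := (memLp_schwartzConv (𝓕⁻ b') (Lp.memLp v)).toLp _) (by
      filter_upwards [hv, fourier_toLp_schwartzConv b' v] with ξ h1 h2
      rw [h2, h1, hb]; ring)
  refine (schwartzConv_continuous _ (Lp.memLp f)).ae_eq_iff_eq volume
    (schwartzConv_continuous _ (Lp.memLp v)) |>.1 ?_
  exact h.trans (MemLp.coeFn_toLp _)

/-! ### Kernel norms of smooth symbols -/

/-- The `L¹` norm of the convolution kernel of the Fourier multiplier with symbol `b`. -/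
noncomputable def kernelNorm (b : Plane → ℂ) : ℝ≥0∞ := ∫⁻ x, ‖𝓕⁻ b x‖ₑ

/-- The first absolute moment of the convolution kernel of the multiplier with symbol `b`. -/
noncomputable def kernelMoment (b : Plane → ℂ) : ℝ≥0∞ := ∫⁻ x, ‖x‖ₑ * ‖𝓕⁻ b x‖ₑ

theorem lintegral_comp_smul_plane (f : Plane → ℝ≥0∞) {c : ℝ} (hc : 0 < c) :
    ∫⁻ x, f (c • x) = ENNReal.ofReal (c ^ (-2 : ℤ)) * ∫⁻ x, f x := by
  have h := Measure.map_addHaar_smul (volume : Measure Plane) hc.ne'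
  have he : MeasurableEmbedding fun x : Plane => c • x :=
    (Homeomorph.smulOfNeZero c hc.ne').measurableEmbedding
  rw [← he.lintegral_map f, h, lintegral_smul_measure]
  simp only [finrank_euclideanSpace, Fintype.card_fin, smul_eq_mul]
  congr 2
  rw [abs_of_pos (by positivity)]
  rw [zpow_neg]; norm_cast

theorem fourierInv_comp_smul (b : Plane → ℂ) {c : ℝ} (hc : 0 < c) (x : Plane) :
    𝓕⁻ (fun ξ => b (c • ξ)) x = ((c ^ (-2 : ℤ) : ℝ) : ℂ) * 𝓕⁻ b (c⁻¹ • x) := by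
  rw [Real.fourierInv_eq, Real.fourierInv_eq]
  have h := Measure.integral_comp_smul (volume : Measure Plane)
    (fun ξ => Real.fourierChar (inner ℝ ξ (c⁻¹ • x)) • b ξ) c
  have h2 : ∀ ξ : Plane, inner ℝ (c • ξ) (c⁻¹ • x) = inner ℝ ξ x := by
    intro ξ
    rw [inner_smul_left, inner_smul_right]
    simp [hc.ne']
  simp only [h2] at h
  rw [h]
  simp only [finrank_euclideanSpace, Fintype.card_fin]
  rw [abs_of_pos (by positivity), Complex.real_smul]
  congr 2

theorem kernelNorm_comp_smul (b : Plane → ℂ) {c : ℝ} (hc : 0 < c) :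
    kernelNorm (fun ξ => b (c • ξ)) = kernelNorm b := by
  unfold kernelNorm
  simp_rw [fourierInv_comp_smul b hc, enorm_mul]
  rw [lintegral_const_mul' _ _ (by finiteness),
    lintegral_comp_smul_plane (fun x => ‖𝓕⁻ b x‖ₑ) (inv_pos.2 hc), ← mul_assoc]
  have : ‖((c ^ (-2 : ℤ) : ℝ) : ℂ)‖ₑ * ENNReal.ofReal (c⁻¹ ^ (-2 : ℤ)) = 1 := by
    rw [← ofReal_norm, Complex.norm_real, Real.norm_of_nonneg (by positivity),
      ← ENNReal.ofReal_mul (by positivity), ← mul_zpow, mul_inv_cancel₀ hc.ne']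
    simp
  rw [this, one_mul]

theorem kernelMoment_comp_smul (b : Plane → ℂ) {c : ℝ} (hc : 0 < c) :
    kernelMoment (fun ξ => b (c • ξ)) = ENNReal.ofReal c * kernelMoment b := by
  unfold kernelMoment
  have h1 : ∀ x : Plane, ‖x‖ₑ * ‖𝓕⁻ (fun ξ => b (c • ξ)) x‖ₑ =
      (ENNReal.ofReal c * ‖((c ^ (-2 : ℤ) : ℝ) : ℂ)‖ₑ) *
        (fun x => ‖x‖ₑ * ‖𝓕⁻ b x‖ₑ) (c⁻¹ • x) := by
    intro x
    have h2 : ‖x‖ₑ = ENNReal.ofReal c * ‖c⁻¹ • x‖ₑ := by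
      rw [enorm_smul, ← ofReal_norm (c⁻¹), ← mul_assoc, ← ENNReal.ofReal_mul hc.le,
        Real.norm_of_nonneg (by positivity), mul_inv_cancel₀ hc.ne']
      simp
    simp only
    rw [fourierInv_comp_smul b hc, enorm_mul, h2]
    ring
  simp_rw [h1]
  rw [lintegral_const_mul' _ _ (by finiteness),
    lintegral_comp_smul_plane (fun x => ‖x‖ₑ * ‖𝓕⁻ b x‖ₑ) (inv_pos.2 hc), ← mul_assoc]
  have : ‖((c ^ (-2 : ℤ) : ℝ) : ℂ)‖ₑ * ENNReal.ofReal (c⁻¹ ^ (-2 : ℤ)) = 1 := by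
    rw [← ofReal_norm, Complex.norm_real, Real.norm_of_nonneg (by positivity),
      ← ENNReal.ofReal_mul (by positivity), ← mul_zpow, mul_inv_cancel₀ hc.ne']
    simp
  rw [mul_assoc (ENNReal.ofReal c), this, mul_one]

/-- Smooth compactly supported symbols on the plane. -/
def IsTestSymbol (b : Plane → ℂ) : Prop := ContDiff ℝ ∞ b ∧ HasCompactSupport b

theorem IsTestSymbol.integrable {b : Plane → ℂ} (h : IsTestSymbol b) : Integrable b :=
  h.1.continuous.integrable_of_hasCompactSupport h.2

theorem fourierInv_continuous {b : Plane → ℂ} (h : Integrable b) : Continuous (𝓕⁻ b) := by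
  have h1 : (𝓕⁻ b) = fun x => 𝓕 b (-x) := by
    ext x; exact Real.fourierInv_eq_fourier_neg b x
  rw [h1]
  exact (VectorFourier.fourierIntegral_continuous Real.continuous_fourierChar
    (by exact continuous_inner) h).comp continuous_neg

theorem fourierInv_add_of_integrable {b b' : Plane → ℂ} (h : Integrable b) (h' : Integrable b') :
    𝓕⁻ (b + b') = 𝓕⁻ b + 𝓕⁻ b' := by
  ext x
  simp only [Real.fourierInv_eq, Pi.add_apply, smul_add]
  refine integral_add ?_ ?_
  · simpa using (Real.fourierIntegral_convergent_iff (-x)).2 h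
  · simpa using (Real.fourierIntegral_convergent_iff (-x)).2 h'

theorem kernelNorm_add_le {b b' : Plane → ℂ} (h : Integrable b) (h' : Integrable b') :
    kernelNorm (b + b') ≤ kernelNorm b + kernelNorm b' := by
  unfold kernelNorm
  rw [fourierInv_add_of_integrable h h',
    ← lintegral_add_left (fourierInv_continuous h).measurable.enorm]
  exact lintegral_mono fun x => enorm_add_le _ _

theorem kernelMoment_add_le {b b' : Plane → ℂ} (h : Integrable b) (h' : Integrable b') :
    kernelMoment (b + b') ≤ kernelMoment b + kernelMoment b' := by
  unfold kernelMoment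
  have hm : Measurable fun x : Plane => ‖x‖ₑ * ‖𝓕⁻ b x‖ₑ :=
    measurable_enorm.mul (fourierInv_continuous h).measurable.enorm
  rw [fourierInv_add_of_integrable h h', ← lintegral_add_left hm]
  refine lintegral_mono fun x => ?_
  rw [← mul_add]
  gcongr
  exact enorm_add_le _ _

theorem fourierInv_const_mul (c : ℂ) (b : Plane → ℂ) (x : Plane) :
    𝓕⁻ (fun ξ => c * b ξ) x = c * 𝓕⁻ b x := by
  simp only [Real.fourierInv_eq, Circle.smul_def, smul_eq_mul]
  rw [← integral_const_mul]
  congr 1; ext ξ; ring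

theorem kernelNorm_const_mul (c : ℂ) (b : Plane → ℂ) :
    kernelNorm (fun ξ => c * b ξ) = ‖c‖ₑ * kernelNorm b := by
  unfold kernelNorm
  simp_rw [fourierInv_const_mul, enorm_mul]
  rw [lintegral_const_mul' _ _ (by finiteness)]

theorem kernelMoment_const_mul (c : ℂ) (b : Plane → ℂ) :
    kernelMoment (fun ξ => c * b ξ) = ‖c‖ₑ * kernelMoment b := by
  unfold kernelMoment
  simp_rw [fourierInv_const_mul, enorm_mul, mul_left_comm _ ‖c‖ₑ]
  rw [lintegral_const_mul' _ _ (by finiteness)]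

/-- Fixing the parameter `l` does not increase the derivatives. -/
theorem norm_iteratedFDeriv_slice_le {a : ℝ × Plane → ℂ} (ha : ContDiff ℝ ∞ a) (n : ℕ) (l : ℝ)
    (z : Plane) :
    ‖iteratedFDeriv ℝ n (fun z => a (l, z)) z‖ ≤ ‖iteratedFDeriv ℝ n a (l, z)‖ := by
  have h1 : (fun z => a (l, z)) =
      (fun q => a ((l, 0) + q)) ∘ (ContinuousLinearMap.inr ℝ ℝ Plane) := by
    ext z; simp
  have h2 : ContDiff ℝ ∞ fun q => a ((l, 0) + q) := ha.comp (by fun_prop)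
  rw [h1, ContinuousLinearMap.iteratedFDeriv_comp_right _ h2 z (by exact_mod_cast le_top),
    iteratedFDeriv_comp_add_left]
  refine (ContinuousMultilinearMap.norm_compContinuousLinearMap_le _ _).trans ?_
  have h3 : ∏ _i : Fin n, ‖ContinuousLinearMap.inr ℝ ℝ Plane‖ ≤ 1 :=
    Finset.prod_le_one (fun _ _ => norm_nonneg _)
      fun _ _ => ContinuousLinearMap.norm_inr_le_one ℝ ℝ Plane
  refine (mul_le_of_le_one_right (norm_nonneg _) h3).trans ?_
  simp

/-- The kernel norms of a family of symbols that depends smoothly on a parameter and has compact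
support, the parameter included, are bounded uniformly in the parameter. -/
theorem exists_kernel_bound_of_family {a : ℝ × Plane → ℂ} (ha : ContDiff ℝ ∞ a)
    (hs : HasCompactSupport a) :
    ∃ C : ℝ≥0, ∀ l, kernelNorm (fun z => a (l, z)) ≤ C ∧ kernelMoment (fun z => a (l, z)) ≤ C := by
  obtain ⟨R, hR⟩ : ∃ R, ∀ l z, R < ‖z‖ → (l, z) ∉ tsupport a := by
    obtain ⟨R, hR⟩ := hs.isCompact.isBounded.exists_norm_le
    refine ⟨R, fun l z hz hmem => ?_⟩
    have h := hR _ hmem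
    have h2 : ‖z‖ ≤ ‖((l, z) : ℝ × Plane)‖ := by simp
    linarith
  -- the parameter ranges over a compact set, so all bounds are uniform in it
  have hD : ∀ n : ℕ, ∃ M : ℝ, 0 ≤ M ∧ ∀ q, ‖iteratedFDeriv ℝ n a q‖ ≤ M := by
    intro n
    have h1 : Continuous (iteratedFDeriv ℝ n a) :=
      ha.continuous_iteratedFDeriv (by exact_mod_cast le_top)
    obtain ⟨M, hM⟩ := h1.bounded_above_of_compact_support (hs.iteratedFDeriv n)
    exact ⟨M, (norm_nonneg _).trans (hM 0), hM⟩
  choose M hM0 hM using hD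
  have hzero : ∀ n l z, R < ‖z‖ → iteratedFDeriv ℝ n (fun z => a (l, z)) z = 0 := by
    intro n l z hz
    have h1 := norm_iteratedFDeriv_slice_le ha n l z
    have h2 : iteratedFDeriv ℝ n a (l, z) = 0 := by
      by_contra hne
      exact hR l z hz (support_iteratedFDeriv_subset n hne)
    rw [h2, norm_zero] at h1
    exact norm_le_zero_iff.1 h1
  have hslice : ∀ l, ContDiff ℝ ∞ fun z => a (l, z) := fun l => ha.comp (by fun_prop)
  set V : ℝ := (volume : Measure Plane).real (Metric.closedBall 0 R) with hV
  have hdom : ∀ n l, Integrable (fun z => ‖iteratedFDeriv ℝ n (fun z => a (l, z)) z‖) ∧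
      ∫ z, ‖iteratedFDeriv ℝ n (fun z => a (l, z)) z‖ ≤ M n * V := by
    intro n l
    have h1 : ∀ z, ‖iteratedFDeriv ℝ n (fun z => a (l, z)) z‖ ≤
        (Metric.closedBall (0 : Plane) R).indicator (fun _ => M n) z := by
      intro z
      by_cases hz : z ∈ Metric.closedBall (0 : Plane) R
      · rw [indicator_of_mem hz]
        exact (norm_iteratedFDeriv_slice_le ha n l z).trans (hM n _)
      · rw [indicator_of_notMem hz, hzero n l z (by simpa using hz), norm_zero]
    have h2 : Integrable ((Metric.closedBall (0 : Plane) R).indicator (fun _ => M n)) := by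
      refine (integrable_indicator_iff measurableSet_closedBall).2 ?_
      exact integrableOn_const (measure_closedBall_lt_top.ne)
    have h3 : Continuous fun z => ‖iteratedFDeriv ℝ n (fun z => a (l, z)) z‖ :=
      ((hslice l).continuous_iteratedFDeriv (by exact_mod_cast le_top)).norm
    refine ⟨h2.mono' h3.aestronglyMeasurable (Eventually.of_forall fun z => by
      rw [norm_norm]; exact h1 z), ?_⟩
    refine (integral_mono_of_nonneg (Eventually.of_forall fun z => norm_nonneg _) h2
      (Eventually.of_forall h1)).trans ?_
    rw [integral_indicator measurableSet_closedBall, setIntegral_const, smul_eq_mul, mul_comm]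
  have hF : ∀ n : ℕ, ∃ K : ℝ, 0 ≤ K ∧ ∀ l x, ‖x‖ ^ n * ‖𝓕⁻ (fun z => a (l, z)) x‖ ≤ K := by
    intro n
    refine ⟨(2 * ((0 : ℕ) : ℝ) + 2) ^ n * ∑ p ∈ Finset.range (n + 1), M p * V, ?_, ?_⟩
    · have : ∀ p ∈ Finset.range (n + 1), 0 ≤ M p * V := fun p _ =>
        mul_nonneg (hM0 p) measureReal_nonneg
      have := Finset.sum_nonneg this
      positivity
    · intro l x
      have h := Real.pow_mul_norm_iteratedFDeriv_fourier_le (K := 0) (N := n) (k := 0) (n := n)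
        ((hslice l).of_le (by exact_mod_cast le_top)) (by
          intro k m hk hm
          have hk0 : k = 0 := by simpa using hk
          subst hk0
          simpa using (hdom m l).1) le_rfl le_rfl (-x)
      rw [norm_neg, norm_iteratedFDeriv_zero, ← Real.fourierInv_eq_fourier_neg] at h
      refine h.trans ?_
      rw [pow_zero, one_mul]
      gcongr
      rw [Finset.sum_product]
      simp only [zero_add, Finset.range_one, Finset.sum_singleton, pow_zero, one_mul]
      exact Finset.sum_le_sum fun p _ => (hdom p l).2
  -- the orders `0` and `4` bound the kernel by a multiple of `(1 + |x|)⁻⁴`, which in dimension two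
  -- is integrable together with its first moment
  obtain ⟨K0, hK00, hK0⟩ := hF 0
  obtain ⟨K4, hK40, hK4⟩ := hF 4
  have hb : ∀ l x, ‖𝓕⁻ (fun z => a (l, z)) x‖ ≤ 8 * (K0 + K4) * (1 + ‖x‖) ^ (-4 : ℝ) := by
    intro l x
    have h0 := hK0 l x
    have h4 := hK4 l x
    set A := ‖𝓕⁻ (fun z => a (l, z)) x‖
    have hA : 0 ≤ A := norm_nonneg _
    have hx := norm_nonneg x
    rw [Real.rpow_neg (by positivity), show ((4 : ℝ)) = ((4 : ℕ) : ℝ) by norm_num,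
      Real.rpow_natCast, ← div_eq_mul_inv, le_div_iff₀ (by positivity)]
    have h5 : (1 + ‖x‖) ^ 4 ≤ 8 * (1 + ‖x‖ ^ 4) := by
      nlinarith [sq_nonneg (‖x‖ - 1), sq_nonneg (‖x‖ ^ 2 - 1), sq_nonneg (‖x‖ ^ 2 - ‖x‖),
          mul_nonneg hx (sq_nonneg (‖x‖ - 1))]
    calc A * (1 + ‖x‖) ^ 4 ≤ A * (8 * (1 + ‖x‖ ^ 4)) := by gcongr
      _ = 8 * (‖x‖ ^ 0 * A + ‖x‖ ^ 4 * A) := by ring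
      _ ≤ _ := by linarith
  set D : ℝ := 8 * (K0 + K4)
  have hD0 : 0 ≤ D := by positivity
  have hI : ∀ r : ℝ, 2 < r → ∫⁻ x : Plane, ENNReal.ofReal (D * (1 + ‖x‖) ^ (-r)) < ⊤ := by
    intro r hr
    have : Integrable fun x : Plane => D * (1 + ‖x‖) ^ (-r) :=
      (integrable_one_add_norm (by simpa using hr)).const_mul D
    exact this.lintegral_lt_top
  have h4 := hI 4 (by norm_num)
  have h3 := hI 3 (by norm_num)
  refine ⟨(∫⁻ x : Plane, ENNReal.ofReal (D * (1 + ‖x‖) ^ (-(4 : ℝ)))).toNNReal +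
    (∫⁻ x : Plane, ENNReal.ofReal (D * (1 + ‖x‖) ^ (-(3 : ℝ)))).toNNReal, fun l => ⟨?_, ?_⟩⟩
  · rw [ENNReal.coe_add, ENNReal.coe_toNNReal h4.ne]
    refine le_add_right (lintegral_mono fun x => ?_)
    rw [← ofReal_norm]
    exact ENNReal.ofReal_le_ofReal (hb l x)
  · rw [ENNReal.coe_add, ENNReal.coe_toNNReal h3.ne]
    refine le_add_left (lintegral_mono fun x => ?_)
    rw [← ofReal_norm, ← ofReal_norm, ← ENNReal.ofReal_mul (norm_nonneg _)]
    refine ENNReal.ofReal_le_ofReal ?_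
    have hx := norm_nonneg x
    calc ‖x‖ * ‖𝓕⁻ (fun z => a (l, z)) x‖ ≤ (1 + ‖x‖) * (D * (1 + ‖x‖) ^ (-4 : ℝ)) := by
          gcongr
          · linarith
          · exact hb l x
      _ = D * (1 + ‖x‖) ^ (-3 : ℝ) := by
          rw [mul_left_comm]
          congr 1
          nth_rewrite 1 [← Real.rpow_one (1 + ‖x‖)]
          rw [← Real.rpow_add (by positivity)]
          norm_num

/-! ### Dyadic estimates for the symbols -/

/-- A smooth cutoff, equal to `1` on the unit ball and to `0` off the ball of radius `2`. -/
noncomputable def freqBump : ContDiffBump (0 : Plane) := ⟨1, 2, one_pos, one_lt_two⟩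

/-- The function `freqBump (z / 2) - freqBump z`, which is supported in `1 ≤ |z| ≤ 4`. -/
noncomputable def annulusBump (z : Plane) : ℝ := freqBump ((2 : ℝ)⁻¹ • z) - freqBump z

theorem freqBump_contDiff : ContDiff ℝ ∞ (freqBump : Plane → ℝ) := freqBump.contDiff

theorem freqBump_eq_one {z : Plane} (h : ‖z‖ ≤ 1) : freqBump z = 1 :=
  freqBump.one_of_mem_closedBall (by simpa [freqBump] using h)

theorem freqBump_eq_zero {z : Plane} (h : 2 ≤ ‖z‖) : freqBump z = 0 :=
  freqBump.zero_of_le_dist (by simpa [freqBump] using h)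

theorem annulusBump_contDiff : ContDiff ℝ ∞ annulusBump :=
  (freqBump_contDiff.comp (contDiff_const_smul _)).sub freqBump_contDiff

theorem annulusBump_eq_zero_of_le {z : Plane} (h : ‖z‖ ≤ 1) : annulusBump z = 0 := by
  rw [annulusBump, freqBump_eq_one h, freqBump_eq_one, sub_self]
  rw [norm_smul]
  norm_num
  linarith

theorem annulusBump_eq_zero_of_ge {z : Plane} (h : 4 ≤ ‖z‖) : annulusBump z = 0 := by
  rw [annulusBump, freqBump_eq_zero (z := z) (by linarith), freqBump_eq_zero, sub_self]
  rw [norm_smul]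
  norm_num
  linarith

theorem hasCompactSupport_of_norm {b : Plane → ℂ} (R : ℝ) (h : ∀ z, R ≤ ‖z‖ → b z = 0) :
    HasCompactSupport b := by
  refine HasCompactSupport.intro (isCompact_closedBall (0 : Plane) R) fun z hz => h z ?_
  simp at hz
  exact hz.le

theorem zero_notMem_tsupport {b : Plane → ℂ} (h : ∀ z, ‖z‖ ≤ 1 / 8 → b z = 0) :
    (0 : Plane) ∉ tsupport b := by
  rw [notMem_tsupport_iff_eventuallyEq]
  filter_upwards [Metric.ball_mem_nhds (0 : Plane) (ε := 1 / 8) (by norm_num)] with z hz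
  exact h z (mem_ball_zero_iff.1 hz).le

theorem zero_notMem_tsupport_annulus {g : Plane → ℂ} :
    (0 : Plane) ∉ tsupport (fun z => (annulusBump z : ℂ) * g z) :=
  zero_notMem_tsupport fun z hz => by
    simp [annulusBump_eq_zero_of_le (z := z) (by linarith)]

theorem hasCompactSupport_annulus {g : Plane → ℂ} :
    HasCompactSupport (fun z => (annulusBump z : ℂ) * g z) :=
  hasCompactSupport_of_norm 4 fun z hz => by simp [annulusBump_eq_zero_of_ge hz]

theorem contDiff_of_zero_notMem_tsupport {F : Type*} [NormedAddCommGroup F] [NormedSpace ℝ F]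
    {b : Plane → F} (h0 : (0 : Plane) ∉ tsupport b)
    (h : ∀ z ≠ 0, ContDiffAt ℝ ∞ b z) : ContDiff ℝ ∞ b := by
  rw [contDiff_iff_contDiffAt]
  intro z
  by_cases hz : z = 0
  · subst hz
    exact (contDiffAt_const (c := (0 : F))).congr_of_eventuallyEq
      (notMem_tsupport_iff_eventuallyEq.1 h0)
  · exact h z hz

theorem contDiff_annulus_mul {g : Plane → ℂ} (hg : ∀ z ≠ 0, ContDiffAt ℝ ∞ g z) :
    ContDiff ℝ ∞ (fun z => (annulusBump z : ℂ) * g z) :=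
  contDiff_of_zero_notMem_tsupport zero_notMem_tsupport_annulus fun z hz =>
    (Complex.ofRealCLM.contDiff.contDiffAt.comp z annulusBump_contDiff.contDiffAt).mul (hg z hz)

/-- Uniform kernel bounds for the symbols `(c + l² + |z|²)^(-1/2) θ(z)`, `0 ≤ l ≤ 8`. When `c = 0`
the origin has to be excluded from the support of `θ`. -/
theorem exists_kernel_bound_bracket {θ : Plane → ℂ} (hθ : ContDiff ℝ ∞ θ)
    (hs : HasCompactSupport θ) {c : ℝ} (hc : 0 ≤ c) (h0 : 0 < c ∨ (0 : Plane) ∉ tsupport θ) :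
    ∃ C : ℝ≥0, ∀ l ∈ Icc (0 : ℝ) 8,
      kernelNorm (fun z => ((√(c + l ^ 2 + ‖z‖ ^ 2))⁻¹ : ℝ) * θ z) ≤ C := by
  -- cutting off in `l` gives the family compact support, the parameter included
  let χ : ContDiffBump (0 : ℝ) := ⟨8, 9, by norm_num, by norm_num⟩
  set a : ℝ × Plane → ℂ := fun q =>
    (((√(c + q.1 ^ 2 + ‖q.2‖ ^ 2))⁻¹ : ℝ) * θ q.2) * (χ q.1 : ℂ) with ha
  have hsm : ContDiff ℝ ∞ a := by
    rw [contDiff_iff_contDiffAt]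
    rintro ⟨l, z⟩
    by_cases hz : z ∈ tsupport θ
    · have hpos : 0 < c + l ^ 2 + ‖z‖ ^ 2 := by
        rcases h0 with h0 | h0
        · positivity
        · have hz0 : z ≠ 0 := fun h => h0 (h ▸ hz)
          have := norm_pos_iff.2 hz0
          positivity
      have h1 : ContDiffAt ℝ ∞ (fun q : ℝ × Plane => c + q.1 ^ 2 + ‖q.2‖ ^ 2) (l, z) :=
        (contDiffAt_const.add (contDiffAt_fst.pow 2)).add (contDiffAt_snd.norm_sq ℝ)
      have h2 : ContDiffAt ℝ ∞ (fun q : ℝ × Plane => (√(c + q.1 ^ 2 + ‖q.2‖ ^ 2))⁻¹) (l, z) :=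
        (h1.sqrt hpos.ne').inv (Real.sqrt_ne_zero'.2 hpos)
      have h3 : ContDiffAt ℝ ∞ (fun q : ℝ × Plane => (χ q.1 : ℝ)) (l, z) :=
        χ.contDiff.contDiffAt.comp (l, z) contDiffAt_fst
      exact ((Complex.ofRealCLM.contDiff.contDiffAt.comp _ h2).mul
        (hθ.contDiffAt.comp _ contDiffAt_snd)).mul (Complex.ofRealCLM.contDiff.contDiffAt.comp _ h3)
    · refine (contDiffAt_const (c := (0 : ℂ))).congr_of_eventuallyEq ?_
      have h1 := notMem_tsupport_iff_eventuallyEq.1 hz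
      have h2 : Tendsto (fun q : ℝ × Plane => q.2) (𝓝 (l, z)) (𝓝 z) := continuous_snd.tendsto _
      filter_upwards [h2.eventually h1] with q hq
      simp only [Pi.zero_apply] at hq
      simp [ha, hq]
  have hcs : HasCompactSupport a := by
    refine HasCompactSupport.intro
      ((isCompact_closedBall (0 : ℝ) 9).prod hs.isCompact) fun q hq => ?_
    by_cases h1 : q.2 ∈ tsupport θ
    · have h2 : q.1 ∉ Metric.closedBall (0 : ℝ) 9 := fun h => hq ⟨h, h1⟩
      have h3 : χ q.1 = 0 := χ.zero_of_le_dist (by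
        simp only [Metric.mem_closedBall, not_le] at h2
        exact h2.le)
      simp [ha, h3]
    · simp [ha, image_eq_zero_of_notMem_tsupport h1]
  obtain ⟨C, hC⟩ := exists_kernel_bound_of_family hsm hcs
  refine ⟨C, fun l hl => ?_⟩
  have h1 := (hC l).1
  have h2 : χ l = 1 := χ.one_of_mem_closedBall (by
    simp only [Metric.mem_closedBall, Real.dist_0_eq_abs]
    rw [abs_of_nonneg hl.1]; exact hl.2)
  simpa [ha, h2] using h1

/-- Increments that decay geometrically add up to a bounded amount. -/
theorem exists_bound_of_le_add_geometric {r : ℝ≥0∞} (hr : r < 1) {A B₀ : ℝ≥0∞} (hA : A ≠ ⊤)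
    (hB : B₀ ≠ ⊤) :
    ∃ C : ℝ≥0, ∀ B : ℕ → ℝ≥0∞, B 0 ≤ B₀ → (∀ j, B (j + 1) ≤ B j + A * r ^ j) → ∀ j, B j ≤ C := by
  have hfin : B₀ + A * (1 - r)⁻¹ ≠ ⊤ := by
    refine ENNReal.add_ne_top.2 ⟨hB, ENNReal.mul_ne_top hA ?_⟩
    exact ENNReal.inv_ne_top.2 (tsub_pos_of_lt hr).ne'
  refine ⟨(B₀ + A * (1 - r)⁻¹).toNNReal, fun B h0 hst j => ?_⟩
  rw [ENNReal.coe_toNNReal hfin]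
  have h1 : ∀ j, B j ≤ B₀ + A * ∑ i ∈ Finset.range j, r ^ i := by
    intro j
    induction j with
    | zero => simpa using h0
    | succ j ih =>
      rw [Finset.sum_range_succ, mul_add, ← add_assoc]
      exact (hst j).trans (by gcongr)
  refine (h1 j).trans ?_
  gcongr
  rw [← ENNReal.tsum_geometric]
  exact ENNReal.sum_le_tsum _

section

variable {s : ℝ} {φ : ℝ → ℝ}

theorem IsIProfile.contDiff_comp_norm (hφ : IsIProfile s φ) :
    ContDiff ℝ ∞ fun z : Plane => φ ‖z‖ := by
  rw [contDiff_iff_contDiffAt]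
  intro z
  by_cases hz : z = 0
  · refine (contDiffAt_const (c := (1 : ℝ))).congr_of_eventuallyEq ?_
    filter_upwards [Metric.ball_mem_nhds z one_pos] with y hy
    rw [hz] at hy
    exact hφ.eq_one _ (mem_ball_zero_iff.1 hy).le
  · exact hφ.smooth.contDiffAt.comp z (contDiffAt_norm ℝ hz)

/-- The symbol of the operator `I`, cut off at the frequency `2 ^ J`. -/
noncomputable def iSymbol (φ : ℝ → ℝ) (J : ℕ) (z : Plane) : ℝ :=
  φ ‖z‖ * freqBump (((2 : ℝ) ^ J)⁻¹ • z)

/-- The symbol of `(1 - P) (⟨D⟩ I)⁻¹`, cut off at the frequency `2 ^ J`, where `P` is the projection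
to low frequencies. All frequencies are measured in units of the parameter `N` of `I`, and
`l = 1 / N`; the factor `1 / N` is left out. -/
noncomputable def highSymbol (φ : ℝ → ℝ) (J : ℕ) (l : ℝ) (z : Plane) : ℝ :=
  (√(l ^ 2 + ‖z‖ ^ 2))⁻¹ * ((freqBump (((2 : ℝ) ^ J)⁻¹ • z) - freqBump ((8 : ℝ) • z)) * (φ ‖z‖)⁻¹)

theorem inv_two_pow_succ_smul (J : ℕ) (z : Plane) :
    ((2 : ℝ) ^ (J + 1))⁻¹ • z = (2 : ℝ)⁻¹ • (((2 : ℝ) ^ J)⁻¹ • z) := by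
  rw [smul_smul, pow_succ, mul_inv_rev]

theorem freqBump_smul_contDiff (c : ℝ) : ContDiff ℝ ∞ fun z : Plane => freqBump (c • z) :=
  freqBump_contDiff.comp (contDiff_const_smul c)

theorem freqBump_scaled_eq_zero {J : ℕ} {z : Plane} (hz : 2 * 2 ^ J ≤ ‖z‖) :
    freqBump (((2 : ℝ) ^ J)⁻¹ • z) = 0 := by
  refine freqBump_eq_zero ?_
  rw [norm_smul, norm_inv, norm_pow, Real.norm_ofNat, inv_mul_eq_div, le_div_iff₀ (by positivity)]
  exact hz

theorem isTestSymbol_iSymbol (hφ : IsIProfile s φ) (J : ℕ) :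
    IsTestSymbol fun z => (iSymbol φ J z : ℂ) := by
  refine ⟨Complex.ofRealCLM.contDiff.comp (hφ.contDiff_comp_norm.mul (freqBump_smul_contDiff _)),
    hasCompactSupport_of_norm (2 * 2 ^ J) fun z hz => ?_⟩
  simp [iSymbol, freqBump_scaled_eq_zero hz]

/-- On the part of the frequency space where the cutoffs at `2 ^ J` and `2 ^ (J + 1)` differ, the
profile is a power. -/
theorem IsIProfile.annulus_eq (hφ : IsIProfile s φ) {J : ℕ} (hJ : 1 ≤ J) (z : Plane) (a : ℝ)
    (g : ℝ → ℝ) (hg : ∀ x, 0 < x → g ((2 ^ J * x) ^ (s - 1)) = (2 : ℝ) ^ (J * a) * x ^ a) :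
    g (φ ‖z‖) * annulusBump (((2 : ℝ) ^ J)⁻¹ • z) =
      (2 : ℝ) ^ (J * a) * (‖((2 : ℝ) ^ J)⁻¹ • z‖ ^ a * annulusBump (((2 : ℝ) ^ J)⁻¹ • z)) := by
  have hn : ‖((2 : ℝ) ^ J)⁻¹ • z‖ = ‖z‖ / 2 ^ J := by
    rw [norm_smul, norm_inv, norm_pow, Real.norm_ofNat, inv_mul_eq_div]
  by_cases h : ‖((2 : ℝ) ^ J)⁻¹ • z‖ ≤ 1
  · simp [annulusBump_eq_zero_of_le h]
  · push Not at h
    have h2 : (2 : ℝ) ≤ 2 ^ J := by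
      calc (2 : ℝ) = 2 ^ 1 := by norm_num
        _ ≤ 2 ^ J := pow_le_pow_right₀ (by norm_num) hJ
    have h3 : ‖z‖ = 2 ^ J * ‖((2 : ℝ) ^ J)⁻¹ • z‖ := by rw [hn]; field_simp
    rw [hφ.eq_rpow ‖z‖ (by rw [h3]; nlinarith), h3, hg _ (by linarith)]
    ring

theorem contDiffAt_norm_rpow {z : Plane} (hz : z ≠ 0) (a : ℝ) :
    ContDiffAt ℝ ∞ (fun z : Plane => ((‖z‖ ^ a : ℝ) : ℂ)) z :=
  Complex.ofRealCLM.contDiff.contDiffAt.comp z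
    ((contDiffAt_norm ℝ hz).rpow_const_of_ne (norm_ne_zero_iff.2 hz))

theorem two_rpow_mul_nat (a : ℝ) (J : ℕ) : (2 : ℝ) ^ (J * a) = ((2 : ℝ) ^ a) ^ J := by
  rw [mul_comm, Real.rpow_mul (by norm_num), Real.rpow_natCast]

theorem exists_bound_iSymbol (hs1 : s < 1) (hφ : IsIProfile s φ) :
    ∃ C : ℝ≥0, ∀ J, kernelNorm (fun z => (iSymbol φ (J + 1) z : ℂ)) ≤ C ∧
      kernelMoment (fun z => (iSymbol φ (J + 1) z : ℂ)) ≤ C := by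
  -- the symbols of two consecutive cutoffs differ by a dilate of a fixed function
  set θ : Plane → ℂ := fun z => (annulusBump z : ℂ) * ((‖z‖ ^ (s - 1) : ℝ) : ℂ) with hθ
  have hθt : IsTestSymbol θ :=
    ⟨contDiff_annulus_mul fun z hz => contDiffAt_norm_rpow hz _, hasCompactSupport_annulus⟩
  -- a single symbol is a family that does not depend on its parameter near `0`
  have hfam : ∀ {b : Plane → ℂ}, IsTestSymbol b →
      ∃ C : ℝ≥0, kernelNorm b ≤ C ∧ kernelMoment b ≤ C := by
    intro b hb
    let χ : ContDiffBump (0 : ℝ) := ⟨1, 2, by norm_num, by norm_num⟩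
    have h1 : ContDiff ℝ ∞ fun q : ℝ × Plane => (χ q.1 : ℂ) * b q.2 :=
      (Complex.ofRealCLM.contDiff.comp (χ.contDiff.comp contDiff_fst)).mul
        (hb.1.comp contDiff_snd)
    have h2 : HasCompactSupport fun q : ℝ × Plane => (χ q.1 : ℂ) * b q.2 := by
      refine HasCompactSupport.intro (χ.hasCompactSupport.isCompact.prod hb.2.isCompact)
        fun q hq => ?_
      by_cases h1 : q.2 ∈ tsupport b
      · have h2 : q.1 ∉ tsupport χ := fun h => hq ⟨h, h1⟩
        simp [image_eq_zero_of_notMem_tsupport h2]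
      · simp [image_eq_zero_of_notMem_tsupport h1]
    obtain ⟨C, hC⟩ := exists_kernel_bound_of_family h1 h2
    have h3 : χ 0 = 1 := χ.one_of_mem_closedBall (by simp [χ])
    exact ⟨C, by simpa [h3] using hC 0⟩
  obtain ⟨A, hA⟩ := hfam hθt
  obtain ⟨B₀, hB₀⟩ := hfam (isTestSymbol_iSymbol hφ 1)
  set r : ℝ≥0∞ := ENNReal.ofReal ((2 : ℝ) ^ (s - 1)) with hr
  have hr1 : r < 1 := by
    rw [hr, ENNReal.ofReal_lt_one]
    exact Real.rpow_lt_one_of_one_lt_of_neg (by norm_num) (by linarith)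
  obtain ⟨C, hC⟩ := exists_bound_of_le_add_geometric hr1 (A := A) (B₀ := B₀) (by simp) (by simp)
  have hstep : ∀ J, (fun z => (iSymbol φ (J + 1 + 1) z : ℂ)) =
      (fun z => (iSymbol φ (J + 1) z : ℂ)) + fun z =>
        (((2 : ℝ) ^ (((J + 1 : ℕ) : ℝ) * (s - 1)) : ℝ) : ℂ) * θ (((2 : ℝ) ^ (J + 1))⁻¹ • z) := by
    intro J
    ext z
    have h := hφ.annulus_eq (J := J + 1) (by omega) z (s - 1) id (by
      intro x hx
      rw [id, Real.mul_rpow (by positivity) hx.le, ← Real.rpow_natCast,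
        ← Real.rpow_mul (by norm_num)])
    have h2 : iSymbol φ (J + 1 + 1) z = iSymbol φ (J + 1) z +
        φ ‖z‖ * annulusBump (((2 : ℝ) ^ (J + 1))⁻¹ • z) := by
      rw [iSymbol, iSymbol, annulusBump, inv_two_pow_succ_smul (J + 1)]; ring
    simp only [Pi.add_apply, hθ]
    rw [h2, show φ ‖z‖ = id (φ ‖z‖) from rfl, h]
    push_cast; ring
  have hint : ∀ J, Integrable fun z => (((2 : ℝ) ^ (((J + 1 : ℕ) : ℝ) * (s - 1)) : ℝ) : ℂ) *
        θ (((2 : ℝ) ^ (J + 1))⁻¹ • z) := fun J =>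
    (hθt.integrable.comp_smul (by positivity)).const_mul _
  have hcoef : ∀ J : ℕ, ‖(((2 : ℝ) ^ (((J + 1 : ℕ) : ℝ) * (s - 1)) : ℝ) : ℂ)‖ₑ ≤ r ^ J := by
    intro J
    rw [two_rpow_mul_nat, ← ofReal_norm, Complex.norm_real, Real.norm_of_nonneg (by positivity), hr,
      ENNReal.ofReal_pow (by positivity), pow_succ]
    exact mul_le_of_le_one_right (by simp) hr1.le
  refine ⟨C, fun J => ⟨?_, ?_⟩⟩
  · refine hC (fun J => kernelNorm (fun z => (iSymbol φ (J + 1) z : ℂ))) hB₀.1 (fun J => ?_) J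
    rw [hstep J]
    refine (kernelNorm_add_le (isTestSymbol_iSymbol hφ _).integrable (hint J)).trans ?_
    rw [kernelNorm_const_mul, kernelNorm_comp_smul θ (by positivity), mul_comm]
    gcongr
    · exact hA.1
    · exact hcoef J
  · refine hC (fun J => kernelMoment (fun z => (iSymbol φ (J + 1) z : ℂ))) hB₀.2 (fun J => ?_) J
    rw [hstep J]
    refine (kernelMoment_add_le (isTestSymbol_iSymbol hφ _).integrable (hint J)).trans ?_
    rw [kernelMoment_const_mul, kernelMoment_comp_smul θ (by positivity), mul_comm]
    have h1 : ENNReal.ofReal ((2 : ℝ) ^ (J + 1))⁻¹ ≤ 1 := by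
      rw [ENNReal.ofReal_le_one]
      exact inv_le_one_of_one_le₀ (one_le_pow₀ (by norm_num))
    have h2 : ENNReal.ofReal ((2 : ℝ) ^ (J + 1))⁻¹ * kernelMoment θ ≤ A :=
      (mul_le_of_le_one_left (by simp) h1).trans hA.2
    gcongr
    exact hcoef J

theorem isTestSymbol_highSymbol (hφ : IsIProfile s φ) (J : ℕ) (l : ℝ) :
    IsTestSymbol fun z => (highSymbol φ (J + 1) l z : ℂ) := by
  have h8 : ∀ z : Plane, ‖(8 : ℝ) • z‖ = 8 * ‖z‖ := fun z => by rw [norm_smul]; norm_num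
  set b : Plane → ℝ := fun z =>
    (freqBump (((2 : ℝ) ^ (J + 1))⁻¹ • z) - freqBump ((8 : ℝ) • z)) * (φ ‖z‖)⁻¹ with hb
  have hbs : ContDiff ℝ ∞ b := ((freqBump_smul_contDiff _).sub (freqBump_smul_contDiff _)).mul
    (hφ.contDiff_comp_norm.inv fun z => (hφ.pos _).ne')
  have hb0 : ∀ z, ‖z‖ ≤ 1 / 8 → b z = 0 := by
    intro z hz
    have h1 : freqBump ((8 : ℝ) • z) = 1 := freqBump_eq_one (by rw [h8]; linarith)
    have h2 : freqBump (((2 : ℝ) ^ (J + 1))⁻¹ • z) = 1 := freqBump_eq_one (by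
      rw [norm_smul, norm_inv, norm_pow, Real.norm_ofNat]
      exact mul_le_one₀ (inv_le_one_of_one_le₀ (one_le_pow₀ (by norm_num))) (norm_nonneg _)
        (by linarith))
    rw [hb]
    simp only
    rw [h1, h2]
    simp
  refine ⟨contDiff_of_zero_notMem_tsupport (zero_notMem_tsupport fun z hz => ?_) fun z hz => ?_,
    hasCompactSupport_of_norm (2 * 2 ^ (J + 1)) fun z hz => ?_⟩
  · have := hb0 z hz
    rw [hb] at this
    simp only at this
    rw [highSymbol, this]
    simp
  · have hpos : 0 < l ^ 2 + ‖z‖ ^ 2 := by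
      have := norm_pos_iff.2 hz
      positivity
    have h1 : ContDiffAt ℝ ∞ (fun z : Plane => l ^ 2 + ‖z‖ ^ 2) z :=
      contDiffAt_const.add (contDiffAt_id.norm_sq ℝ)
    exact Complex.ofRealCLM.contDiff.contDiffAt.comp z
      (((h1.sqrt hpos.ne').inv (Real.sqrt_ne_zero'.2 hpos)).mul hbs.contDiffAt)
  · have h1 : freqBump ((8 : ℝ) • z) = 0 := freqBump_eq_zero (by
      rw [h8]
      have : (1 : ℝ) ≤ 2 ^ (J + 1) := one_le_pow₀ (by norm_num)
      linarith)
    rw [highSymbol, freqBump_scaled_eq_zero hz, h1]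
    simp

/-- Removing the low frequencies and inverting `⟨D⟩ I` gains a factor `1 / N`, which is left out
here, and costs nothing else: the pieces at frequency `2 ^ J` have size `2 ^ (-J s)`. -/
theorem exists_bound_highSymbol (hs0 : 0 < s) (hφ : IsIProfile s φ) :
    ∃ C : ℝ≥0, ∀ J, ∀ l ∈ Icc (0 : ℝ) 1,
      kernelNorm (fun z => (highSymbol φ (J + 1) l z : ℂ)) ≤ C := by
  set θ : Plane → ℂ := fun z => (annulusBump z : ℂ) * ((‖z‖ ^ (1 - s) : ℝ) : ℂ) with hθ
  have hθt : IsTestSymbol θ :=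
    ⟨contDiff_annulus_mul fun z hz => contDiffAt_norm_rpow hz _, hasCompactSupport_annulus⟩
  obtain ⟨A, hA⟩ := exists_kernel_bound_bracket hθt.1 hθt.2 le_rfl
    (Or.inr zero_notMem_tsupport_annulus)
  -- the first cutoff covers frequencies where the profile is not a power, so that it is not a
  -- dilate of the annular piece
  set θ₁ : Plane → ℂ := fun z =>
    (((freqBump (((2 : ℝ) ^ 1)⁻¹ • z) - freqBump ((8 : ℝ) • z)) * (φ ‖z‖)⁻¹ : ℝ) : ℂ) with hθ₁
  have hsm₁ : ContDiff ℝ ∞ θ₁ := Complex.ofRealCLM.contDiff.comp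
    (((freqBump_smul_contDiff _).sub (freqBump_smul_contDiff _)).mul
      (hφ.contDiff_comp_norm.inv fun z => (hφ.pos _).ne'))
  have h8 : ∀ z : Plane, ‖(8 : ℝ) • z‖ = 8 * ‖z‖ := fun z => by rw [norm_smul]; norm_num
  have hcs₁ : HasCompactSupport θ₁ := hasCompactSupport_of_norm (2 * 2 ^ 1) fun z hz => by
    have h1 : freqBump ((8 : ℝ) • z) = 0 := freqBump_eq_zero (by rw [h8]; linarith)
    rw [hθ₁]
    simp only
    rw [freqBump_scaled_eq_zero hz, h1]
    simp
  have h0₁ : (0 : Plane) ∉ tsupport θ₁ := zero_notMem_tsupport fun z hz => by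
    have h1 : freqBump ((8 : ℝ) • z) = 1 := freqBump_eq_one (by rw [h8]; linarith)
    have h2 : freqBump (((2 : ℝ) ^ 1)⁻¹ • z) = 1 := freqBump_eq_one (by
      rw [norm_smul]; norm_num; linarith)
    rw [hθ₁]
    simp only
    rw [h1, h2]
    simp
  obtain ⟨B₀, hB₀⟩ := exists_kernel_bound_bracket hsm₁ hcs₁ le_rfl (Or.inr h0₁)
  set r : ℝ≥0∞ := ENNReal.ofReal ((2 : ℝ) ^ (-s)) with hr
  have hr1 : r < 1 := by
    rw [hr, ENNReal.ofReal_lt_one]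
    exact Real.rpow_lt_one_of_one_lt_of_neg (by norm_num) (by linarith)
  obtain ⟨C, hC⟩ := exists_bound_of_le_add_geometric hr1 (A := A) (B₀ := B₀) (by simp) (by simp)
  refine ⟨C, fun J l hl => ?_⟩
  refine hC (fun J => kernelNorm (fun z => (highSymbol φ (J + 1) l z : ℂ))) ?_ (fun J => ?_) J
  · have := hB₀ l ⟨hl.1, hl.2.trans (by norm_num)⟩
    refine le_trans (le_of_eq ?_) this
    congr 1
    ext z
    simp [highSymbol, hθ₁]
  · set c : ℝ := (2 : ℝ) ^ (J + 1) with hc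
    have hc1 : 1 ≤ c := one_le_pow₀ (by norm_num)
    have hc0 : 0 < c := by positivity
    -- this is `c ^ (-s)`: the profile contributes `c ^ (1 - s)` and the bracket `c⁻¹`
    set coef : ℝ := (2 : ℝ) ^ (((J + 1 : ℕ) : ℝ) * (1 - s)) * c⁻¹ with hcoef
    set b : Plane → ℂ := fun y => ((√(0 + (c⁻¹ * l) ^ 2 + ‖y‖ ^ 2))⁻¹ : ℝ) * θ y with hb
    -- the dilation by `c` turns `l` into `c⁻¹ l`
    have hstep : (fun z => (highSymbol φ (J + 1 + 1) l z : ℂ)) =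
        (fun z => (highSymbol φ (J + 1) l z : ℂ)) + fun z => (coef : ℂ) * b (c⁻¹ • z) := by
      ext z
      have h := hφ.annulus_eq (J := J + 1) (by omega) z (1 - s) (fun x => x⁻¹) (by
        intro x hx
        rw [Real.mul_rpow (by positivity) hx.le, ← Real.rpow_natCast,
          ← Real.rpow_mul (by norm_num), mul_inv, ← Real.rpow_neg (by norm_num),
          ← Real.rpow_neg hx.le]
        congr 2 <;> ring)
      have h1 : √(l ^ 2 + ‖z‖ ^ 2) = c * √(0 + (c⁻¹ * l) ^ 2 + ‖c⁻¹ • z‖ ^ 2) := by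
        rw [norm_smul, Real.norm_of_nonneg (by positivity), mul_pow, mul_pow, zero_add, ← mul_add,
          Real.sqrt_mul (by positivity), Real.sqrt_sq (by positivity), mul_inv_cancel_left₀ hc0.ne']
      have h2 : highSymbol φ (J + 1 + 1) l z = highSymbol φ (J + 1) l z +
          (√(l ^ 2 + ‖z‖ ^ 2))⁻¹ * ((φ ‖z‖)⁻¹ * annulusBump (c⁻¹ • z)) := by
        rw [highSymbol, highSymbol, annulusBump, hc, inv_two_pow_succ_smul (J + 1)]; ring
      simp only [Pi.add_apply, hb, hθ]
      rw [h2, h, h1, hcoef, mul_inv]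
      push_cast; ring
    have hbint : Integrable b := by
      refine Continuous.integrable_of_hasCompactSupport ?_ hθt.2.mul_left
      refine ContDiff.continuous (n := ∞) (𝕜 := ℝ) (contDiff_of_zero_notMem_tsupport ?_ ?_)
      · refine zero_notMem_tsupport fun z hz => ?_
        simp [hb, hθ, annulusBump_eq_zero_of_le (z := z) (by linarith)]
      · intro z hz
        have hpos : 0 < 0 + (c⁻¹ * l) ^ 2 + ‖z‖ ^ 2 := by
          have := norm_pos_iff.2 hz
          positivity
        have h1 : ContDiffAt ℝ ∞ (fun z : Plane => 0 + (c⁻¹ * l) ^ 2 + ‖z‖ ^ 2) z :=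
          contDiffAt_const.add (contDiffAt_id.norm_sq ℝ)
        exact (Complex.ofRealCLM.contDiff.contDiffAt.comp z
          ((h1.sqrt hpos.ne').inv (Real.sqrt_ne_zero'.2 hpos))).mul hθt.1.contDiffAt
    rw [hstep]
    refine (kernelNorm_add_le (isTestSymbol_highSymbol hφ J l).integrable
      ((hbint.comp_smul (by positivity)).const_mul _)).trans ?_
    rw [kernelNorm_const_mul, kernelNorm_comp_smul b (by positivity), mul_comm]
    have hcl : c⁻¹ * l ∈ Icc (0 : ℝ) 8 := by
      refine ⟨mul_nonneg (by positivity) hl.1, ?_⟩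
      have := mul_le_one₀ (inv_le_one_of_one_le₀ hc1) hl.1 hl.2
      linarith
    have hco : ‖(coef : ℂ)‖ₑ ≤ r ^ J := by
      have h1 : coef = ((2 : ℝ) ^ (-s)) ^ (J + 1) := by
        rw [hcoef, hc, two_rpow_mul_nat, ← inv_pow, ← mul_pow]
        congr 1
        rw [← Real.rpow_neg_one, ← Real.rpow_add (by norm_num)]
        congr 1; ring
      rw [h1, ← ofReal_norm, Complex.norm_real, Real.norm_of_nonneg (by positivity), hr,
        ENNReal.ofReal_pow (by positivity), pow_succ]
      exact mul_le_of_le_one_right (by simp) hr1.le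
    gcongr
    exact hA _ hcl

/-- The symbol of `P ⟨D⟩⁻¹`, where `P` is the projection to frequencies below `2 S`. -/
noncomputable def lowSymbol (S : ℝ) (z : Plane) : ℝ := freqBump (S⁻¹ • z) * (japaneseBracket z)⁻¹

theorem japaneseBracket_pos (z : Plane) : 0 < japaneseBracket z :=
  Real.sqrt_pos.2 (by positivity)

theorem japaneseBracket_contDiff : ContDiff ℝ ∞ japaneseBracket := by
  have h1 : ContDiff ℝ ∞ fun z : Plane => 1 + ‖z‖ ^ 2 := contDiff_const.add (contDiff_norm_sq ℝ)
  exact h1.sqrt fun z => by positivity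

theorem isTestSymbol_lowSymbol {w : Plane → ℝ} (hw : ContDiff ℝ ∞ w) {S : ℝ} (hS : 0 < S) :
    IsTestSymbol fun z => ((w z * lowSymbol S z : ℝ) : ℂ) := by
  refine ⟨Complex.ofRealCLM.contDiff.comp (hw.mul ((freqBump_smul_contDiff _).mul
    (japaneseBracket_contDiff.inv fun z => (japaneseBracket_pos z).ne'))),
    hasCompactSupport_of_norm (2 * S) fun z hz => ?_⟩
  have : freqBump (S⁻¹ • z) = 0 := freqBump_eq_zero (by
    rw [norm_smul, Real.norm_of_nonneg (by positivity), inv_mul_eq_div, le_div_iff₀ hS]; exact hz)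
  simp [lowSymbol, this]

theorem japaneseBracket_scale {S : ℝ} (hS : 0 < S) (z : Plane) :
    japaneseBracket z = S * √(0 + S⁻¹ ^ 2 + ‖S⁻¹ • z‖ ^ 2) := by
  rw [japaneseBracket, norm_smul, Real.norm_of_nonneg (by positivity), mul_pow, zero_add,
    ← mul_one_add, Real.sqrt_mul (by positivity), Real.sqrt_sq (by positivity),
    mul_inv_cancel_left₀ hS.ne']

/-- Doubling the cutoff frequency `S` of `w(D) P ⟨D⟩⁻¹`, where `w` is homogeneous of degree `d`,
costs `S ^ (d - 1)`. -/
theorem exists_bound_lowSymbol_step {w : Plane → ℝ} (hw : ContDiff ℝ ∞ w) (d : ℕ)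
    (hwd : ∀ (S : ℝ) z, w (S • z) = S ^ d * w z) :
    ∃ C : ℝ≥0, (∀ S ∈ Icc (1 / 8 : ℝ) (1 / 4),
      kernelNorm (fun z => ((w z * lowSymbol S z : ℝ) : ℂ)) ≤ C) ∧
    ∀ S, 1 / 8 ≤ S → kernelNorm (fun z => ((w z * lowSymbol (2 * S) z : ℝ) : ℂ)) ≤
      kernelNorm (fun z => ((w z * lowSymbol S z : ℝ) : ℂ)) + C * ENNReal.ofReal (S ^ d * S⁻¹) := by
  have hwc : ContDiff ℝ ∞ fun z => (w z : ℂ) := Complex.ofRealCLM.contDiff.comp hw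
  set θ : Plane → ℂ := fun z => (annulusBump z : ℂ) * (w z : ℂ) with hθ
  have hθt : IsTestSymbol θ :=
    ⟨contDiff_annulus_mul fun z hz => hwc.contDiffAt, hasCompactSupport_annulus⟩
  obtain ⟨A, hA⟩ := exists_kernel_bound_bracket hθt.1 hθt.2 le_rfl
    (Or.inr zero_notMem_tsupport_annulus)
  set θ₁ : Plane → ℂ := fun z => (freqBump z : ℂ) * (w z : ℂ) with hθ₁
  have hθ₁t : IsTestSymbol θ₁ :=
    ⟨(Complex.ofRealCLM.contDiff.comp freqBump_contDiff).mul hwc,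
      hasCompactSupport_of_norm 2 fun z hz => by simp [hθ₁, freqBump_eq_zero hz]⟩
  obtain ⟨B, hB⟩ := exists_kernel_bound_bracket hθ₁t.1 hθ₁t.2 zero_le_one (Or.inl one_pos)
  have h8 : (1 : ℝ) ≤ (8 : ℝ) ^ (1 : ℕ) := by norm_num
  refine ⟨8 * B + A, fun S hS => ?_, fun S hS => ?_⟩
  · have hS0 : 0 < S := by linarith [hS.1]
    have hi4 : 4 ≤ S⁻¹ := by rw [le_inv_comm₀ (by norm_num) hS0]; linarith [hS.2]
    have hi8 : S⁻¹ ≤ 8 := by rw [inv_le_comm₀ hS0 (by norm_num)]; linarith [hS.1]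
    -- with `S⁻² = 1 + l²`, the bracket at the scale `S` is `S √(1 + l² + |y|²)`
    set l : ℝ := √(S⁻¹ ^ 2 - 1) with hl
    have hl2 : l ^ 2 = S⁻¹ ^ 2 - 1 := Real.sq_sqrt (by nlinarith)
    have hlm : l ∈ Icc (0 : ℝ) 8 := ⟨Real.sqrt_nonneg _, by
      refine Real.sqrt_le_iff.2 ⟨by norm_num, by nlinarith⟩⟩
    have h1 : (fun z => ((w z * lowSymbol S z : ℝ) : ℂ)) = fun z => ((S ^ d * S⁻¹ : ℝ) : ℂ) *
        (fun y => ((√(1 + l ^ 2 + ‖y‖ ^ 2))⁻¹ : ℝ) * θ₁ y) (S⁻¹ • z) := by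
      ext z
      have h2 : w z = S ^ d * w (S⁻¹ • z) := by
        rw [← hwd, smul_inv_smul₀ hS0.ne']
      simp only [hθ₁]
      rw [lowSymbol, japaneseBracket_scale hS0, h2, hl2, mul_inv, add_sub_cancel, zero_add]
      push_cast; ring
    rw [h1, kernelNorm_const_mul, kernelNorm_comp_smul (fun y => ((√(1 + l ^ 2 + ‖y‖ ^ 2))⁻¹ : ℝ) *
      θ₁ y) (inv_pos.2 hS0)]
    have h3 : ‖((S ^ d * S⁻¹ : ℝ) : ℂ)‖ₑ ≤ 8 := by
      rw [← ofReal_norm, Complex.norm_real, Real.norm_of_nonneg (by positivity),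
        show (8 : ℝ≥0∞) = ENNReal.ofReal 8 by simp]
      refine ENNReal.ofReal_le_ofReal ?_
      have : S ^ d ≤ 1 := pow_le_one₀ hS0.le (by linarith [hS.2])
      calc S ^ d * S⁻¹ ≤ 1 * 8 := by gcongr
        _ = 8 := by norm_num
    refine (mul_le_mul' h3 (hB l hlm)).trans ?_
    push_cast
    exact le_self_add
  · have hS0 : 0 < S := by linarith
    have hi8 : S⁻¹ ≤ 8 := by rw [inv_le_comm₀ hS0 (by norm_num)]; linarith
    set b : Plane → ℂ := fun y => ((√(0 + S⁻¹ ^ 2 + ‖y‖ ^ 2))⁻¹ : ℝ) * θ y with hb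
    have h1 : (fun z => ((w z * lowSymbol (2 * S) z : ℝ) : ℂ)) =
        (fun z => ((w z * lowSymbol S z : ℝ) : ℂ)) +
          fun z => ((S ^ d * S⁻¹ : ℝ) : ℂ) * b (S⁻¹ • z) := by
      ext z
      have h2 : w z = S ^ d * w (S⁻¹ • z) := by
        rw [← hwd, smul_inv_smul₀ hS0.ne']
      have h3 : w z * lowSymbol (2 * S) z = w z * lowSymbol S z +
          S ^ d * w (S⁻¹ • z) * annulusBump (S⁻¹ • z) * (japaneseBracket z)⁻¹ := by
        rw [← h2, lowSymbol, lowSymbol, annulusBump, mul_inv, mul_smul]; ring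
      simp only [Pi.add_apply, hb, hθ]
      rw [h3, japaneseBracket_scale hS0, mul_inv]
      push_cast; ring
    have hbi : Integrable fun z => ((S ^ d * S⁻¹ : ℝ) : ℂ) * b (S⁻¹ • z) := by
      have h2 : (fun z => ((S ^ d * S⁻¹ : ℝ) : ℂ) * b (S⁻¹ • z)) =
          (fun z => ((w z * lowSymbol (2 * S) z : ℝ) : ℂ)) -
          (fun z => ((w z * lowSymbol S z : ℝ) : ℂ)) := by rw [h1]; simp
      rw [h2]
      exact (isTestSymbol_lowSymbol hw (by positivity)).integrable.sub
        (isTestSymbol_lowSymbol hw hS0).integrable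
    rw [h1]
    refine (kernelNorm_add_le (isTestSymbol_lowSymbol hw hS0).integrable hbi).trans ?_
    rw [kernelNorm_const_mul, kernelNorm_comp_smul b (inv_pos.2 hS0), mul_comm]
    have h3 : ‖((S ^ d * S⁻¹ : ℝ) : ℂ)‖ₑ = ENNReal.ofReal (S ^ d * S⁻¹) := by
      rw [← ofReal_norm, Complex.norm_real, Real.norm_of_nonneg (by positivity)]
    rw [h3]
    gcongr
    push_cast
    exact (hA _ ⟨by positivity, hi8⟩).trans le_add_self

/-- The number `N / 8` is reached from `[1/8, 1/4]` by at most `log₂ N` doublings. -/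
theorem exists_dyadic_scale {N : ℝ} (hN : 1 ≤ N) :
    ∃ (S : ℝ) (k : ℕ), S ∈ Icc (1 / 8 : ℝ) (1 / 4) ∧ 2 ^ k ≤ N ∧ N / 8 = 2 ^ k * S := by
  obtain ⟨k, hk1, hk2⟩ := exists_nat_pow_near hN (one_lt_two)
  have h2 : (0 : ℝ) < 2 ^ k := by positivity
  refine ⟨N / 8 / 2 ^ k, k, ⟨?_, ?_⟩, hk1, by field_simp⟩
  · rw [le_div_iff₀ h2]; linarith
  · rw [div_le_iff₀ h2]; rw [pow_succ] at hk2; linarith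

/-- The kernel norms of `P ⟨D⟩⁻¹` are bounded, since the doubling at frequency `S` costs `S⁻¹`. -/
theorem exists_bound_lowSymbol :
    ∃ C : ℝ≥0, ∀ N : ℝ, 1 ≤ N → kernelNorm (fun z => (lowSymbol (N / 8) z : ℂ)) ≤ C := by
  obtain ⟨A, hA0, hA⟩ := exists_bound_lowSymbol_step (w := fun _ => 1) contDiff_const 0 (by simp)
  simp only [one_mul, pow_zero] at hA0 hA
  have hr1 : (2 : ℝ≥0∞)⁻¹ < 1 := by simp
  obtain ⟨C, hC⟩ := exists_bound_of_le_add_geometric hr1 (A := A * 8) (B₀ := A)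
    (by finiteness) (by simp)
  refine ⟨C, fun N hN => ?_⟩
  obtain ⟨S, k, hS, hk, hNS⟩ := exists_dyadic_scale hN
  rw [hNS]
  refine hC (fun k => kernelNorm (fun z => (lowSymbol (2 ^ k * S) z : ℂ))) (by simpa using hA0 S hS)
    (fun j => ?_) k
  have hS0 : 0 < S := by linarith [hS.1]
  have h1 : (1 : ℝ) ≤ 2 ^ j := one_le_pow₀ (by norm_num)
  have h := hA (2 ^ j * S) (by nlinarith [hS.1])
  rw [pow_succ', mul_assoc]
  refine h.trans ?_
  rw [mul_assoc (A : ℝ≥0∞)]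
  gcongr
  rw [mul_inv, mul_comm, ENNReal.ofReal_mul (by positivity), ← inv_pow,
    ENNReal.ofReal_pow (by positivity)]
  gcongr
  · rw [show (8 : ℝ≥0∞) = ENNReal.ofReal 8 by simp]
    refine ENNReal.ofReal_le_ofReal ?_
    rw [inv_le_comm₀ hS0 (by norm_num)]; linarith [hS.1]
  · rw [ENNReal.ofReal_inv_of_pos (by norm_num)]; simp

/-- One derivative of `P ⟨D⟩⁻¹` costs the number of dyadic scales, hence at most `N ^ ε`. -/
theorem exists_bound_lowSymbol_deriv {ε : ℝ} (hε : 0 < ε) (v : Plane) :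
    ∃ C : ℝ≥0, ∀ N : ℝ, 1 ≤ N →
      kernelNorm (fun z => ((inner ℝ z v * lowSymbol (N / 8) z : ℝ) : ℂ)) ≤
        C * ENNReal.ofReal (N ^ ε) := by
  obtain ⟨A, hA0, hA⟩ := exists_bound_lowSymbol_step (w := fun z => inner ℝ z v)
    (contDiff_id.inner ℝ contDiff_const) 1 (fun S z => by rw [real_inner_smul_left, pow_one])
  have hlog : 0 < ε * Real.log 2 := mul_pos hε (Real.log_pos (by norm_num))
  refine ⟨A * (1 + (ε * Real.log 2)⁻¹).toNNReal, fun N hN => ?_⟩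
  obtain ⟨S, k, hS, hk, hNS⟩ := exists_dyadic_scale hN
  have hS0 : 0 < S := by linarith [hS.1]
  have hind : ∀ k : ℕ, kernelNorm (fun z => ((inner ℝ z v * lowSymbol (2 ^ k * S) z : ℝ) : ℂ)) ≤
      A * ((k : ℝ≥0∞) + 1) := by
    intro k
    induction k with
    | zero => simpa using hA0 S hS
    | succ k ih =>
      have h1 : (1 : ℝ) ≤ 2 ^ k := one_le_pow₀ (by norm_num)
      have h := hA (2 ^ k * S) (by nlinarith [hS.1])
      rw [pow_succ', mul_assoc]
      refine h.trans ?_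
      rw [pow_one, mul_inv_cancel₀ (by positivity), ENNReal.ofReal_one]
      rw [Nat.cast_succ]
      calc _ ≤ A * ((k : ℝ≥0∞) + 1) + A * 1 := by gcongr
        _ = _ := by ring
  rw [hNS, ← hNS]
  refine (hNS ▸ hind k).trans ?_
  push_cast
  rw [mul_assoc]
  gcongr
  -- each of the `k ≤ log₂ N` doublings costs a constant
  have h2 : ((k : ℝ) + 1) ≤ (1 + (ε * Real.log 2)⁻¹) * N ^ ε := by
    have h3 : (2 : ℝ) ^ ((k : ℝ) * ε) ≤ N ^ ε := by
      rw [Real.rpow_mul (by norm_num), Real.rpow_natCast]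
      exact Real.rpow_le_rpow (by positivity) hk hε.le
    have h4 : (k : ℝ) * (ε * Real.log 2) + 1 ≤ (2 : ℝ) ^ ((k : ℝ) * ε) := by
      rw [Real.rpow_def_of_pos (by norm_num)]
      refine le_trans (le_of_eq ?_) (Real.add_one_le_exp _)
      ring
    have h5 : (1 : ℝ) ≤ N ^ ε := Real.one_le_rpow hN hε.le
    have h6 : (k : ℝ) ≤ (ε * Real.log 2)⁻¹ * N ^ ε := by
      rw [inv_mul_eq_div, le_div_iff₀ hlog]
      linarith
    linarith
  rw [show ((k : ℝ≥0∞) + 1) = ENNReal.ofReal ((k : ℝ) + 1) by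
    rw [ENNReal.ofReal_add (by positivity) zero_le_one]; simp]
  change _ ≤ ENNReal.ofReal (1 + (ε * Real.log 2)⁻¹) * _
  rw [← ENNReal.ofReal_mul (by positivity)]
  exact ENNReal.ofReal_le_ofReal h2

end

/-! ### Convolution operators attached to test symbols -/

/-- A test symbol as a Schwartz function. -/
noncomputable def IsTestSymbol.toSchwartz {b : Plane → ℂ} (h : IsTestSymbol b) : 𝓢(Plane, ℂ) :=
  h.2.toSchwartzMap h.1

theorem IsTestSymbol.toSchwartz_apply {b : Plane → ℂ} (h : IsTestSymbol b) (z : Plane) :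
    h.toSchwartz z = b z := rfl

theorem IsTestSymbol.comp_smul {b : Plane → ℂ} (h : IsTestSymbol b) {c : ℝ} (hc : 0 < c) :
    IsTestSymbol fun z => b (c • z) :=
  ⟨h.1.comp (contDiff_const_smul c), h.2.comp_homeomorph (Homeomorph.smulOfNeZero c hc.ne')⟩

theorem IsTestSymbol.const_mul {b : Plane → ℂ} (h : IsTestSymbol b) (c : ℂ) :
    IsTestSymbol fun z => c * b z :=
  ⟨contDiff_const.mul h.1, h.2.mul_left⟩

theorem IsTestSymbol.lintegral_kernel {b : Plane → ℂ} (h : IsTestSymbol b) :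
    ∫⁻ z, ‖(𝓕⁻ h.toSchwartz : 𝓢(Plane, ℂ)) z‖ₑ = kernelNorm b := by
  rw [SchwartzMap.fourierInv_coe]; rfl

theorem IsTestSymbol.lintegral_moment {b : Plane → ℂ} (h : IsTestSymbol b) :
    ∫⁻ z, ‖z‖ₑ * ‖(𝓕⁻ h.toSchwartz : 𝓢(Plane, ℂ)) z‖ₑ = kernelMoment b := by
  rw [SchwartzMap.fourierInv_coe]; rfl

theorem IsTestSymbol.eLpNorm_conv_le {b : Plane → ℂ} (h : IsTestSymbol b) {p : ℝ≥0∞} (hp1 : 1 ≤ p)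
    (hpt : p ≠ ⊤) {f : Plane → ℂ} (hf : Measurable f) :
    eLpNorm (schwartzConv (𝓕⁻ h.toSchwartz) f) p ≤ kernelNorm b * eLpNorm f p := by
  rw [← h.lintegral_kernel]
  exact eLpNorm_schwartzConv_le hp1 hpt _ hf

/-- Fatou's lemma for `L^p` norms along a sequence that converges in `L²`. -/
theorem eLpNorm_le_liminf_of_tendsto {F : ℕ → Plane → ℂ} {g : Plane → ℂ} {p : ℝ≥0∞}
    (hF : ∀ J, AEStronglyMeasurable (F J)) (hg : AEStronglyMeasurable g)
    (h : Tendsto (fun J => eLpNorm (F J - g) 2) atTop (𝓝 0)) :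
    eLpNorm g p ≤ liminf (fun J => eLpNorm (F J) p) atTop := by
  refine le_of_forall_gt fun B hB => ?_
  by_contra hcon
  push Not at hcon
  obtain ⟨B', hB1, hB2⟩ := exists_between hB
  have hfr : ∃ᶠ J in atTop, eLpNorm (F J) p < B' :=
    frequently_lt_of_liminf_lt (by isBoundedDefault) hB1
  -- a subsequence with small norms, and a further subsequence that converges almost everywhere
  obtain ⟨ns, hns, hlt⟩ := extraction_of_frequently_atTop hfr
  have hm : TendstoInMeasure volume (fun J => F (ns J)) atTop g :=
    tendstoInMeasure_of_tendsto_eLpNorm (p := 2) (by norm_num) (fun J => hF _) hg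
      (h.comp hns.tendsto_atTop)
  obtain ⟨ms, hms, hae⟩ := hm.exists_seq_tendsto_ae
  have h1 := Lp.eLpNorm_lim_le_liminf_eLpNorm (p := p) (fun n => hF (ns (ms n))) g hae
  have h2 : liminf (fun n => eLpNorm (F (ns (ms n))) p) atTop ≤ B' :=
    liminf_le_of_le (by isBoundedDefault) fun b hb => by
      obtain ⟨n, hn⟩ := hb.exists
      exact hn.trans (hlt _).le
  exact absurd (hcon.trans (h1.trans h2)) (not_le.2 hB2)

theorem eLpNorm_le_of_tendsto {F : ℕ → Plane → ℂ} {g : Plane → ℂ} {p B : ℝ≥0∞}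
    (hF : ∀ J, AEStronglyMeasurable (F J)) (hg : AEStronglyMeasurable g)
    (h : Tendsto (fun J => eLpNorm (F J - g) 2) atTop (𝓝 0)) (hB : ∀ J, eLpNorm (F J) p ≤ B) :
    eLpNorm g p ≤ B := by
  refine (eLpNorm_le_liminf_of_tendsto hF hg h).trans ?_
  refine liminf_le_of_le (by isBoundedDefault) fun b hb => ?_
  obtain ⟨n, hn⟩ := hb.exists
  exact hn.trans (hB n)

/-- Multipliers with bounded symbols that converge pointwise converge strongly in `L²`. -/
theorem tendsto_schwartzConv {b : ℕ → 𝓢(Plane, ℂ)} {σ : Plane → ℂ} {C : ℝ}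
    (hC : ∀ J ξ, ‖b J ξ‖ ≤ C) (hlim : ∀ ξ, Tendsto (fun J => b J ξ) atTop (𝓝 (σ ξ)))
    {f g : L2Plane} (hg : ∀ᵐ ξ, (𝓕 g : L2Plane) ξ = σ ξ * (𝓕 f : L2Plane) ξ) :
    Tendsto (fun J => eLpNorm (schwartzConv (𝓕⁻ (b J)) f - ⇑g) 2) atTop (𝓝 0) := by
  have h1 : ∀ J, eLpNorm (schwartzConv (𝓕⁻ (b J)) f - ⇑g) 2 =
      eLpNorm (fun ξ => (b J ξ - σ ξ) * (𝓕 f : L2Plane) ξ) 2 := by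
    intro J
    set w := (memLp_schwartzConv (𝓕⁻ (b J)) (Lp.memLp f)).toLp _ with hw
    have h2 : schwartzConv (𝓕⁻ (b J)) f - ⇑g =ᵐ[volume] (w - g : L2Plane) :=
      ((MemLp.coeFn_toLp _).symm.sub EventuallyEq.rfl).trans (Lp.coeFn_sub w g).symm
    rw [eLpNorm_congr_ae h2, ← Lp.enorm_def, ← ofReal_norm, ← Lp.norm_fourier_eq, ofReal_norm,
      Lp.enorm_def]
    refine eLpNorm_congr_ae ?_
    have h3 : (𝓕 (w - g) : L2Plane) = (𝓕 w : L2Plane) - (𝓕 g : L2Plane) :=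
      map_sub (Lp.fourierTransformₗᵢ Plane ℂ) w g
    rw [h3]
    filter_upwards [Lp.coeFn_sub (𝓕 w : L2Plane) (𝓕 g), hg, fourier_toLp_schwartzConv (b J) f]
      with ξ e1 e2 e3
    rw [e1, Pi.sub_apply, e2, e3]; ring
  simp_rw [h1]
  have hσ : ∀ ξ, ‖σ ξ‖ ≤ C := fun ξ =>
    le_of_tendsto (hlim ξ).norm (Eventually.of_forall fun J => hC J ξ)
  have hσm : Measurable σ := measurable_of_tendsto_metrizable
    (fun J => (b J).continuous.measurable) (tendsto_pi_nhds.2 hlim)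
  set fh : Plane → ℂ := ⇑(𝓕 f : L2Plane) with hfh
  have hfm : Measurable fh := (Lp.stronglyMeasurable (𝓕 f : L2Plane)).measurable
  have hf2 : MemLp fh 2 := Lp.memLp (𝓕 f : L2Plane)
  have hC0 : 0 ≤ C := (norm_nonneg _).trans (hσ 0)
  simp_rw [eLpNorm_eq_lintegral_rpow_enorm_toReal (p := 2) (by norm_num) (by norm_num)]
  have h4 : Tendsto (fun J => ∫⁻ ξ, ‖(b J ξ - σ ξ) * fh ξ‖ₑ ^ (2 : ℝ≥0∞).toReal) atTop
      (𝓝 (∫⁻ _ : Plane, 0)) := by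
    refine tendsto_lintegral_of_dominated_convergence
      (fun ξ => (ENNReal.ofReal (2 * C) * ‖fh ξ‖ₑ) ^ (2 : ℝ≥0∞).toReal) ?_ ?_ ?_ ?_
    · intro J
      exact ((((b J).continuous.measurable.sub hσm).mul hfm).enorm).pow_const _
    · intro J
      refine Eventually.of_forall fun ξ => ?_
      refine ENNReal.rpow_le_rpow ?_ (by positivity)
      rw [enorm_mul]
      gcongr
      rw [← ofReal_norm]
      refine ENNReal.ofReal_le_ofReal ((norm_sub_le _ _).trans ?_)
      linarith [hC J ξ, hσ ξ]
    · simp_rw [ENNReal.mul_rpow_of_nonneg _ _ (by positivity : (0 : ℝ) ≤ (2 : ℝ≥0∞).toReal)]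
      rw [lintegral_const_mul' _ _ (by finiteness)]
      refine ENNReal.mul_ne_top (by finiteness) ?_
      exact (lintegral_rpow_enorm_lt_top_of_eLpNorm_lt_top (by norm_num) (by norm_num) hf2.2).ne
    · refine Eventually.of_forall fun ξ => ?_
      have h5 : Tendsto (fun J => (b J ξ - σ ξ) * fh ξ) atTop (𝓝 0) := by
        have := ((hlim ξ).sub_const (σ ξ)).mul_const (fh ξ)
        simpa using this
      have h6 := (h5.enorm).ennrpow_const (2 : ℝ≥0∞).toReal
      simpa using h6
  have h7 := h4.ennrpow_const (1 / (2 : ℝ≥0∞).toReal)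
  simpa using h7

/-- For a multiplier with Schwartz symbol, the Fourier inversion formula holds pointwise. -/
theorem schwartzConv_eq_fourierInv (b : 𝓢(Plane, ℂ)) (f : L2Plane) (x : Plane) :
    schwartzConv (𝓕⁻ b) f x = 𝓕⁻ (fun ξ => b ξ * (𝓕 f : L2Plane) ξ) x := by
  -- both sides are pairings of `f`, or of its transform, with a function in `L²`
  have hk : MemLp (fun y => (𝓕⁻ b : 𝓢(Plane, ℂ)) (x - y)) 2 :=
    memLp_comp_sub_left ((𝓕⁻ b : 𝓢(Plane, ℂ)).memLp 2) x
  have he : MemLp (fun ξ => (Real.fourierChar (inner ℝ ξ x) : ℂ) * b ξ) 2 := by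
    have hc : Continuous fun ξ : Plane => (Real.fourierChar (inner ℝ ξ x) : ℂ) :=
      continuous_subtype_val.comp (Real.continuous_fourierChar.comp (by fun_prop))
    exact (b.memLp 2).congr_norm (hc.mul b.continuous).aestronglyMeasurable
      (Eventually.of_forall fun ξ => by
        have h1 : ‖(Real.fourierChar (inner ℝ ξ x) : ℂ)‖ = 1 := Circle.norm_coe _
        rw [Pi.mul_apply, norm_mul, h1, one_mul])
  set L₁ := (ContinuousLinearMap.mul ℂ ℂ).lpPairing volume 2 2 (hk.toLp _) with hL₁
  set L₂ := (ContinuousLinearMap.mul ℂ ℂ).lpPairing volume 2 2 (he.toLp _) with hL₂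
  have e1 : ∀ f : L2Plane, schwartzConv (𝓕⁻ b) f x = L₁ f := by
    intro f
    rw [hL₁, ContinuousLinearMap.lpPairing_eq_integral]
    refine integral_congr_ae ?_
    filter_upwards [hk.coeFn_toLp] with y hy
    simp [hy]
  have e2 : ∀ f : L2Plane, 𝓕⁻ (fun ξ => b ξ * (𝓕 f : L2Plane) ξ) x = L₂ (𝓕 f : L2Plane) := by
    intro f
    rw [hL₂, ContinuousLinearMap.lpPairing_eq_integral, Real.fourierInv_eq]
    refine integral_congr_ae ?_
    filter_upwards [he.coeFn_toLp] with y hy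
    simp [hy, Circle.smul_def, mul_assoc]
  have hc : Continuous fun f : L2Plane => (𝓕 f : L2Plane) := FourierTransform.continuous_fourier
  have key : (fun f : L2Plane => L₁ f) = fun f : L2Plane => L₂ (𝓕 f : L2Plane) := by
    refine (SchwartzMap.denseRange_toLpCLM (E := Plane) (F := ℂ) (p := 2)
      (by norm_num)).equalizer L₁.continuous (L₂.continuous.comp hc) ?_
    ext1 ψ
    simp only [Function.comp_apply, SchwartzMap.toLpCLM_apply]
    rw [← e1, ← e2, schwartzConv_congr _ (ψ.coeFn_toLp 2 volume), schwartzConv_coe_eq_convolution]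
    have h1 : SchwartzMap.convolution (ContinuousLinearMap.mul ℂ ℂ) (𝓕⁻ b) ψ =
        𝓕⁻ (𝓕 (SchwartzMap.convolution (ContinuousLinearMap.mul ℂ ℂ) (𝓕⁻ b) ψ)) := by simp
    rw [h1, SchwartzMap.fourierInv_coe, Real.fourierInv_eq, Real.fourierInv_eq]
    refine integral_congr_ae ?_
    rw [SchwartzMap.toLp_fourier_eq]
    filter_upwards [(𝓕 ψ).coeFn_toLp 2 volume] with ξ h2
    rw [SchwartzMap.fourier_convolution_apply]
    have h4 := Real.fourier_bilin_convolution_eq (ContinuousLinearMap.mul ℂ ℂ)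
        (𝓕⁻ b : 𝓢(Plane, ℂ)).integrable ψ.integrable ξ
    rw [h4, ← SchwartzMap.fourier_coe, ← SchwartzMap.fourier_coe,
        FourierTransform.fourier_fourierInv_eq, h2]
    rfl
  rw [e1, e2]
  exact congrFun key f

/-- Functions with an integrable Fourier transform supported in the closed ball of radius `r`. -/
def IsBandLimited (r : ℝ) (f : Plane → ℂ) : Prop :=
  ∃ A : Plane → ℂ, Integrable A ∧ (∀ ξ, A ξ ≠ 0 → ‖ξ‖ ≤ r) ∧ f = 𝓕⁻ A

theorem IsBandLimited.mul {r r' : ℝ} {f g : Plane → ℂ} (hf : IsBandLimited r f)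
    (hg : IsBandLimited r' g) : IsBandLimited (r + r') (fun x => f x * g x) := by
  obtain ⟨A, hA, hAs, rfl⟩ := hf
  obtain ⟨B, hB, hBs, rfl⟩ := hg
  refine ⟨convolution A B (ContinuousLinearMap.mul ℂ ℂ) volume, hA.integrable_convolution _ hB,
    fun ξ hξ => ?_, ?_⟩
  · obtain ⟨a, ha, b, hb, rfl⟩ := support_convolution_subset (L := ContinuousLinearMap.mul ℂ ℂ) hξ
    exact (norm_add_le _ _).trans (add_le_add (hAs a ha) (hBs b hb))
  · ext x
    rw [Real.fourierInv_eq_fourier_neg, Real.fourierInv_eq_fourier_neg,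
      Real.fourierInv_eq_fourier_neg, Real.fourier_mul_convolution_eq hA hB]

theorem IsBandLimited.conj {r : ℝ} {f : Plane → ℂ} (hf : IsBandLimited r f) :
    IsBandLimited r (fun x => conj (f x)) := by
  obtain ⟨A, hA, hAs, rfl⟩ := hf
  refine ⟨fun ξ => conj (A (-ξ)), ?_, fun ξ hξ => ?_, ?_⟩
  · exact (LinearIsometryEquiv.integrable_comp_iff Complex.conjLIE).2 hA.comp_neg
  · rw [← norm_neg]
    exact hAs (-ξ) fun h => hξ (by simp [h])
  · ext x
    rw [Real.fourierInv_eq, Real.fourierInv_eq, ← integral_conj, ← integral_neg_eq_self]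
    congr 1
    ext ξ
    simp [Circle.smul_def, ← Circle.coe_inv_eq_conj, AddChar.map_neg_eq_inv]

/-- A multiplier acts as the identity on functions whose frequencies lie where its symbol is `1`. -/
theorem IsBandLimited.schwartzConv_eq {r : ℝ} {f : Plane → ℂ} (hf : IsBandLimited r f)
    {b : 𝓢(Plane, ℂ)} (hb : ∀ ξ, ‖ξ‖ ≤ r → b ξ = 1) : schwartzConv (𝓕⁻ b) f = f := by
  obtain ⟨A, hA, hAs, rfl⟩ := hf
  ext x
  set k : 𝓢(Plane, ℂ) := 𝓕⁻ b with hk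
  rw [_root_.schwartzConv_eq]
  simp_rw [Real.fourierInv_eq, ← integral_const_mul]
  rw [integral_integral_swap]
  · refine integral_congr_ae (Eventually.of_forall fun ξ => ?_)
    have h1 : ∀ z, k z * (Real.fourierChar (inner ℝ ξ (x - z)) • A ξ) =
        (Real.fourierChar (-(inner ℝ z ξ)) • k z) * (Real.fourierChar (inner ℝ ξ x) • A ξ) := by
      intro z
      rw [inner_sub_right, sub_eq_add_neg, AddChar.map_add_eq_mul, real_inner_comm z ξ]
      simp only [Circle.smul_def, Circle.coe_mul, smul_eq_mul]
      ring
    simp_rw [h1]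
    rw [integral_mul_const, ← Real.fourier_eq, ← SchwartzMap.fourier_coe, hk,
      FourierTransform.fourier_fourierInv_eq]
    by_cases h : A ξ = 0
    · simp [h]
    · rw [hb ξ (hAs ξ h), one_mul]
  · have h2 : Integrable (fun q : Plane × Plane => k q.1 * A q.2) (volume.prod volume) :=
      k.integrable.mul_prod hA
    refine h2.congr' ?_ (Eventually.of_forall fun q => by
      have h1 : ‖(Real.fourierChar (inner ℝ q.2 (x - q.1)) : ℂ)‖ = 1 := Circle.norm_coe _
      simp only [Function.uncurry, Circle.smul_def, norm_mul, smul_eq_mul, h1, one_mul])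
    have h3 : Continuous fun q : Plane × Plane =>
        (Real.fourierChar (inner ℝ q.2 (x - q.1)) : ℂ) :=
      continuous_subtype_val.comp (Real.continuous_fourierChar.comp (by fun_prop))
    have h4 := h3.aestronglyMeasurable (μ := volume.prod volume) |>.mul h2.aestronglyMeasurable
    refine h4.congr (Eventually.of_forall fun q => ?_)
    simp only [Pi.mul_apply, Function.uncurry, Circle.smul_def, smul_eq_mul]
    ring

theorem isBandLimited_schwartzConv {r : ℝ} {b : 𝓢(Plane, ℂ)} (hb : ∀ ξ, b ξ ≠ 0 → ‖ξ‖ ≤ r)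
    (f : L2Plane) : IsBandLimited r (schwartzConv (𝓕⁻ b) f) :=
  ⟨fun ξ => b ξ * (𝓕 f : L2Plane) ξ, (b.memLp 2).integrable_mul (Lp.memLp (𝓕 f : L2Plane)),
    fun ξ hξ => hb ξ (left_ne_zero_of_mul hξ), funext fun x => schwartzConv_eq_fourierInv b f x⟩

/-! ### Commutators of a convolution operator with products -/

theorem eLpNorm_mul_mul_le {a b c : Plane → ℂ} (ha : AEStronglyMeasurable a)
    (hb : AEStronglyMeasurable b) (hc : AEStronglyMeasurable c) :
    eLpNorm (fun x => a x * b x * c x) 2 ≤ eLpNorm a 6 * eLpNorm b 6 * eLpNorm c 6 := by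
  have i1 : ENNReal.HolderTriple 6 6 3 := ⟨by
    rw [← ENNReal.toReal_eq_toReal_iff' (by simp) (by simp), ENNReal.toReal_add (by simp) (by simp)]
    norm_num⟩
  have i2 : ENNReal.HolderTriple 3 6 2 := ⟨by
    rw [← ENNReal.toReal_eq_toReal_iff' (by simp) (by simp), ENNReal.toReal_add (by simp) (by simp)]
    norm_num⟩
  have h1 := eLpNorm_smul_le_mul_eLpNorm (p := 6) (q := 6) (r := 3) hb ha
  have h2 := eLpNorm_smul_le_mul_eLpNorm (p := 3) (q := 6) (r := 2) hc (ha.mul hb)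
  exact h2.trans (mul_le_mul_left h1 _)

theorem eLpNorm_conj (a : Plane → ℂ) (p : ℝ≥0∞) : eLpNorm (fun x => conj (a x)) p = eLpNorm a p :=
  eLpNorm_congr_norm_ae (Eventually.of_forall fun x => by simp)

theorem schwartzConv_conj {k : 𝓢(Plane, ℂ)} (hk : ∀ x, conj (k x) = k x) (h : Plane → ℂ)
    (x : Plane) :
    schwartzConv k (fun y => conj (h y)) x = conj (schwartzConv k h x) := by
  rw [schwartzConv, schwartzConv, ← integral_conj]
  simp [hk]

/-- The commutator of a convolution operator with a product of two functions, tested against a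
third one, gains a derivative on one of the two factors. -/
theorem eLpNorm_commutator_le (k : 𝓢(Plane, ℂ)) {a b h : Plane → ℂ} (ha : Measurable a)
    (hb : Measurable b) (hh : Measurable h) (hh2 : MemLp h 2) {D L H : ℝ≥0∞}
    (hL : L ≠ ⊤) (hH : H ≠ ⊤) (haL : eLpNorm a 6 ≤ L) (hbL : eLpNorm b 6 ≤ L)
    (hhH : eLpNorm h 6 ≤ H) (haD : ∀ z, eLpNorm (fun x => a (x - z) - a x) 6 ≤ ‖z‖ₑ * D)
    (hbD : ∀ z, eLpNorm (fun x => b (x - z) - b x) 6 ≤ ‖z‖ₑ * D) :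
    eLpNorm (fun x =>
        schwartzConv k (fun y => a y * b y * h y) x - a x * b x * schwartzConv k h x) 2
      ≤ (∫⁻ z, ‖z‖ₑ * ‖k z‖ₑ) * (2 * D * L * H) := by
  have hprod : MemLp (fun y => a y * b y * h y) 2 :=
    ⟨by fun_prop, (eLpNorm_mul_mul_le (by fun_prop) (by fun_prop) (by fun_prop)).trans_lt
      (lt_of_le_of_lt (by gcongr) (by finiteness : L * L * H < ⊤))⟩
  set g : Plane → Plane → ℂ := fun z x => (a (x - z) * b (x - z) - a x * b x) * h (x - z) with hg
  have hgm : Measurable (Function.uncurry g) := by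
    simp only [Function.uncurry_def, hg]
    fun_prop
  have hg2 : ∀ z, eLpNorm (g z) 2 ≤ ‖z‖ₑ * (2 * D * L * H) := by
    intro z
    have e1 : g z = (fun x => (a (x - z) - a x) * b (x - z) * h (x - z)) +
        fun x => a x * (b (x - z) - b x) * h (x - z) := by
      ext x; simp only [hg, Pi.add_apply]; ring
    have hbz : Measurable fun x => b (x - z) := by fun_prop
    have hhz : Measurable fun x => h (x - z) := by fun_prop
    have haz : Measurable fun x => a (x - z) := by fun_prop
    rw [e1]
    refine (eLpNorm_add_le (by fun_prop) (by fun_prop) (by norm_num)).trans ?_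
    refine (add_le_add
      (eLpNorm_mul_mul_le (haz.sub ha).aestronglyMeasurable hbz.aestronglyMeasurable
        hhz.aestronglyMeasurable)
      (eLpNorm_mul_mul_le ha.aestronglyMeasurable (hbz.sub hb).aestronglyMeasurable
        hhz.aestronglyMeasurable)).trans ?_
    rw [eLpNorm_comp_sub_right hh.aestronglyMeasurable,
      eLpNorm_comp_sub_right hb.aestronglyMeasurable]
    calc _ ≤ ‖z‖ₑ * D * L * H + L * (‖z‖ₑ * D) * H := by gcongr; exacts [haD z, hbD z]
      _ = _ := by ring
  -- moving `|z|` from the difference to the kernel `k z` leaves difference quotients in the average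
  refine eLpNorm_le_of_enorm_le_lintegral (by norm_num) (by norm_num)
    (κ := fun z => ‖z‖ₑ * ‖k z‖ₑ) (H := fun z x => ‖(‖z‖⁻¹ : ℝ) • g z x‖ₑ) ?_ ?_ ?_ ?_
  · exact measurable_enorm.mul k.continuous.measurable.enorm
  · refine Measurable.enorm ?_
    exact (measurable_fst.norm.inv).smul hgm
  · refine Eventually.of_forall fun x => ?_
    have e1 : schwartzConv k (fun y => a y * b y * h y) x - a x * b x * schwartzConv k h x =
        ∫ z, k z * g z x := by
      have i1 : Integrable fun z => k z * (a (x - z) * b (x - z) * h (x - z)) := by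
        have := (schwartzConv_integrable k hprod x).comp_sub_left x
        simpa using this
      have i2 : Integrable fun z => k z * h (x - z) := by
        have := (schwartzConv_integrable k hh2 x).comp_sub_left x
        simpa using this
      rw [schwartzConv_eq, schwartzConv_eq, ← integral_const_mul,
        ← integral_sub i1 (i2.const_mul _)]
      refine integral_congr_ae (Eventually.of_forall fun z => ?_)
      simp only [hg]; ring
    rw [e1]
    refine (enorm_integral_le_lintegral_enorm _).trans (lintegral_mono fun z => ?_)
    simp only
    rw [enorm_mul]
    by_cases hz : z = 0
    · simp [hz, hg]
    · have h1 : ‖‖z‖⁻¹‖ₑ * ‖z‖ₑ = 1 := by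
        rw [enorm_inv (norm_ne_zero_iff.2 hz), enorm_norm]
        exact ENNReal.inv_mul_cancel (by simpa using hz) (by simp)
      rw [enorm_smul]
      refine le_of_eq ?_
      calc ‖k z‖ₑ * ‖g z x‖ₑ = (‖‖z‖⁻¹‖ₑ * ‖z‖ₑ) * (‖k z‖ₑ * ‖g z x‖ₑ) := by rw [h1, one_mul]
        _ = _ := by ring
  · intro z
    simp_rw [eLpNorm_enorm]
    have : (fun x => (‖z‖⁻¹ : ℝ) • g z x) = (‖z‖⁻¹ : ℝ) • g z := rfl
    rw [this]
    refine (eLpNorm_const_smul_le).trans ?_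
    by_cases hz : z = 0
    · simp [hz]
    · refine (mul_le_mul_right (hg2 z) _).trans ?_
      rw [← mul_assoc, enorm_inv (norm_ne_zero_iff.2 hz), enorm_norm,
        ENNReal.inv_mul_cancel (by simpa using hz) (by simp), one_mul]

/-- The mean value inequality in `L^p` for translations. -/
theorem eLpNorm_comp_sub_sub_le {l : Plane → ℂ} (hl : Differentiable ℝ l) {d : Fin 2 → Plane → ℂ}
    (hd : ∀ i x, fderiv ℝ l x (EuclideanSpace.single i 1) = d i x) (hdc : ∀ i, Continuous (d i))
    {p : ℝ≥0∞} (hp1 : 1 ≤ p) (hpt : p ≠ ⊤) (z : Plane) :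
    eLpNorm (fun x => l (x - z) - l x) p ≤ ‖z‖ₑ * (eLpNorm (d 0) p + eLpNorm (d 1) p) := by
  have hfd : ∀ x, fderiv ℝ l x z = (z 0 : ℂ) * d 0 x + (z 1 : ℂ) * d 1 x := by
    intro x
    have hz : z = z 0 • EuclideanSpace.single 0 1 + z 1 • EuclideanSpace.single 1 1 := by
      ext i; fin_cases i <;> simp
    conv_lhs => rw [hz]
    rw [map_add, map_smul, map_smul, hd, hd]
    simp
  have hfc : Continuous fun x => fderiv ℝ l x z := by
    simp_rw [hfd]
    have := hdc 0; have := hdc 1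
    fun_prop
  have key := eLpNorm_le_of_enorm_le_lintegral (μ := (volume : Measure Plane))
    (ν := (volume : Measure ℝ).restrict (Ioc 0 1)) hp1 hpt (κ := fun _ => 1) measurable_const
    (F := fun x => l (x - z) - l x)
    (H := fun θ x => ‖fderiv ℝ l (x - θ • z) z‖ₑ) (B := ‖z‖ₑ * (eLpNorm (d 0) p + eLpNorm (d 1) p))
    ?_ ?_ ?_
  · simpa using key
  · refine Continuous.measurable ?_
    exact (hfc.comp (by fun_prop : Continuous fun q : ℝ × Plane => q.2 - q.1 • z)).enorm
  · refine Eventually.of_forall fun x => ?_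
    have h1 : ∀ θ : ℝ, HasDerivAt (fun θ : ℝ => l (x - θ • z)) (-(fderiv ℝ l (x - θ • z) z)) θ := by
      intro θ
      have h2 : HasDerivAt (fun θ : ℝ => x - θ • z) (-z) θ := by
        simpa using ((hasDerivAt_id θ).smul_const z).const_sub x
      have h3 := (hl (x - θ • z)).hasFDerivAt.comp_hasDerivAt θ h2
      rw [map_neg] at h3
      exact h3
    have h3 := intervalIntegral.integral_eq_sub_of_hasDerivAt (a := 0) (b := 1) (fun θ _ => h1 θ)
      (Continuous.intervalIntegrable (by
        exact (hfc.comp (by fun_prop : Continuous fun θ : ℝ => x - θ • z)).neg) 0 1)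
    simp only [one_smul, zero_smul, sub_zero] at h3
    simp only [one_mul]
    rw [← h3, intervalIntegral.integral_of_le zero_le_one]
    refine (enorm_integral_le_lintegral_enorm _).trans (le_of_eq ?_)
    simp
  · intro θ
    simp_rw [eLpNorm_enorm, hfd]
    refine (eLpNorm_add_le (f := fun x => (z 0 : ℂ) * d 0 (x - θ • z))
      (g := fun x => (z 1 : ℂ) * d 1 (x - θ • z)) ?_ ?_ hp1).trans ?_
    · have := hdc 0
      exact Continuous.aestronglyMeasurable (by fun_prop)
    · have := hdc 1
      exact Continuous.aestronglyMeasurable (by fun_prop)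
    have h4 : ∀ i, eLpNorm (fun x => (z i : ℂ) * d i (x - θ • z)) p ≤ ‖z‖ₑ * eLpNorm (d i) p := by
      intro i
      rw [← eLpNorm_comp_sub_right (hdc i).aestronglyMeasurable (θ • z)]
      refine (eLpNorm_const_smul_le (c := (z i : ℂ)) (f := fun x => d i (x - θ • z))).trans ?_
      gcongr
      rw [← ofReal_norm, ← ofReal_norm]
      refine ENNReal.ofReal_le_ofReal ?_
      simpa using PiLp.norm_apply_le z i
    rw [mul_add]
    exact add_le_add (h4 0) (h4 1)

theorem ofReal_norm_sq_mul (z : ℂ) : ((‖z‖ ^ 2 : ℝ) : ℂ) * z = z * conj z * z := by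
  rw [Complex.mul_conj, Complex.normSq_eq_norm_sq]

/-- The terms of `|l + h|² (l + h)` that are at least quadratic in `h`. -/
noncomputable def cubicRemainder (l h : Plane → ℂ) (x : Plane) : ℂ :=
  l x * h x * conj (h x) + (l x * h x * conj (h x) +
    (conj (l x) * h x * h x + h x * conj (h x) * h x))

theorem eLpNorm_cubicRemainder_le {l h : Plane → ℂ} (hl : Measurable l) (hh : Measurable h)
    {L H : ℝ≥0∞} (hL : eLpNorm l 6 ≤ L) (hH : eLpNorm h 6 ≤ H) :
    eLpNorm (cubicRemainder l h) 2 ≤ 3 * L * H ^ 2 + H ^ 3 := by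
  have hlc : Measurable fun x => conj (l x) := Complex.continuous_conj.measurable.comp hl
  have hhc : Measurable fun x => conj (h x) := Complex.continuous_conj.measurable.comp hh
  have e1 : cubicRemainder l h = (fun x => l x * h x * conj (h x)) +
    ((fun x => l x * h x * conj (h x)) + ((fun x => conj (l x) * h x * h x) +
      fun x => h x * conj (h x) * h x)) := rfl
  have m1 : AEStronglyMeasurable (fun x => l x * h x * conj (h x)) volume :=
    ((hl.mul hh).mul hhc).aestronglyMeasurable
  have m2 : AEStronglyMeasurable (fun x => conj (l x) * h x * h x) volume :=
    ((hlc.mul hh).mul hh).aestronglyMeasurable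
  have m3 : AEStronglyMeasurable (fun x => h x * conj (h x) * h x) volume :=
    ((hh.mul hhc).mul hh).aestronglyMeasurable
  have t1 : eLpNorm (fun x => l x * h x * conj (h x)) 2 ≤ L * H * H := by
    refine (eLpNorm_mul_mul_le hl.aestronglyMeasurable hh.aestronglyMeasurable
      hhc.aestronglyMeasurable).trans ?_
    rw [eLpNorm_conj]; gcongr
  have t2 : eLpNorm (fun x => conj (l x) * h x * h x) 2 ≤ L * H * H := by
    refine (eLpNorm_mul_mul_le hlc.aestronglyMeasurable hh.aestronglyMeasurable
      hh.aestronglyMeasurable).trans ?_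
    rw [eLpNorm_conj]; gcongr
  have t3 : eLpNorm (fun x => h x * conj (h x) * h x) 2 ≤ H * H * H := by
    refine (eLpNorm_mul_mul_le hh.aestronglyMeasurable hhc.aestronglyMeasurable
      hh.aestronglyMeasurable).trans ?_
    rw [eLpNorm_conj]; gcongr
  rw [e1]
  calc _ ≤ L * H * H + (L * H * H + (L * H * H + H * H * H)) :=
        (eLpNorm_add_le m1 (m1.add (m2.add m3)) (by norm_num)).trans (add_le_add t1
          ((eLpNorm_add_le m1 (m2.add m3) (by norm_num)).trans (add_le_add t1
            ((eLpNorm_add_le m2 m3 (by norm_num)).trans (add_le_add t2 t3)))))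
    _ = _ := by ring

/-- The commutator of a convolution operator `K` with the cubic nonlinearity, at `l + h`, where `K`
acts as the identity on `l` and on `|l|² l`. -/
theorem eLpNorm_cubic_commutator_le {k : 𝓢(Plane, ℂ)} (hk : ∀ x, conj (k x) = k x) {l h : Plane → ℂ}
    (hl : Measurable l) (hh : Measurable h) (hl2 : MemLp l 2) (hh2 : MemLp h 2) {D L H : ℝ≥0∞}
    (hL : L ≠ ⊤) (hH : H ≠ ⊤) (hlL : eLpNorm l 6 ≤ L) (hhH : eLpNorm h 6 ≤ H)
    (hlD : ∀ z, eLpNorm (fun x => l (x - z) - l x) 6 ≤ ‖z‖ₑ * D) (hKl : schwartzConv k l = l)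
    (hKl3 : schwartzConv k (fun x => l x * conj (l x) * l x) = fun x => l x * conj (l x) * l x) :
    eLpNorm (fun x => schwartzConv k (fun y => ((‖l y + h y‖ ^ 2 : ℝ) : ℂ) * (l y + h y)) x -
        ((‖schwartzConv k (fun y => l y + h y) x‖ ^ 2 : ℝ) : ℂ) *
          schwartzConv k (fun y => l y + h y) x) 2 ≤
      6 * (∫⁻ z, ‖z‖ₑ * ‖k z‖ₑ) * D * L * H + (∫⁻ z, ‖k z‖ₑ) * (3 * L * H ^ 2 + H ^ 3) +
        (3 * L * ((∫⁻ z, ‖k z‖ₑ) * H) ^ 2 + ((∫⁻ z, ‖k z‖ₑ) * H) ^ 3) := by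
  set A := ∫⁻ z, ‖k z‖ₑ with hA
  set m := ∫⁻ z, ‖z‖ₑ * ‖k z‖ₑ with hm
  have hlc : Measurable fun x => conj (l x) := Complex.continuous_conj.measurable.comp hl
  have hhc : Measurable fun x => conj (h x) := Complex.continuous_conj.measurable.comp hh
  have hKh : Measurable (schwartzConv k h) := (schwartzConv_continuous k hh2).measurable
  have hhc2 : MemLp (fun x => conj (h x)) 2 :=
    ⟨hhc.aestronglyMeasurable, by rw [eLpNorm_conj]; exact hh2.2⟩
  have hlcD : ∀ z, eLpNorm (fun x => conj (l (x - z)) - conj (l x)) 6 ≤ ‖z‖ₑ * D := by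
    intro z
    simp_rw [← map_sub]
    rw [eLpNorm_conj]
    exact hlD z
  have hlcL : eLpNorm (fun x => conj (l x)) 6 ≤ L := by rwa [eLpNorm_conj]
  have hhcH : eLpNorm (fun x => conj (h x)) 6 ≤ H := by rwa [eLpNorm_conj]
  have c1 := eLpNorm_commutator_le k hl hlc hh hh2 hL hH hlL hlcL hhH hlD hlcD
  have c2 := eLpNorm_commutator_le k hl hl hhc hhc2 hL hH hlL hlL hhcH hlD hlD
  simp_rw [schwartzConv_conj hk] at c2
  -- `K` fixes `t1`; the terms linear in `h`, which are `t2` twice and `t3`, give commutators; all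
  -- the others are at least quadratic in `h`, and Hölder's inequality suffices for them
  set t1 : Plane → ℂ := fun y => l y * conj (l y) * l y
  set t2 : Plane → ℂ := fun y => l y * conj (l y) * h y
  set t3 : Plane → ℂ := fun y => l y * l y * conj (h y)
  have mem3 : ∀ {a b c : Plane → ℂ} {A B C : ℝ≥0∞}, Measurable a → Measurable b → Measurable c →
      eLpNorm a 6 ≤ A → eLpNorm b 6 ≤ B → eLpNorm c 6 ≤ C → A ≠ ⊤ → B ≠ ⊤ → C ≠ ⊤ →
      MemLp (fun x => a x * b x * c x) 2 := by
    intro a b c A B C ha hb hc hA hB hC _ _ _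
    refine ⟨((ha.mul hb).mul hc).aestronglyMeasurable, ?_⟩
    refine (eLpNorm_mul_mul_le ha.aestronglyMeasurable hb.aestronglyMeasurable
      hc.aestronglyMeasurable).trans_lt ?_
    exact lt_of_le_of_lt (by gcongr) (by finiteness : A * B * C < ⊤)
  have p1 : MemLp t1 2 := mem3 hl hlc hl hlL hlcL hlL hL hL hL
  have p2 : MemLp t2 2 := mem3 hl hlc hh hlL hlcL hhH hL hL hH
  have p3 : MemLp t3 2 := mem3 hl hl hhc hlL hlL hhcH hL hL hH
  have mR : Measurable (cubicRemainder l h) := by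
    unfold cubicRemainder; fun_prop
  have bR := eLpNorm_cubicRemainder_le hl hh hlL hhH
  have pR : MemLp (cubicRemainder l h) 2 :=
    ⟨mR.aestronglyMeasurable, bR.trans_lt (by finiteness)⟩
  have bKh : eLpNorm (schwartzConv k h) 6 ≤ A * H :=
    (eLpNorm_schwartzConv_le (by norm_num) (by norm_num) k hh).trans (by gcongr)
  have bKR : eLpNorm (schwartzConv k (cubicRemainder l h)) 2 ≤ A * (3 * L * H ^ 2 + H ^ 3) :=
    (eLpNorm_schwartzConv_le (by norm_num) (by norm_num) k mR).trans (by gcongr)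
  have bRK := eLpNorm_cubicRemainder_le hl hKh hlL bKh
  have mRK : Measurable (cubicRemainder l (schwartzConv k h)) := by
    have : Measurable fun x => conj (schwartzConv k h x) :=
      Complex.continuous_conj.measurable.comp hKh
    unfold cubicRemainder; fun_prop
  have hcube : (fun y => ((‖l y + h y‖ ^ 2 : ℝ) : ℂ) * (l y + h y)) =
      t1 + (t2 + (t2 + (t3 + cubicRemainder l h))) := by
    ext y
    rw [ofReal_norm_sq_mul]
    simp only [Pi.add_apply, t1, t2, t3, cubicRemainder, map_add]
    ring
  have hKf : schwartzConv k (fun y => l y + h y) = l + schwartzConv k h := by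
    exact (schwartzConv_add k hl2 hh2).trans (by rw [hKl])
  set d2 : Plane → ℂ := fun x => schwartzConv k t2 x - l x * conj (l x) * schwartzConv k h x
  set d3 : Plane → ℂ := fun x => schwartzConv k t3 x - l x * l x * conj (schwartzConv k h x)
  have hfin : (fun x => schwartzConv k (fun y => ((‖l y + h y‖ ^ 2 : ℝ) : ℂ) * (l y + h y)) x -
        ((‖schwartzConv k (fun y => l y + h y) x‖ ^ 2 : ℝ) : ℂ) *
          schwartzConv k (fun y => l y + h y) x) =
      d2 + (d2 + (d3 + (schwartzConv k (cubicRemainder l h) -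
        cubicRemainder l (schwartzConv k h)))) := by
    ext x
    rw [ofReal_norm_sq_mul, hcube, hKf, schwartzConv_add k p1 (p2.add (p2.add (p3.add pR))),
      schwartzConv_add k p2 (p2.add (p3.add pR)), schwartzConv_add k p2 (p3.add pR),
      schwartzConv_add k p3 pR, hKl3]
    simp only [Pi.add_apply, Pi.sub_apply, d2, d3, cubicRemainder, map_add, t1]
    ring
  have m2 : AEStronglyMeasurable d2 volume :=
    ((schwartzConv_continuous k p2).measurable.sub ((hl.mul hlc).mul hKh)).aestronglyMeasurable
  have m3 : AEStronglyMeasurable d3 volume :=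
    ((schwartzConv_continuous k p3).measurable.sub ((hl.mul hl).mul
      (Complex.continuous_conj.measurable.comp hKh))).aestronglyMeasurable
  have m4 : AEStronglyMeasurable (schwartzConv k (cubicRemainder l h)) volume :=
    (schwartzConv_continuous k pR).aestronglyMeasurable
  have m5 := mRK.aestronglyMeasurable (μ := volume)
  rw [hfin]
  calc _ ≤ m * (2 * D * L * H) + (m * (2 * D * L * H) + (m * (2 * D * L * H) +
        (A * (3 * L * H ^ 2 + H ^ 3) + (3 * L * (A * H) ^ 2 + (A * H) ^ 3)))) :=
        (eLpNorm_add_le m2 (m2.add (m3.add (m4.sub m5))) (by norm_num)).trans (add_le_add c1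
          ((eLpNorm_add_le m2 (m3.add (m4.sub m5)) (by norm_num)).trans (add_le_add c1
            ((eLpNorm_add_le m3 (m4.sub m5) (by norm_num)).trans (add_le_add c2
              ((eLpNorm_sub_le m4 m5 (by norm_num)).trans (add_le_add bKR bRK)))))))
    _ = _ := by ring

/-! ### Fixed-time estimates for the truncated `I`-operator -/

section

variable {s : ℝ} {φ : ℝ → ℝ}

/-- The symbol, as a function of Mathlib's frequency variable, of the operator `I_N` truncated to
frequencies below `2^(J+2) N`. -/
noncomputable def truncSymbol (hφ : IsIProfile s φ) {N : ℝ} (hN : 1 ≤ N) (J : ℕ) : 𝓢(Plane, ℂ) :=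
  ((isTestSymbol_iSymbol hφ (J + 1)).comp_smul (c := 2 * Real.pi / N)
    (by positivity)).toSchwartz

/-- The convolution kernel of the truncated `I`-operator. -/
noncomputable def truncKernel (hφ : IsIProfile s φ) {N : ℝ} (hN : 1 ≤ N) (J : ℕ) : 𝓢(Plane, ℂ) :=
  𝓕⁻ (truncSymbol hφ hN J)

theorem truncSymbol_apply (hφ : IsIProfile s φ) {N : ℝ} (hN : 1 ≤ N) (J : ℕ) (ξ : Plane) :
    truncSymbol hφ hN J ξ = (iSymbol φ (J + 1) ((2 * Real.pi / N) • ξ) : ℂ) := rfl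

/-- The multiplier `⟨D⟩ I_N`, as a function of Mathlib's frequency variable. -/
noncomputable def bracketISymbol (φ : ℝ → ℝ) (N : ℝ) (ξ : Plane) : ℝ :=
  japaneseBracket ((2 * Real.pi) • ξ) * φ (‖(2 * Real.pi) • ξ‖ / N)

theorem isTestSymbol_freqBump {a : ℝ} (ha : 0 < a) :
    IsTestSymbol fun z => ((freqBump (a • z) : ℝ) : ℂ) :=
  ⟨Complex.ofRealCLM.contDiff.comp (freqBump_smul_contDiff a),
    hasCompactSupport_of_norm (2 / a) fun z hz => by
      have : freqBump (a • z) = 0 := freqBump_eq_zero (by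
        rw [norm_smul, Real.norm_of_nonneg ha.le]
        rw [div_le_iff₀ ha] at hz; linarith)
      simp [this]⟩

theorem norm_two_pi_smul_div {N : ℝ} (hN : 1 ≤ N) (ξ : Plane) :
    ‖(2 * Real.pi) • ξ‖ / N = ‖(2 * Real.pi / N) • ξ‖ := by
  rw [norm_smul, norm_smul, Real.norm_of_nonneg (by positivity),
    Real.norm_of_nonneg (by positivity)]
  ring

theorem conj_fourierInv_of_even {b : Plane → ℂ} (hb : ∀ ξ, conj (b ξ) = b (-ξ)) (x : Plane) :
    conj (𝓕⁻ b x) = 𝓕⁻ b x := by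
  rw [Real.fourierInv_eq, ← integral_conj, ← integral_neg_eq_self]
  congr 1
  ext ξ
  simp [Circle.smul_def, ← Circle.coe_inv_eq_conj, AddChar.map_neg_eq_inv, hb]

theorem conj_truncKernel (hφ : IsIProfile s φ) {N : ℝ} (hN : 1 ≤ N) (J : ℕ) (x : Plane) :
    conj (truncKernel hφ hN J x) = truncKernel hφ hN J x := by
  rw [truncKernel, SchwartzMap.fourierInv_coe]
  refine conj_fourierInv_of_even (fun ξ => ?_) x
  rw [truncSymbol_apply, truncSymbol_apply, Complex.conj_ofReal, iSymbol, iSymbol, smul_neg,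
    norm_neg, smul_neg, freqBump.neg]

/-- The low-frequency cutoff: frequencies below `N / 4`. -/
noncomputable def lowCutoff {N : ℝ} (hN : 1 ≤ N) : 𝓢(Plane, ℂ) :=
  (isTestSymbol_freqBump (a := 8 * (2 * Real.pi / N)) (by positivity)).toSchwartz

theorem lowCutoff_apply {N : ℝ} (hN : 1 ≤ N) (ξ : Plane) :
    lowCutoff hN ξ = (freqBump ((8 * (2 * Real.pi / N)) • ξ) : ℂ) := rfl

theorem norm_le_of_lowCutoff_ne_zero {N : ℝ} (hN : 1 ≤ N) {ξ : Plane} (h : lowCutoff hN ξ ≠ 0) :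
    ‖ξ‖ ≤ N / (8 * Real.pi) := by
  by_contra hc
  refine h ?_
  rw [lowCutoff_apply, freqBump_eq_zero, Complex.ofReal_zero]
  rw [norm_smul, Real.norm_of_nonneg (by positivity)]
  have hp := Real.pi_pos
  push Not at hc
  rw [div_lt_iff₀ (by positivity)] at hc
  have h1 : 8 * (2 * Real.pi / N) * ‖ξ‖ = (2 * (‖ξ‖ * (8 * Real.pi))) / N := by ring
  rw [h1, le_div_iff₀ (by linarith)]
  linarith

theorem truncSymbol_eq_one (hφ : IsIProfile s φ) {N : ℝ} (hN : 1 ≤ N) (J : ℕ) {ξ : Plane}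
    (h : ‖ξ‖ ≤ 3 * (N / (8 * Real.pi))) : truncSymbol hφ hN J ξ = 1 := by
  have hp := Real.pi_pos
  have h1 : ‖(2 * Real.pi / N) • ξ‖ ≤ 1 := by
    rw [norm_smul, Real.norm_of_nonneg (by positivity)]
    calc 2 * Real.pi / N * ‖ξ‖ ≤ 2 * Real.pi / N * (3 * (N / (8 * Real.pi))) := by gcongr
      _ = 3 / 4 := by field_simp; norm_num
      _ ≤ 1 := by norm_num
  rw [truncSymbol_apply, iSymbol, hφ.eq_one _ h1, freqBump_eq_one, one_mul, Complex.ofReal_one]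
  rw [norm_smul, norm_inv, norm_pow, Real.norm_ofNat]
  exact mul_le_one₀ (inv_le_one_of_one_le₀ (one_le_pow₀ (by norm_num))) (norm_nonneg _) h1

theorem lowCutoff_eq (hφ : IsIProfile s φ) {N : ℝ} (hN : 1 ≤ N) (ξ : Plane) :
    lowCutoff hN ξ =
      ((lowSymbol (N / 8) ((2 * Real.pi) • ξ) * bracketISymbol φ N ξ : ℝ) : ℂ) := by
  rw [lowCutoff_apply, lowSymbol, bracketISymbol, smul_smul]
  have h1 : 8 * (2 * Real.pi / N) = (N / 8)⁻¹ * (2 * Real.pi) := by field_simp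
  rw [h1, Complex.ofReal_inj]
  by_cases h : freqBump (((N / 8)⁻¹ * (2 * Real.pi)) • ξ) = 0
  · rw [h]; simp
  · have h2 : ‖ξ‖ ≤ N / (8 * Real.pi) := norm_le_of_lowCutoff_ne_zero hN (by
      rw [lowCutoff_apply, h1]; exact_mod_cast h)
    have h3 : ‖(2 * Real.pi) • ξ‖ / N ≤ 1 := by
      have := Real.pi_pos
      rw [norm_smul, Real.norm_of_nonneg (by positivity), div_le_one (by linarith)]
      rw [le_div_iff₀ (by positivity)] at h2
      nlinarith [norm_nonneg ξ]
    rw [hφ.eq_one _ h3, mul_one, inv_mul_cancel_right₀ (japaneseBracket_pos _).ne']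

/-- The difference of the projections to frequencies below `2^(J+2) N` and below `N/4`. -/
noncomputable def highCutoff {N : ℝ} (hN : 1 ≤ N) (J : ℕ) : 𝓢(Plane, ℂ) :=
  (((isTestSymbol_freqBump (a := ((2 : ℝ) ^ (J + 1))⁻¹) (by positivity)).comp_smul
    (c := 2 * Real.pi / N) (by positivity)).toSchwartz) - lowCutoff hN

theorem highCutoff_apply {N : ℝ} (hN : 1 ≤ N) (J : ℕ) (ξ : Plane) :
    highCutoff hN J ξ =
      (freqBump (((2 : ℝ) ^ (J + 1))⁻¹ • (2 * Real.pi / N) • ξ) : ℂ) - lowCutoff hN ξ := rfl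

theorem highCutoff_eq (hφ : IsIProfile s φ) {N : ℝ} (hN : 1 ≤ N) (J : ℕ) (ξ : Plane) :
    highCutoff hN J ξ = ((N⁻¹ * highSymbol φ (J + 1) N⁻¹ ((2 * Real.pi / N) • ξ) *
      bracketISymbol φ N ξ : ℝ) : ℂ) := by
  have hN0 : 0 < N := by linarith
  have h1 : (2 * Real.pi) • ξ = N • (2 * Real.pi / N) • ξ := by
    rw [smul_smul]; congr 1; field_simp
  have h3 : japaneseBracket ((2 * Real.pi) • ξ) =
      N * √(N⁻¹ ^ 2 + ‖(2 * Real.pi / N) • ξ‖ ^ 2) := by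
    rw [japaneseBracket_scale hN0, zero_add, h1, inv_smul_smul₀ hN0.ne']
  have hpos : 0 < √(N⁻¹ ^ 2 + ‖(2 * Real.pi / N) • ξ‖ ^ 2) := by positivity
  rw [highCutoff_apply, lowCutoff_apply, mul_smul, highSymbol, bracketISymbol,
    norm_two_pi_smul_div hN, h3]
  have := (hφ.pos ‖(2 * Real.pi / N) • ξ‖).ne'
  rw [← Complex.ofReal_sub, Complex.ofReal_inj]
  field_simp

theorem tendsto_highCutoff {N : ℝ} (hN : 1 ≤ N) (ξ : Plane) :
    Tendsto (fun J => highCutoff hN J ξ) atTop (𝓝 (1 - lowCutoff hN ξ)) := by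
  simp_rw [highCutoff_apply]
  refine Tendsto.sub_const ?_ _
  have h1 : Tendsto (fun J : ℕ => ((2 : ℝ) ^ (J + 1))⁻¹ • (2 * Real.pi / N) • ξ) atTop (𝓝 0) := by
    have h2 : Tendsto (fun J : ℕ => ((2 : ℝ) ^ (J + 1))⁻¹) atTop (𝓝 0) :=
      tendsto_inv_atTop_zero.comp
        ((tendsto_pow_atTop_atTop_of_one_lt one_lt_two).comp (tendsto_add_atTop_nat 1))
    simpa using h2.smul_const ((2 * Real.pi / N) • ξ)
  have h3 : Tendsto (fun z : Plane => (freqBump z : ℂ)) (𝓝 0) (𝓝 1) := by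
    have h4 := (Complex.continuous_ofReal.comp freqBump.continuous).tendsto (0 : Plane)
    rw [Function.comp_apply, freqBump_eq_one (z := 0) (by simp), Complex.ofReal_one] at h4
    exact h4
  exact h3.comp h1

theorem norm_highCutoff_le {N : ℝ} (hN : 1 ≤ N) (J : ℕ) (ξ : Plane) : ‖highCutoff hN J ξ‖ ≤ 2 := by
  rw [highCutoff_apply, lowCutoff_apply, ← Complex.ofReal_sub, Complex.norm_real, Real.norm_eq_abs,
    abs_le]
  constructor <;>
  linarith [freqBump.nonneg (x := ((2 : ℝ) ^ (J + 1))⁻¹ • (2 * Real.pi / N) • ξ),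
    freqBump.le_one (x := ((2 : ℝ) ^ (J + 1))⁻¹ • (2 * Real.pi / N) • ξ),
    freqBump.nonneg (x := (8 * (2 * Real.pi / N)) • ξ),
    freqBump.le_one (x := (8 * (2 * Real.pi / N)) • ξ)]

section FixedTime

variable {N : ℝ} (hN : 1 ≤ N) {f v : L2Plane}
  (hv : ∀ᵐ ξ, (𝓕 v : L2Plane) ξ = (bracketISymbol φ N ξ : ℂ) * (𝓕 f : L2Plane) ξ)

include hv

/-- Here `v` stands for `⟨D⟩ I_N f`. On the low frequencies `I_N` is the identity, so that the low
part of `f` is `P ⟨D⟩⁻¹ v`. -/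
theorem eLpNorm_lowPart_le (hφ : IsIProfile s φ) :
    eLpNorm (schwartzConv (𝓕⁻ (lowCutoff hN)) f) 6 ≤
      kernelNorm (fun z => (lowSymbol (N / 8) z : ℂ)) * eLpNorm v 6 := by
  set hs := (isTestSymbol_lowSymbol (w := fun _ => 1) contDiff_const (S := N / 8)
    (by positivity)).comp_smul (c := 2 * Real.pi) (by positivity) with hhs
  rw [schwartzConv_eq_of_symbol (b' := hs.toSchwartz) hv fun ξ => by
    rw [lowCutoff_eq hφ, IsTestSymbol.toSchwartz_apply]; push_cast; simp]
  refine (hs.eLpNorm_conv_le (by norm_num) (by norm_num)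
    (Lp.stronglyMeasurable v).measurable).trans (le_of_eq ?_)
  have := kernelNorm_comp_smul (fun z => ((1 * lowSymbol (N / 8) z : ℝ) : ℂ))
    (c := 2 * Real.pi) (by positivity)
  rw [this]
  simp

open LineDeriv in
theorem eLpNorm_lowPart_deriv_le (hφ : IsIProfile s φ) (e : Plane) :
    eLpNorm (schwartzConv (∂_{e} (𝓕⁻ (lowCutoff hN))) f) 6 ≤
      kernelNorm (fun z => ((inner ℝ z e * lowSymbol (N / 8) z : ℝ) : ℂ)) * eLpNorm v 6 := by
  have hw : ContDiff ℝ ∞ fun z : Plane => inner ℝ z e := contDiff_id.inner ℝ contDiff_const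
  set hs := ((isTestSymbol_lowSymbol hw (S := N / 8)
    (by positivity)).const_mul Complex.I).comp_smul (c := 2 * Real.pi) (by positivity) with hhs
  rw [SchwartzMap.lineDerivOp_fourierInv_eq,
    schwartzConv_eq_of_symbol (b' := hs.toSchwartz) hv fun ξ => by
      rw [smul_apply, SchwartzMap.smulLeftCLM_apply_apply (by fun_prop),
        lowCutoff_eq hφ, IsTestSymbol.toSchwartz_apply]
      simp only [Complex.real_smul, smul_eq_mul, inner_smul_left]
      push_cast
      simp
      ring]
  refine (hs.eLpNorm_conv_le (by norm_num) (by norm_num)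
    (Lp.stronglyMeasurable v).measurable).trans (le_of_eq ?_)
  have := kernelNorm_comp_smul (fun z => Complex.I * ((inner ℝ z e * lowSymbol (N / 8) z : ℝ) : ℂ))
    (c := 2 * Real.pi) (by positivity)
  rw [this, kernelNorm_const_mul, ← ofReal_norm Complex.I, Complex.norm_I, ENNReal.ofReal_one,
    one_mul]

/-- Here `v` stands for `⟨D⟩ I_N f`. The multiplier that recovers the high part of `f` from `v` has
no integrable kernel to hand; its truncations have uniformly bounded ones, and Fatou's lemma passes
to the limit. -/
theorem eLpNorm_highPart_le (hφ : IsIProfile s φ) {C : ℝ≥0}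
    (hC : ∀ J, ∀ l ∈ Icc (0 : ℝ) 1, kernelNorm (fun z => (highSymbol φ (J + 1) l z : ℂ)) ≤ C) :
    eLpNorm (fun x => f x - schwartzConv (𝓕⁻ (lowCutoff hN)) f x) 6 ≤
      ENNReal.ofReal N⁻¹ * C * eLpNorm v 6 := by
  have hN0 : 0 < N := by linarith
  set l := (memLp_schwartzConv (𝓕⁻ (lowCutoff hN)) (Lp.memLp f)).toLp _ with hl
  have hfl : ((f - l : L2Plane) : Plane → ℂ) =ᵐ[volume]
      fun x => f x - schwartzConv (𝓕⁻ (lowCutoff hN)) f x :=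
    (Lp.coeFn_sub f l).trans (EventuallyEq.rfl.sub (MemLp.coeFn_toLp _))
  rw [← eLpNorm_congr_ae hfl]
  have hlim := tendsto_schwartzConv (b := highCutoff hN) (C := 2) (norm_highCutoff_le hN)
    (tendsto_highCutoff hN) (f := f) (g := f - l) (by
      have h3 : (𝓕 (f - l) : L2Plane) = (𝓕 f : L2Plane) - (𝓕 l : L2Plane) :=
        map_sub (Lp.fourierTransformₗᵢ Plane ℂ) f l
      rw [h3]
      filter_upwards [Lp.coeFn_sub (𝓕 f : L2Plane) (𝓕 l : L2Plane),
        fourier_toLp_schwartzConv (lowCutoff hN) f] with ξ e1 e2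
      rw [e1, Pi.sub_apply, e2]; ring)
  refine eLpNorm_le_of_tendsto
    (fun J => (schwartzConv_continuous _ (Lp.memLp f)).aestronglyMeasurable)
    (Lp.aestronglyMeasurable _) hlim fun J => ?_
  set hs := ((isTestSymbol_highSymbol hφ J N⁻¹).const_mul ((N⁻¹ : ℝ) : ℂ)).comp_smul
    (c := 2 * Real.pi / N) (by positivity) with hhs
  rw [schwartzConv_eq_of_symbol (b' := hs.toSchwartz) hv fun ξ => by
    rw [highCutoff_eq hφ, IsTestSymbol.toSchwartz_apply]; push_cast; rfl]
  refine (hs.eLpNorm_conv_le (by norm_num) (by norm_num)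
    (Lp.stronglyMeasurable v).measurable).trans ?_
  have := kernelNorm_comp_smul (fun z => ((N⁻¹ : ℝ) : ℂ) * (highSymbol φ (J + 1) N⁻¹ z : ℂ))
    (c := 2 * Real.pi / N) (by positivity)
  rw [this, kernelNorm_const_mul]
  gcongr
  · rw [← ofReal_norm, Complex.norm_real, Real.norm_of_nonneg (by positivity)]
  · exact hC J _ ⟨by positivity, inv_le_one_of_one_le₀ hN⟩

end FixedTime

open LineDeriv in
/-- For the truncated `I`-operator `I`, uniformly in the truncation,
`‖I (|f|² f) - |I f|² I f‖_2 ≤ C N ^ (-2 + ε) ‖⟨D⟩ I_N f‖_6 ^ 3`. -/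
theorem exists_cubic_commutator_bound (hs0 : 0 < s) (hs1 : s < 1) (hφ : IsIProfile s φ) {ε : ℝ}
    (hε : 0 < ε) :
    ∃ C : ℝ≥0, ∀ (N : ℝ) (hN : 1 ≤ N) (J : ℕ) (f v : L2Plane),
      (∀ᵐ ξ, (𝓕 v : L2Plane) ξ = (bracketISymbol φ N ξ : ℂ) * (𝓕 f : L2Plane) ξ) →
      eLpNorm v 6 < ⊤ →
      eLpNorm f 6 ≤ C * eLpNorm v 6 ∧
      eLpNorm (fun x => schwartzConv (truncKernel hφ hN J)
          (fun y => ((‖f y‖ ^ 2 : ℝ) : ℂ) * f y) x -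
        ((‖schwartzConv (truncKernel hφ hN J) f x‖ ^ 2 : ℝ) : ℂ) *
          schwartzConv (truncKernel hφ hN J) f x) 2 ≤
      C * ENNReal.ofReal (N ^ (-2 + ε)) * eLpNorm v 6 ^ 3 := by
  obtain ⟨CI, hCI⟩ := exists_bound_iSymbol hs1 hφ
  obtain ⟨CH, hCH⟩ := exists_bound_highSymbol hs0 hφ
  obtain ⟨CL, hCL⟩ := exists_bound_lowSymbol
  obtain ⟨C0, hC0⟩ := exists_bound_lowSymbol_deriv hε (EuclideanSpace.single 0 1)
  obtain ⟨C1, hC1⟩ := exists_bound_lowSymbol_deriv hε (EuclideanSpace.single 1 1)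
  set p : ℝ≥0 := ⟨2 * Real.pi, by positivity⟩ with hp
  refine ⟨6 * (p * CI) * (C0 + C1) * CL * CH + CI * (3 * CL * CH ^ 2 + CH ^ 3) +
    (3 * CL * (CI * CH) ^ 2 + (CI * CH) ^ 3) + (CL + CH), fun N hN J f v hv hv6 => ?_⟩
  have hN0 : 0 < N := by linarith
  set V := eLpNorm v 6 with hV
  set n : ℝ≥0∞ := ENNReal.ofReal N⁻¹ with hn
  have hn1 : n ≤ 1 := by
    rw [hn, ENNReal.ofReal_le_one]; exact inv_le_one_of_one_le₀ hN
  set l : Plane → ℂ := schwartzConv (𝓕⁻ (lowCutoff hN)) f with hl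
  set h : Plane → ℂ := fun x => f x - l x with hh
  have hl2 : MemLp l 2 := memLp_schwartzConv _ (Lp.memLp f)
  have hh2 : MemLp h 2 := (Lp.memLp f).sub hl2
  have hlc : Continuous l := schwartzConv_continuous _ (Lp.memLp f)
  have hlm : Measurable l := hlc.measurable
  have hhm : Measurable h := (Lp.stronglyMeasurable f).measurable.sub hlm
  have hflh : (f : Plane → ℂ) = fun x => l x + h x := by ext x; simp [hh]
  have hL : eLpNorm l 6 ≤ CL * V :=
    (eLpNorm_lowPart_le hN hv hφ).trans (mul_le_mul_left (hCL N hN) _)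
  have hH : eLpNorm h 6 ≤ n * CH * V := eLpNorm_highPart_le hN hv hφ hCH
  have hD : ∀ z, eLpNorm (fun x => l (x - z) - l x) 6 ≤
      ‖z‖ₑ * ((C0 + C1) * ENNReal.ofReal (N ^ ε) * V) := by
    intro z
    refine (eLpNorm_comp_sub_sub_le (l := l)
      (d := fun i => schwartzConv (∂_{EuclideanSpace.single i (1 : ℝ)} (𝓕⁻ (lowCutoff hN))) f)
      (fun x => (schwartzConv_hasFDerivAt _ (Lp.memLp f) x).differentiableAt) (fun i x => ?_)
      (fun i => schwartzConv_continuous _ (Lp.memLp f)) (by norm_num) (by norm_num) z).trans ?_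
    · rw [← (schwartzConv_hasFDerivAt _ (Lp.memLp f) x).differentiableAt.lineDeriv_eq_fderiv]
      exact (schwartzConv_hasLineDerivAt _ (Lp.memLp f) x _).lineDeriv
    · gcongr
      rw [add_mul, add_mul]
      exact add_le_add
        ((eLpNorm_lowPart_deriv_le hN hv hφ _).trans (mul_le_mul_left (hC0 N hN) _))
        ((eLpNorm_lowPart_deriv_le hN hv hφ _).trans (mul_le_mul_left (hC1 N hN) _))
  -- products of three functions with frequencies below `N / 4` have frequencies below `3 N / 4`,
  -- where the symbol is `1`; the Fourier variable of Mathlib differs by the factor `2 π`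
  have hband : IsBandLimited (N / (8 * Real.pi)) l :=
    isBandLimited_schwartzConv (fun ξ hξ => norm_le_of_lowCutoff_ne_zero hN hξ) f
  have hr : 0 ≤ N / (8 * Real.pi) := by positivity
  have hKl : schwartzConv (truncKernel hφ hN J) l = l :=
    hband.schwartzConv_eq fun ξ hξ => truncSymbol_eq_one hφ hN J (by linarith)
  have hKl3 : schwartzConv (truncKernel hφ hN J) (fun x => l x * conj (l x) * l x) =
      fun x => l x * conj (l x) * l x :=
    ((hband.mul hband.conj).mul hband).schwartzConv_eq fun ξ hξ =>
      truncSymbol_eq_one hφ hN J (by linarith)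
  have hA : ∫⁻ z, ‖truncKernel hφ hN J z‖ₑ ≤ CI := by
    rw [truncKernel, truncSymbol, IsTestSymbol.lintegral_kernel]
    have := kernelNorm_comp_smul (fun z => (iSymbol φ (J + 1) z : ℂ))
      (c := 2 * Real.pi / N) (by positivity)
    rw [this]
    exact (hCI J).1
  have hm : ∫⁻ z, ‖z‖ₑ * ‖truncKernel hφ hN J z‖ₑ ≤ n * (p * CI) := by
    rw [truncKernel, truncSymbol, IsTestSymbol.lintegral_moment]
    have := kernelMoment_comp_smul (fun z => (iSymbol φ (J + 1) z : ℂ))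
      (c := 2 * Real.pi / N) (by positivity)
    rw [this, div_eq_inv_mul, ENNReal.ofReal_mul (by positivity), mul_assoc]
    gcongr
    · exact (ENNReal.ofReal_eq_coe_nnreal (by positivity)).le
    · exact (hCI J).2
  have hVt : V ≠ ⊤ := hv6.ne
  have hnt : n ≠ ⊤ := ENNReal.ofReal_ne_top
  constructor
  · rw [hflh]
    refine (eLpNorm_add_le hlm.aestronglyMeasurable hhm.aestronglyMeasurable (by norm_num)).trans
      ((add_le_add hL hH).trans ?_)
    push_cast
    calc CL * V + n * CH * V ≤ CL * V + 1 * CH * V := by gcongr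
      _ = (CL + CH) * V := by ring
      _ ≤ _ := mul_le_mul_left le_add_self _
  have key := eLpNorm_cubic_commutator_le (conj_truncKernel hφ hN J) hlm hhm hl2 hh2
    (by finiteness) (by finiteness) hL hH hD hKl hKl3
  rw [hflh]
  refine key.trans ?_
  set E := ENNReal.ofReal (N ^ ε) with hE
  have hE1 : 1 ≤ E := by
    rw [hE, ENNReal.one_le_ofReal]; exact Real.one_le_rpow hN hε.le
  have hNE : ENNReal.ofReal (N ^ (-2 + ε)) = n ^ 2 * E := by
    rw [hn, hE, ← ENNReal.ofReal_pow (by positivity), ← ENNReal.ofReal_mul (by positivity),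
      Real.rpow_add hN0, Real.rpow_neg hN0.le, inv_pow]
    norm_num
  have hn3 : n ^ 3 ≤ n ^ 2 * E := by
    rw [pow_succ]; gcongr; exact hn1.trans hE1
  have hn2 : n ^ 2 ≤ n ^ 2 * E := le_mul_of_one_le_right (by simp) hE1
  rw [hNE]
  set A := ∫⁻ z, ‖truncKernel hφ hN J z‖ₑ
  set m := ∫⁻ z, ‖z‖ₑ * ‖truncKernel hφ hN J z‖ₑ
  push_cast
  -- `n = 1 / N` comes from the moment of the kernel and from each factor `h`, and every term has at
  -- least two such factors
  calc _ ≤ 6 * (n * (p * CI)) * ((C0 + C1) * E * V) * (CL * V) * (n * CH * V) +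
        CI * (3 * (CL * V) * (n * CH * V) ^ 2 + (n * CH * V) ^ 3) +
        (3 * (CL * V) * (CI * (n * CH * V)) ^ 2 + (CI * (n * CH * V)) ^ 3) := by gcongr
    _ = 6 * (p * CI) * (C0 + C1) * CL * CH * (n ^ 2 * E) * V ^ 3 +
        CI * (3 * CL * CH ^ 2 * n ^ 2 + CH ^ 3 * n ^ 3) * V ^ 3 +
        (3 * CL * (CI * CH) ^ 2 * n ^ 2 + (CI * CH) ^ 3 * n ^ 3) * V ^ 3 := by ring
    _ ≤ 6 * (p * CI) * (C0 + C1) * CL * CH * (n ^ 2 * E) * V ^ 3 +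
        CI * (3 * CL * CH ^ 2 * (n ^ 2 * E) + CH ^ 3 * (n ^ 2 * E)) * V ^ 3 +
        (3 * CL * (CI * CH) ^ 2 * (n ^ 2 * E) + (CI * CH) ^ 3 * (n ^ 2 * E)) * V ^ 3 := by gcongr
    _ = (6 * (p * CI) * (C0 + C1) * CL * CH + CI * (3 * CL * CH ^ 2 + CH ^ 3) +
        (3 * CL * (CI * CH) ^ 2 + (CI * CH) ^ 3)) * (n ^ 2 * E) * V ^ 3 := by ring
    _ ≤ _ := mul_le_mul_left (mul_le_mul_left le_self_add _) _

end

/-! ### Interaction Morawetz functionals at a fixed time -/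

/-- The interaction of two densities on the plane through the kernel `θ(⟨x - y, e⟩)`. -/
noncomputable def interaction (θ : ℝ → ℝ) (e : Plane) (a c : Plane → ℝ) : ℝ :=
  ∫ q : Plane × Plane, θ (inner ℝ (q.1 - q.2) e) * (a q.1 * c q.2)

section Interaction

variable {θ θ' : ℝ → ℝ} {X Y : ℝ} {e : Plane} {a b c : Plane → ℝ}

theorem interaction_integrable (hθ : Continuous θ) (hX : ∀ r, |θ r| ≤ X) (ha : Integrable a)
    (hc : Integrable c) :
    Integrable fun q : Plane × Plane => θ (inner ℝ (q.1 - q.2) e) * (a q.1 * c q.2) :=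
  (ha.mul_prod hc).bdd_mul (c := X)
    (Continuous.aestronglyMeasurable (by fun_prop)) (Eventually.of_forall fun q => hX _)

theorem abs_interaction_le (hθ : Continuous θ) (hX : ∀ r, |θ r| ≤ X) (ha : Integrable a)
    (hc : Integrable c) : |interaction θ e a c| ≤ X * ((∫ x, ‖a x‖) * ∫ x, ‖c x‖) := by
  have h0 : 0 ≤ X := (abs_nonneg _).trans (hX 0)
  rw [interaction, ← integral_prod_mul, ← integral_const_mul, ← Real.norm_eq_abs]
  refine (norm_integral_le_integral_norm _).trans
    (integral_mono (interaction_integrable hθ hX ha hc).norm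
      ((ha.norm.mul_prod hc.norm).const_mul X) fun q => ?_)
  simp only [norm_mul]
  gcongr
  exact hX _

theorem interaction_add_left (hθ : Continuous θ) (hX : ∀ r, |θ r| ≤ X) (ha : Integrable a)
    (hb : Integrable b) (hc : Integrable c) :
    interaction θ e (fun x => a x + b x) c = interaction θ e a c + interaction θ e b c := by
  rw [interaction, interaction, interaction, ← integral_add (interaction_integrable hθ hX ha hc)
    (interaction_integrable hθ hX hb hc)]
  congr 1; ext q; ring

theorem interaction_add_right (hθ : Continuous θ) (hX : ∀ r, |θ r| ≤ X) (ha : Integrable a)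
    (hb : Integrable b) (hc : Integrable c) :
    interaction θ e c (fun x => a x + b x) = interaction θ e c a + interaction θ e c b := by
  rw [interaction, interaction, interaction, ← integral_add (interaction_integrable hθ hX hc ha)
    (interaction_integrable hθ hX hc hb)]
  congr 1; ext q; ring

theorem interaction_smul_left (r : ℝ) :
    interaction θ e (fun x => r * a x) c = r * interaction θ e a c := by
  rw [interaction, interaction, ← integral_const_mul]
  congr 1; ext q; ring

theorem interaction_smul_right (r : ℝ) :
    interaction θ e c (fun x => r * a x) = r * interaction θ e c a := by
  rw [interaction, interaction, ← integral_const_mul]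
  congr 1; ext q; ring

theorem interaction_symm (hθ : ∀ r, θ (-r) = θ r) :
    interaction θ e a c = interaction θ e c a := by
  rw [interaction, interaction, Measure.volume_eq_prod, ← integral_prod_swap]
  congr 1
  ext q
  simp only [Prod.fst_swap, Prod.snd_swap]
  rw [← neg_sub, inner_neg_left, hθ]
  ring

/-- Integration by parts in the first density. -/
theorem interaction_deriv_left (hθ' : Continuous θ') (hd : ∀ r, HasDerivAt θ (θ' r) r)
    (hX : ∀ r, |θ r| ≤ X) (hY : ∀ r, |θ' r| ≤ Y) {v : Plane} (ha : Integrable a)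
    (hb : Integrable b) (hc : Integrable c) (hab : ∀ x, HasLineDerivAt ℝ a (b x) x v) :
    interaction θ e b c = -(inner ℝ v e * interaction θ' e a c) := by
  have hθ : Continuous θ := continuous_iff_continuousAt.2 fun r => (hd r).continuousAt
  have : (volume : Measure (Plane × Plane)).IsAddHaarMeasure := by
    rw [Measure.volume_eq_prod]; infer_instance
  have key := integral_bilinear_hasLineDerivAt_right_eq_neg_left_of_integrable
    (μ := (volume : Measure (Plane × Plane))) (B := ContinuousLinearMap.mul ℝ ℝ) (v := (v, 0))
    (f := fun q : Plane × Plane => θ (inner ℝ (q.1 - q.2) e))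
    (f' := fun q => θ' (inner ℝ (q.1 - q.2) e) * inner ℝ v e)
    (g := fun q => a q.1 * c q.2) (g' := fun q => b q.1 * c q.2) ?_ ?_ ?_ ?_ ?_
  · simp only [ContinuousLinearMap.mul_apply'] at key
    rw [interaction, key, interaction, ← integral_const_mul]
    congr 2; ext q; ring
  · simp only [ContinuousLinearMap.mul_apply']
    refine ((interaction_integrable (e := e) hθ' hY ha hc).const_mul (inner ℝ v e)).congr
      (Eventually.of_forall fun q => ?_)
    simp only; ring
  · exact interaction_integrable hθ hX hb hc
  · exact interaction_integrable hθ hX ha hc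
  · intro q _
    have h1 : HasDerivAt (fun t : ℝ => inner ℝ (q.1 - q.2) e + t * inner ℝ v e)
        (inner ℝ v e) 0 := by
      simpa using ((hasDerivAt_id (0 : ℝ)).mul_const (inner ℝ v e)).const_add
        (inner ℝ (q.1 - q.2) e)
    have h2 := (hd (inner ℝ (q.1 - q.2) e + 0 * inner ℝ v e)).comp (0 : ℝ) h1
    rw [zero_mul, add_zero] at h2
    refine h2.congr_of_eventuallyEq (Eventually.of_forall fun t => ?_)
    simp only [Function.comp_apply, Prod.fst_add, Prod.snd_add, Prod.smul_fst, Prod.smul_snd,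
      smul_zero, add_zero]
    congr 1
    rw [add_sub_right_comm, inner_add_left, inner_smul_left]; rfl
  · intro q _
    have h1 : HasDerivAt (fun t : ℝ => a (q.1 + t • v)) (b q.1) 0 := hab q.1
    refine (h1.mul_const (c q.2)).congr_of_eventuallyEq (Eventually.of_forall fun t => ?_)
    simp

/-- Integration by parts in the second density. -/
theorem interaction_deriv_right (hθ' : Continuous θ') (hd : ∀ r, HasDerivAt θ (θ' r) r)
    (hX : ∀ r, |θ r| ≤ X) (hY : ∀ r, |θ' r| ≤ Y) {v : Plane} (ha : Integrable a)
    (hb : Integrable b) (hc : Integrable c) (hab : ∀ x, HasLineDerivAt ℝ a (b x) x v) :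
    interaction θ e c b = inner ℝ v e * interaction θ' e c a := by
  have hθ : Continuous θ := continuous_iff_continuousAt.2 fun r => (hd r).continuousAt
  have : (volume : Measure (Plane × Plane)).IsAddHaarMeasure := by
    rw [Measure.volume_eq_prod]; infer_instance
  have key := integral_bilinear_hasLineDerivAt_right_eq_neg_left_of_integrable
    (μ := (volume : Measure (Plane × Plane))) (B := ContinuousLinearMap.mul ℝ ℝ) (v := (0, v))
    (f := fun q : Plane × Plane => θ (inner ℝ (q.1 - q.2) e))
    (f' := fun q => θ' (inner ℝ (q.1 - q.2) e) * (-inner ℝ v e))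
    (g := fun q => c q.1 * a q.2) (g' := fun q => c q.1 * b q.2) ?_ ?_ ?_ ?_ ?_
  · simp only [ContinuousLinearMap.mul_apply'] at key
    rw [interaction, key, interaction, ← integral_const_mul, ← integral_neg]
    congr 1; ext q; ring
  · simp only [ContinuousLinearMap.mul_apply']
    refine ((interaction_integrable (e := e) hθ' hY hc ha).const_mul (-inner ℝ v e)).congr
      (Eventually.of_forall fun q => ?_)
    simp only; ring
  · exact interaction_integrable hθ hX hc hb
  · exact interaction_integrable hθ hX hc ha
  · intro q _
    have h1 : HasDerivAt (fun t : ℝ => inner ℝ (q.1 - q.2) e + t * (-inner ℝ v e))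
        (-inner ℝ v e) 0 := by
      simpa using ((hasDerivAt_id (0 : ℝ)).mul_const (-inner ℝ v e)).const_add
        (inner ℝ (q.1 - q.2) e)
    have h2 := (hd (inner ℝ (q.1 - q.2) e + 0 * (-inner ℝ v e))).comp (0 : ℝ) h1
    rw [zero_mul, add_zero] at h2
    refine h2.congr_of_eventuallyEq (Eventually.of_forall fun t => ?_)
    simp only [Function.comp_apply, Prod.fst_add, Prod.snd_add, Prod.smul_fst, Prod.smul_snd,
      smul_zero, add_zero]
    congr 1
    rw [← sub_sub, inner_sub_left, inner_smul_left, mul_neg, ← sub_eq_add_neg]; rfl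
  · intro q _
    have h1 : HasDerivAt (fun t : ℝ => a (q.2 + t • v)) (b q.2) 0 := hab q.2
    refine (h1.const_mul (c q.1)).congr_of_eventuallyEq (Eventually.of_forall fun t => ?_)
    simp

end Interaction

theorem HasLineDerivAt.inner_real {f g : Plane → ℂ} {f' g' : ℂ} {x v : Plane}
    (hf : HasLineDerivAt ℝ f f' x v) (hg : HasLineDerivAt ℝ g g' x v) :
    HasLineDerivAt ℝ (fun x => inner ℝ (f x) (g x)) (inner ℝ (f x) g' + inner ℝ f' (g x)) x v := by
  have h1 : HasDerivAt (fun t : ℝ => f (x + t • v)) f' 0 := hf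
  have h2 : HasDerivAt (fun t : ℝ => g (x + t • v)) g' 0 := hg
  have h3 := h1.inner ℝ h2
  simp only [zero_smul, add_zero] at h3
  exact h3

theorem integrable_inner_real {f g : Plane → ℂ} (hf : MemLp f 2) (hg : MemLp g 2) :
    Integrable fun x => inner ℝ (f x) (g x) :=
  memLp_one_iff_integrable.1 ((innerSL ℝ (E := ℂ)).memLp_of_bilin 1 hf hg)

theorem integral_norm_inner_real_le {f g : Plane → ℂ} (hf : MemLp f 2) (hg : MemLp g 2) :
    ∫ x, ‖(inner ℝ (f x) (g x) : ℝ)‖ ≤ (eLpNorm f 2).toReal * (eLpNorm g 2).toReal := by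
  have h1 : eLpNorm (fun x => (inner ℝ (f x) (g x) : ℝ)) 1 ≤ eLpNorm f 2 * eLpNorm g 2 := by
    have := eLpNorm_le_eLpNorm_mul_eLpNorm_of_nnnorm (p := 2) (q := 2) (r := 1) hf.1 hg.1
      (fun a b => (inner ℝ a b : ℝ)) 1 (Eventually.of_forall fun x => by
        rw [one_mul]; exact_mod_cast norm_inner_le_norm (𝕜 := ℝ) (f x) (g x))
    simpa using this
  rw [integral_norm_eq_lintegral_enorm (integrable_inner_real hf hg).1,
    ← eLpNorm_one_eq_lintegral_enorm,
    ← ENNReal.toReal_mul]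
  exact ENNReal.toReal_mono (ENNReal.mul_ne_top hf.2.ne hg.2.ne) h1

theorem inner_I_mul (z w : ℂ) : inner ℝ z (Complex.I * w) = -inner ℝ (Complex.I * z) w := by
  simp [Complex.inner]; ring

theorem inner_I_mul_self (z : ℂ) : inner ℝ (Complex.I * z) z = 0 := by
  simp [Complex.inner]; ring

/-- The polarised form of `|∇ρ|² ≤ 4 ρ |∇w|²`, which makes the interaction positive. -/
theorem inner_two_point_nonneg (a b c d : ℂ) :
    0 ≤ inner ℝ a a * inner ℝ b b + inner ℝ c c * inner ℝ d d
      - 2 * (inner ℝ (Complex.I * c) a * inner ℝ (Complex.I * b) d)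
      - 2 * (inner ℝ c a * inner ℝ b d) := by
  have h : inner ℝ a a * inner ℝ b b + inner ℝ c c * inner ℝ d d
      - 2 * (inner ℝ (Complex.I * c) a * inner ℝ (Complex.I * b) d)
      - 2 * (inner ℝ c a * inner ℝ b d) = Complex.normSq (a * b - c * d) := by
    simp only [Complex.inner, Complex.normSq_apply, Complex.mul_re, Complex.mul_im, Complex.conj_re,
      Complex.conj_im, Complex.sub_re, Complex.sub_im, Complex.I_re, Complex.I_im, map_mul,
      Complex.conj_I, Complex.neg_re, Complex.neg_im]
    ring
  rw [h]
  exact Complex.normSq_nonneg _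

/-- Positivity of the commutator terms in the interaction Morawetz identity. -/
theorem interaction_virial_nonneg {κ : ℝ → ℝ} {Y : ℝ} (hκ : Continuous κ) (hY : ∀ r, |κ r| ≤ Y)
    (hpos : ∀ r, 0 ≤ κ r) (heven : ∀ r, κ (-r) = κ r) (e : Plane) {w w1 : Plane → ℂ}
    (hw : MemLp w 2) (hw1 : MemLp w1 2) :
    (1 / 2 : ℝ) * interaction κ e (fun x => 2 * inner ℝ (w x) (w1 x))
        (fun x => 2 * inner ℝ (w x) (w1 x)) ≤
      2 * interaction κ e (fun x => inner ℝ (w1 x) (w1 x)) (fun x => inner ℝ (w x) (w x)) -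
      2 * interaction κ e (fun x => inner ℝ (Complex.I * w x) (w1 x))
        (fun x => inner ℝ (Complex.I * w x) (w1 x)) := by
  have hIw : MemLp (fun x => Complex.I * w x) 2 := hw.const_mul _
  have i1 := interaction_integrable (e := e) hκ hY (integrable_inner_real hw1 hw1)
    (integrable_inner_real hw hw)
  have i2 := interaction_integrable (e := e) hκ hY (integrable_inner_real hw hw)
    (integrable_inner_real hw1 hw1)
  have i3 := interaction_integrable (e := e) hκ hY (integrable_inner_real hIw hw1)
    (integrable_inner_real hIw hw1)
  have i4 := interaction_integrable (e := e) hκ hY (integrable_inner_real hw hw1)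
    (integrable_inner_real hw hw1)
  have hs : interaction κ e (fun x => inner ℝ (w1 x) (w1 x)) (fun x => inner ℝ (w x) (w x)) =
    interaction κ e (fun x => inner ℝ (w x) (w x)) (fun x => inner ℝ (w1 x) (w1 x)) :=
    interaction_symm heven
  have h0 : 0 ≤ interaction κ e (fun x => inner ℝ (w1 x) (w1 x)) (fun x => inner ℝ (w x) (w x)) +
      interaction κ e (fun x => inner ℝ (w x) (w x)) (fun x => inner ℝ (w1 x) (w1 x)) -
      2 * interaction κ e (fun x => inner ℝ (Complex.I * w x) (w1 x))
        (fun x => inner ℝ (Complex.I * w x) (w1 x)) -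
      2 * interaction κ e (fun x => inner ℝ (w x) (w1 x)) (fun x => inner ℝ (w x) (w1 x)) := by
    simp only [interaction]
    have i12 : Integrable fun q : Plane × Plane =>
        κ (inner ℝ (q.1 - q.2) e) * (inner ℝ (w1 q.1) (w1 q.1) * inner ℝ (w q.2) (w q.2)) +
        κ (inner ℝ (q.1 - q.2) e) * (inner ℝ (w q.1) (w q.1) * inner ℝ (w1 q.2) (w1 q.2)) :=
      i1.add i2
    have i123 : Integrable fun q : Plane × Plane =>
        κ (inner ℝ (q.1 - q.2) e) * (inner ℝ (w1 q.1) (w1 q.1) * inner ℝ (w q.2) (w q.2)) +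
        κ (inner ℝ (q.1 - q.2) e) * (inner ℝ (w q.1) (w q.1) * inner ℝ (w1 q.2) (w1 q.2)) -
        2 * (κ (inner ℝ (q.1 - q.2) e) *
          (inner ℝ (Complex.I * w q.1) (w1 q.1) * inner ℝ (Complex.I * w q.2) (w1 q.2))) :=
      i12.sub (i3.const_mul 2)
    rw [← integral_const_mul, ← integral_const_mul, ← integral_add i1 i2,
      ← integral_sub i12 (i3.const_mul 2), ← integral_sub i123 (i4.const_mul 2)]
    refine integral_nonneg fun q => ?_
    have := mul_nonneg (hpos (inner ℝ (q.1 - q.2) e))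
      (inner_two_point_nonneg (w1 q.1) (w q.2) (w q.1) (w1 q.2))
    simp only [Pi.zero_apply]
    refine this.trans (le_of_eq ?_)
    ring
  rw [interaction_smul_left, interaction_smul_right]
  linarith

/-- The interaction Morawetz inequality at a fixed time, in the direction `e`. The function `w`
evolves by `w_t = i (w11 + w22) - i (|w|² w + E)`, where `c` is `|w|² w`, the indices `1` and `2`
stand for the derivatives in the directions `e` and `e'`, and `E` is an error term. The left side is
`∫∫ κ ∂ρ ∂ρ` up to the error, and the right side is the time derivative of the functional. -/
theorem interaction_morawetz {χ κ : ℝ → ℝ} {X Y : ℝ} (hd : ∀ r, HasDerivAt χ (κ r) r)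
    (hκ : Continuous κ) (hX : ∀ r, |χ r| ≤ X) (hY : ∀ r, |κ r| ≤ Y) (hpos : ∀ r, 0 ≤ κ r)
    (heven : ∀ r, κ (-r) = κ r) {e e' : Plane} (he : ‖e‖ = 1) (hee' : inner ℝ e' e = 0)
    {w w1 w2 w11 w12 w22 w111 w122 c c1 E E1 : Plane → ℂ}
    (hw : MemLp w 2) (hw1 : MemLp w1 2) (hw2 : MemLp w2 2) (hw11 : MemLp w11 2)
    (hw12 : MemLp w12 2) (hw22 : MemLp w22 2) (hw111 : MemLp w111 2) (hw122 : MemLp w122 2)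
    (hcm : MemLp c 2) (hc1m : MemLp c1 2) (hE : MemLp E 2) (hE1 : MemLp E1 2)
    (d1 : ∀ x, HasLineDerivAt ℝ w (w1 x) x e) (d2 : ∀ x, HasLineDerivAt ℝ w (w2 x) x e')
    (d11 : ∀ x, HasLineDerivAt ℝ w1 (w11 x) x e) (d12 : ∀ x, HasLineDerivAt ℝ w1 (w12 x) x e')
    (d22 : ∀ x, HasLineDerivAt ℝ w2 (w22 x) x e') (d111 : ∀ x, HasLineDerivAt ℝ w11 (w111 x) x e)
    (d122 : ∀ x, HasLineDerivAt ℝ w12 (w122 x) x e') (dE : ∀ x, HasLineDerivAt ℝ E (E1 x) x e)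
    (dc : ∀ x, HasLineDerivAt ℝ c (c1 x) x e) (hc : ∀ x, c x = ((‖w x‖ ^ 2 : ℝ) : ℂ) * w x)
    (hc1 : ∀ x, c1 x = ((2 * inner ℝ (w x) (w1 x) : ℝ) : ℂ) * w x + ((‖w x‖ ^ 2 : ℝ) : ℂ) * w1 x) :
    interaction κ e (fun x => 2 * inner ℝ (w x) (w1 x)) (fun x => 2 * inner ℝ (w x) (w1 x)) -
      6 * X * ((eLpNorm E 2).toReal * (eLpNorm w 2).toReal ^ 2 * (eLpNorm w1 2).toReal) ≤
    interaction χ e (fun x =>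
        inner ℝ (w x) (w111 x + w122 x) - inner ℝ (w11 x + w22 x) (w1 x)
          + inner ℝ (c x + E x) (w1 x) - inner ℝ (w x) (c1 x + E1 x))
        (fun x => inner ℝ (w x) (w x)) +
      interaction χ e (fun x => inner ℝ (Complex.I * w x) (w1 x))
        (fun x => 2 * inner ℝ (w x) (Complex.I * (w11 x + w22 x - (c x + E x)))) := by
  have hχ : Continuous χ := continuous_iff_continuousAt.2 fun r => (hd r).continuousAt
  have hee : inner ℝ e e = (1 : ℝ) := by rw [real_inner_self_eq_norm_sq, he]; norm_num
  have hIw : MemLp (fun x => Complex.I * w x) 2 := hw.const_mul _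
  have hX0 : 0 ≤ X := (abs_nonneg _).trans (hX 0)
  have ii : ∀ {f g : Plane → ℂ}, MemLp f 2 → MemLp g 2 →
    Integrable fun x => (inner ℝ (f x) (g x) : ℝ) := fun hf hg => integrable_inner_real hf hg
  -- the mass density `ρ`, the momentum `(p1, p2)`, the momentum flux `(T1, T2)` in the direction
  -- `e` up to the pressure `q = |w|⁴`, and the contributions `r`, `m`, `z` of the error term
  set ρ : Plane → ℝ := fun x => inner ℝ (w x) (w x) with hρ
  set ρ1 : Plane → ℝ := fun x => 2 * inner ℝ (w x) (w1 x) with hρ1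
  set p1 : Plane → ℝ := fun x => inner ℝ (Complex.I * w x) (w1 x) with hp1
  set p2 : Plane → ℝ := fun x => inner ℝ (Complex.I * w x) (w2 x) with hp2
  set T2 : Plane → ℝ := fun x => inner ℝ (w x) (w12 x) + (-1) * inner ℝ (w2 x) (w1 x) with hT2
  set n1 : Plane → ℝ := fun x => inner ℝ (w1 x) (w1 x) with hn1
  set ρ11 : Plane → ℝ := fun x => 2 * (inner ℝ (w x) (w11 x) + inner ℝ (w1 x) (w1 x)) with hρ11
  set T1 : Plane → ℝ := fun x => inner ℝ (w x) (w11 x) + (-1) * inner ℝ (w1 x) (w1 x) with hT1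
  set T11 : Plane → ℝ := fun x => inner ℝ (w x) (w111 x) - inner ℝ (w11 x) (w1 x) with hT11
  set T22 : Plane → ℝ := fun x => inner ℝ (w x) (w122 x) - inner ℝ (w22 x) (w1 x) with hT22
  set q : Plane → ℝ := fun x => inner ℝ (w x) (c x) with hq
  set q1 : Plane → ℝ := fun x => inner ℝ (w x) (c1 x) + inner ℝ (w1 x) (c x) with hq1
  set r : Plane → ℝ := fun x => inner ℝ (w x) (E x) with hr
  set r1 : Plane → ℝ := fun x => inner ℝ (w x) (E1 x) + inner ℝ (w1 x) (E x) with hr1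
  set m : Plane → ℝ := fun x => inner ℝ (E x) (w1 x) with hm
  set z : Plane → ℝ := fun x => inner ℝ (Complex.I * w x) (E x) with hz
  set s1 : Plane → ℝ := fun x => inner ℝ (Complex.I * w x) (w11 x) with hs1
  set s2 : Plane → ℝ := fun x => inner ℝ (Complex.I * w x) (w22 x) with hs2
  have iρ : Integrable ρ := ii hw hw
  have iρ1 : Integrable ρ1 := (ii hw hw1).const_mul 2
  have ip1 : Integrable p1 := ii hIw hw1
  have ip2 : Integrable p2 := ii hIw hw2
  have in1 : Integrable n1 := ii hw1 hw1
  have iρ11 : Integrable ρ11 := ((ii hw hw11).add (ii hw1 hw1)).const_mul 2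
  have iT1 : Integrable T1 := (ii hw hw11).add ((ii hw1 hw1).const_mul _)
  have iT2 : Integrable T2 := (ii hw hw12).add ((ii hw2 hw1).const_mul _)
  have iT11 : Integrable T11 := (ii hw hw111).sub (ii hw11 hw1)
  have iT22 : Integrable T22 := (ii hw hw122).sub (ii hw22 hw1)
  have iq : Integrable q := ii hw hcm
  have iq1 : Integrable q1 := (ii hw hc1m).add (ii hw1 hcm)
  have ir : Integrable r := ii hw hE
  have ir1 : Integrable r1 := (ii hw hE1).add (ii hw1 hE)
  have im : Integrable m := ii hE hw1
  have iz : Integrable z := ii hIw hE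
  have is1 : Integrable s1 := ii hIw hw11
  have is2 : Integrable s2 := ii hIw hw22
  have dIw1 : ∀ x, HasLineDerivAt ℝ (fun x => Complex.I * w x) (Complex.I * w1 x) x e := fun x =>
    HasDerivAt.const_mul Complex.I (d1 x)
  have dIw2 : ∀ x, HasLineDerivAt ℝ (fun x => Complex.I * w x) (Complex.I * w2 x) x e' := fun x =>
    HasDerivAt.const_mul Complex.I (d2 x)
  -- the derivatives of the densities
  have Dρ : ∀ x, HasLineDerivAt ℝ ρ (ρ1 x) x e := fun x => by
    have h := (d1 x).inner_real (d1 x)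
    rwa [real_inner_comm (w x) (w1 x), ← two_mul] at h
  have Dρ1 : ∀ x, HasLineDerivAt ℝ ρ1 (ρ11 x) x e := fun x =>
    HasDerivAt.const_mul 2 ((d1 x).inner_real (d11 x))
  have DT1 : ∀ x, HasLineDerivAt ℝ T1 (T11 x) x e := fun x => by
    have h := HasDerivAt.add ((d1 x).inner_real (d111 x))
      (HasDerivAt.const_mul (-1) ((d11 x).inner_real (d11 x)))
    refine HasDerivAt.congr_deriv h ?_
    simp only [hT11, real_inner_comm (w11 x) (w1 x)]; ring
  have DT2 : ∀ x, HasLineDerivAt ℝ T2 (T22 x) x e' := fun x => by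
    have h := HasDerivAt.add ((d2 x).inner_real (d122 x))
      (HasDerivAt.const_mul (-1) ((d22 x).inner_real (d12 x)))
    refine HasDerivAt.congr_deriv h ?_
    simp only [hT22]; ring
  have Dp1 : ∀ x, HasLineDerivAt ℝ p1 (s1 x) x e := fun x => by
    have h := (dIw1 x).inner_real (d11 x)
    rwa [inner_I_mul_self, add_zero] at h
  have Dp2 : ∀ x, HasLineDerivAt ℝ p2 (s2 x) x e' := fun x => by
    have h := (dIw2 x).inner_real (d22 x)
    rwa [inner_I_mul_self, add_zero] at h
  have Dq : ∀ x, HasLineDerivAt ℝ q (q1 x) x e := fun x => (d1 x).inner_real (dc x)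
  have Dr : ∀ x, HasLineDerivAt ℝ r (r1 x) x e := fun x => (d1 x).inner_real (dE x)
  have hcE : ∀ (a : ℂ) (x : Plane), inner ℝ a (c x) = ‖w x‖ ^ 2 * inner ℝ a (w x) := fun a x => by
    rw [hc, ← Complex.real_smul, inner_smul_right]
  have hww : ∀ x, inner ℝ (w x) (w x) = ‖w x‖ ^ 2 := fun x => real_inner_self_eq_norm_sq _
  -- the momentum law: the time derivative of `p1` is the divergence `∂₁ T1 + ∂₂ T2`, the pressure
  -- term and the errors
  have hA : (fun x => inner ℝ (w x) (w111 x + w122 x) - inner ℝ (w11 x + w22 x) (w1 x)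
      + inner ℝ (c x + E x) (w1 x) - inner ℝ (w x) (c1 x + E1 x)) =
      fun x => T11 x + (T22 x + ((-1 / 2) * q1 x + (2 * m x + (-1) * r1 x))) := by
    ext x
    simp only [hT11, hT22, hq1, hm, hr1, inner_add_left, inner_add_right]
    rw [real_inner_comm (w1 x) (c x), real_inner_comm (E x) (w1 x), hcE, hc1, inner_add_right,
      ← Complex.real_smul, ← Complex.real_smul, inner_smul_right, inner_smul_right, hww,
      real_inner_comm (w x) (w1 x)]
    ring
  -- the mass law: the time derivative of `ρ` is `-2 (∂₁ p1 + ∂₂ p2) + 2 z`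
  have hB : (fun x => 2 * inner ℝ (w x) (Complex.I * (w11 x + w22 x - (c x + E x)))) =
      fun x => (-2) * s1 x + ((-2) * s2 x + 2 * z x) := by
    ext x
    simp only [hs1, hs2, hz, inner_I_mul, inner_sub_right, inner_add_right]
    rw [hcE, inner_I_mul_self]
    ring
  have hT1' : T1 = fun x => (1 / 2) * ρ11 x + (-2) * n1 x := by
    ext x
    simp only [hT1, hρ11, hn1]; ring
  have j1 : interaction χ e
        (fun x => T11 x + (T22 x + ((-1 / 2) * q1 x + (2 * m x + (-1) * r1 x)))) ρ =
      interaction χ e T11 ρ + (interaction χ e T22 ρ + ((-1 / 2) * interaction χ e q1 ρ +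
        (2 * interaction χ e m ρ + (-1) * interaction χ e r1 ρ))) := by
    have a1 : Integrable fun x => 2 * m x + (-1) * r1 x := (im.const_mul _).add (ir1.const_mul _)
    have a2 : Integrable fun x => (-1 / 2) * q1 x + (2 * m x + (-1) * r1 x) :=
      (iq1.const_mul _).add a1
    have a3 : Integrable fun x => T22 x + ((-1 / 2) * q1 x + (2 * m x + (-1) * r1 x)) := iT22.add a2
    rw [interaction_add_left hχ hX iT11 a3 iρ, interaction_add_left hχ hX iT22 a2 iρ,
      interaction_add_left hχ hX (iq1.const_mul _) a1 iρ,
      interaction_add_left hχ hX (im.const_mul _) (ir1.const_mul _) iρ,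
      interaction_smul_left (a := q1), interaction_smul_left (a := m),
      interaction_smul_left (a := r1)]
  have j2 : interaction χ e p1 (fun x => (-2) * s1 x + ((-2) * s2 x + 2 * z x)) =
      (-2) * interaction χ e p1 s1 + ((-2) * interaction χ e p1 s2 + 2 * interaction χ e p1 z) := by
    have a1 : Integrable fun x => (-2) * s2 x + 2 * z x := (is2.const_mul _).add (iz.const_mul _)
    rw [interaction_add_right hχ hX (is1.const_mul _) a1 ip1,
      interaction_add_right hχ hX (is2.const_mul _) (iz.const_mul _) ip1,
      interaction_smul_right (a := s1), interaction_smul_right (a := s2),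
      interaction_smul_right (a := z)]
  have j3 : interaction κ e T1 ρ = (1 / 2) * interaction κ e ρ11 ρ +
      (-2) * interaction κ e n1 ρ := by
    rw [hT1', interaction_add_left hκ hY (iρ11.const_mul _) (in1.const_mul _) iρ,
      interaction_smul_left (a := ρ11), interaction_smul_left (a := n1)]
  have k1 := interaction_deriv_left hκ hd hX hY (e := e) iT1 iT11 iρ DT1
  have k2 := interaction_deriv_left hκ hd hX hY (e := e) iT2 iT22 iρ DT2
  have k3 := interaction_deriv_left hκ hd hX hY (e := e) iq iq1 iρ Dq
  have k4 := interaction_deriv_left hκ hd hX hY (e := e) ir ir1 iρ Dr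
  have k5 := interaction_deriv_right hκ hd hX hY (e := e) iρ iρ1 ir Dρ
  have k6 := interaction_deriv_right hκ hd hX hY (e := e) ip1 is1 ip1 Dp1
  have k7 := interaction_deriv_right hκ hd hX hY (e := e) ip2 is2 ip1 Dp2
  have k8 := interaction_deriv_right hκ hd hX hY (e := e) iρ iρ1 iρ11 Dρ
  have k9 := interaction_deriv_left hκ hd hX hY (e := e) iρ1 iρ11 iρ1 Dρ1
  have hvir := interaction_virial_nonneg hκ hY hpos heven e hw hw1
  -- the pressure term has a sign because the nonlinearity is defocusing
  have hqpos : 0 ≤ interaction κ e q ρ := by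
    refine integral_nonneg fun y => mul_nonneg (hpos _) (mul_nonneg ?_ ?_)
    · simp only [hq]; rw [hcE, hww]; positivity
    · simp only [hρ]; rw [hww]; positivity
  have hnI : eLpNorm (fun x => Complex.I * w x) 2 = eLpNorm w 2 :=
    eLpNorm_congr_norm_ae (Eventually.of_forall fun x => by simp)
  -- the three error terms enter with the weights `2 · 1`, `1 · 2` and `2 · 1`, hence the factor `6`
  have b1 : |interaction χ e m ρ| ≤ X * (((eLpNorm E 2).toReal * (eLpNorm w1 2).toReal) *
      ((eLpNorm w 2).toReal * (eLpNorm w 2).toReal)) :=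
    (abs_interaction_le hχ hX im iρ).trans (by
      have := integral_norm_inner_real_le hE hw1
      have := integral_norm_inner_real_le hw hw
      gcongr)
  have b2 : |interaction χ e r ρ1| ≤ X * (((eLpNorm w 2).toReal * (eLpNorm E 2).toReal) *
      (2 * ((eLpNorm w 2).toReal * (eLpNorm w1 2).toReal))) :=
    (abs_interaction_le hχ hX ir iρ1).trans (by
      have := integral_norm_inner_real_le hw hE
      have := integral_norm_inner_real_le hw hw1
      have e1 : ∫ x, ‖ρ1 x‖ = 2 * ∫ x, ‖(inner ℝ (w x) (w1 x) : ℝ)‖ := by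
        rw [← integral_const_mul]; simp [hρ1]
      rw [e1]
      gcongr)
  have b3 : |interaction χ e p1 z| ≤ X * (((eLpNorm w 2).toReal * (eLpNorm w1 2).toReal) *
      ((eLpNorm w 2).toReal * (eLpNorm E 2).toReal)) :=
    (abs_interaction_le hχ hX ip1 iz).trans (by
      have h1 := integral_norm_inner_real_le hIw hw1
      have h2 := integral_norm_inner_real_le hIw hE
      rw [hnI] at h1 h2
      gcongr)
  rw [hA, hB, j1, j2]
  rw [hee, one_mul] at k1 k3 k4 k5 k6 k8 k9
  -- the kernel is constant in the direction perpendicular to `e`, so that those fluxes drop out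
  rw [hee', zero_mul] at k2 k7
  rw [abs_le] at b1 b2 b3
  rw [k1, k2, k3, k4, k6, k7, j3]
  have b1' := b1.1
  have b2' := b2.1
  have b3' := b3.1
  rw [k5] at b2'
  have k10 : interaction κ e ρ11 ρ = -interaction κ e ρ1 ρ1 := by rw [← k8, k9]
  rw [k10]
  nlinarith [hvir, hqpos, b1', b2', b3']

/-! ### Interactions on the Fourier side -/

/-- The Gaussian `∫ exp (-π b σ²) exp (2 π i r σ) dσ`. -/
noncomputable def gaussKernel (b r : ℝ) : ℝ := (√b)⁻¹ * Real.exp (-(Real.pi / b) * r ^ 2)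

/-- The odd primitive of `gaussKernel b`. -/
noncomputable def gaussPrimitive (b r : ℝ) : ℝ := ∫ x in (0 : ℝ)..r, gaussKernel b x

theorem gaussKernel_continuous (b : ℝ) : Continuous (gaussKernel b) := by
  unfold gaussKernel; fun_prop

theorem gaussKernel_nonneg (b r : ℝ) : 0 ≤ gaussKernel b r := by
  unfold gaussKernel; positivity

theorem gaussKernel_neg (b r : ℝ) : gaussKernel b (-r) = gaussKernel b r := by
  simp [gaussKernel]

theorem abs_gaussKernel_le {b : ℝ} (hb : 0 < b) (r : ℝ) : |gaussKernel b r| ≤ (√b)⁻¹ := by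
  rw [abs_of_nonneg (gaussKernel_nonneg b r), gaussKernel]
  refine mul_le_of_le_one_right (by positivity) (Real.exp_le_one_iff.2 ?_)
  have := Real.pi_pos
  rw [neg_mul]
  exact neg_nonpos.2 (by positivity)

theorem hasDerivAt_gaussPrimitive (b r : ℝ) :
    HasDerivAt (gaussPrimitive b) (gaussKernel b r) r :=
  (gaussKernel_continuous b).integral_hasStrictDerivAt 0 r |>.hasDerivAt

theorem abs_gaussPrimitive_le {b : ℝ} (hb : 0 < b) (r : ℝ) : |gaussPrimitive b r| ≤ 1 := by
  have hp := Real.pi_pos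
  have hint : Integrable (gaussKernel b) :=
    (integrable_exp_neg_mul_sq (b := Real.pi / b) (by positivity)).const_mul _
  have htot : ∫ x, gaussKernel b x = 1 := by
    simp only [gaussKernel]
    rw [integral_const_mul, integral_gaussian, div_div_cancel₀ hp.ne']
    exact inv_mul_cancel₀ (Real.sqrt_pos.2 hb).ne'
  rw [gaussPrimitive, ← Real.norm_eq_abs, ← htot]
  refine (intervalIntegral.norm_integral_le_integral_norm_uIoc).trans ?_
  simp_rw [Real.norm_of_nonneg (gaussKernel_nonneg b _)]
  exact setIntegral_le_integral hint (Eventually.of_forall fun x => gaussKernel_nonneg b x)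

theorem gaussKernel_eq_integral {b : ℝ} (hb : 0 < b) (r : ℝ) :
    (gaussKernel b r : ℂ) =
      ∫ σ : ℝ, (Real.fourierChar (-(σ * r)) : ℂ) * (Real.exp (-(Real.pi * b) * σ ^ 2) : ℂ) := by
  have h := congrFun (fourier_gaussian_pi (b := (b : ℂ)) (by simpa using hb)) r
  rw [Real.fourier_eq] at h
  have e1 : (gaussKernel b r : ℂ) = 1 / (b : ℂ) ^ (1 / 2 : ℂ) *
      Complex.exp (-Real.pi / b * (r : ℂ) ^ 2) := by
    rw [gaussKernel, Real.sqrt_eq_rpow]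
    push_cast
    rw [Complex.ofReal_cpow hb.le]
    push_cast
    simp only [one_div, neg_div]
  rw [e1, ← h]
  congr 1
  ext σ
  rw [Circle.smul_def, smul_eq_mul]
  push_cast
  congr 3
  · simp [mul_comm]
  · ring

/-- The Fourier transform turns a directional derivative into a multiplication. -/
theorem fourier_hasLineDerivAt {a a' : Plane → ℂ} {v : Plane} (ha : Integrable a)
    (ha' : Integrable a') (hd : ∀ x, HasLineDerivAt ℝ a (a' x) x v) (ξ : Plane) :
    𝓕 a' ξ = (2 * Real.pi * Complex.I * (inner ℝ v ξ : ℝ)) * 𝓕 a ξ := by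
  have hchar : ∀ x : Plane, HasLineDerivAt ℝ
      (fun x : Plane => (Real.fourierChar (-inner ℝ x ξ) : ℂ))
      (-(2 * Real.pi * Complex.I * (inner ℝ v ξ : ℝ)) *
        (Real.fourierChar (-inner ℝ x ξ) : ℂ)) x v := by
    intro x
    have h1 : HasDerivAt
        (fun t : ℝ => Complex.exp (2 * Real.pi * (-(inner ℝ x ξ + t * inner ℝ v ξ) : ℝ)
          * Complex.I))
        (Complex.exp (2 * Real.pi * (-(inner ℝ x ξ + (0 : ℝ) * inner ℝ v ξ) : ℝ) * Complex.I) *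
          (2 * Real.pi * (-(inner ℝ v ξ) : ℝ) * Complex.I)) 0 := by
      have h2 : HasDerivAt (fun t : ℝ => -(inner ℝ x ξ + t * inner ℝ v ξ)) (-(inner ℝ v ξ)) 0 := by
        exact (((hasDerivAt_id (0 : ℝ)).mul_const (inner ℝ v ξ)).const_add
          (inner ℝ x ξ)).fun_neg.congr_deriv (by simp)
      exact ((h2.ofReal_comp.const_mul (2 * Real.pi : ℂ)).mul_const Complex.I).cexp
    refine (h1.congr_of_eventuallyEq (Eventually.of_forall fun t => ?_)).congr_deriv ?_
    · simp only [Real.fourierChar_apply, inner_add_left, inner_smul_left]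
      push_cast
      simp
    · simp only [Real.fourierChar_apply]
      push_cast
      rw [zero_mul, add_zero]
      ring
  have hb : ∀ {f : Plane → ℂ}, Integrable f →
      Integrable fun x => (Real.fourierChar (-inner ℝ x ξ) : ℂ) * f x := fun hf =>
    hf.bdd_mul (c := 1) (Continuous.aestronglyMeasurable (continuous_subtype_val.comp
      (Real.continuous_fourierChar.comp (by fun_prop))))
      (Eventually.of_forall fun x => (Circle.norm_coe _).le)
  have key := integral_bilinear_hasLineDerivAt_right_eq_neg_left_of_integrable
    (μ := (volume : Measure Plane)) (B := ContinuousLinearMap.mul ℝ ℂ) (v := v)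
    (f := fun x => (Real.fourierChar (-inner ℝ x ξ) : ℂ))
    (f' := fun x => -(2 * Real.pi * Complex.I * (inner ℝ v ξ : ℝ)) *
      (Real.fourierChar (-inner ℝ x ξ) : ℂ)) (g := a) (g' := a') ?_ (hb ha') (hb ha)
    (fun x _ => hchar x) (fun x _ => hd x)
  · rw [Real.fourier_eq, Real.fourier_eq]
    simp only [ContinuousLinearMap.mul_apply', mul_assoc, neg_mul] at key
    simp only [Circle.smul_def, smul_eq_mul]
    rw [key, integral_neg, neg_neg, ← integral_const_mul]
    simp only [mul_assoc]
  · simp only [ContinuousLinearMap.mul_apply', mul_assoc]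
    exact (hb ha).const_mul _

/-- The interaction through a Gaussian kernel is an integral of `|ĝ|²` along a line. -/
theorem interaction_gaussKernel {b : ℝ} (hb : 0 < b) (e : Plane) {g : Plane → ℝ}
    (hg : Integrable g) :
    interaction (gaussKernel b) e g g =
      ∫ σ : ℝ, Real.exp (-(Real.pi * b) * σ ^ 2) * ‖𝓕 (fun x => (g x : ℂ)) (σ • e)‖ ^ 2 := by
  have hp := Real.pi_pos
  have hG : Integrable fun σ : ℝ => (Real.exp (-(Real.pi * b) * σ ^ 2) : ℂ) :=
    (integrable_exp_neg_mul_sq (b := Real.pi * b) (by positivity)).ofReal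
  have hgc : Integrable fun x => (g x : ℂ) := hg.ofReal
  apply Complex.ofReal_injective
  rw [interaction, ← integral_complex_ofReal, ← integral_complex_ofReal]
  simp only [Complex.ofReal_mul, gaussKernel_eq_integral hb, ← integral_mul_const]
  rw [integral_integral_swap]
  · refine integral_congr_ae (Eventually.of_forall fun σ => ?_)
    simp only
    have e1 : 𝓕 (fun x => (g x : ℂ)) (σ • e) =
        ∫ x, (Real.fourierChar (-(σ * inner ℝ x e)) : ℂ) * (g x : ℂ) := by
      rw [Real.fourier_eq]
      simp only [Circle.smul_def, smul_eq_mul, inner_smul_right]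
    have e2 : conj (𝓕 (fun x => (g x : ℂ)) (σ • e)) =
        ∫ x, (Real.fourierChar (σ * inner ℝ x e) : ℂ) * (g x : ℂ) := by
      rw [e1, ← integral_conj]
      congr 1; ext x
      rw [map_mul, Complex.conj_ofReal, ← Circle.coe_inv_eq_conj, ← AddChar.map_neg_eq_inv, neg_neg]
    rw [← Complex.normSq_eq_norm_sq, ← Complex.mul_conj, e2, e1, ← integral_prod_mul,
      ← integral_const_mul]
    congr 1
    ext q
    have e3 : Real.fourierChar (-(σ * inner ℝ (q.1 - q.2) e)) =
        Real.fourierChar (-(σ * inner ℝ q.1 e)) * Real.fourierChar (σ * inner ℝ q.2 e) := by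
      rw [← AddChar.map_add_eq_mul, inner_sub_left]; congr 1; ring
    rw [e3, Circle.coe_mul]
    ring
  · have h1 : Integrable (fun z : (Plane × Plane) × ℝ => ((g z.1.1 : ℂ) * (g z.1.2 : ℂ)) *
        (Real.exp (-(Real.pi * b) * z.2 ^ 2) : ℂ)) (volume.prod volume) :=
      (hgc.mul_prod hgc).mul_prod hG
    have h2 : Continuous fun z : (Plane × Plane) × ℝ =>
        (Real.fourierChar (-(z.2 * inner ℝ (z.1.1 - z.1.2) e)) : ℂ) :=
      continuous_subtype_val.comp (Real.continuous_fourierChar.comp (by fun_prop))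
    refine (h1.bdd_mul (c := 1) h2.aestronglyMeasurable
      (Eventually.of_forall fun x => (Circle.norm_coe _).le)).congr
      (Eventually.of_forall fun z => ?_)
    simp only [Function.uncurry]
    ring

theorem norm_fourier_le (g : Plane → ℂ) (ξ : Plane) : ‖𝓕 g ξ‖ ≤ ∫ x, ‖g x‖ :=
  VectorFourier.norm_fourierIntegral_le_integral_norm _ _ _ _ _

theorem ofReal_interaction_gaussKernel {b : ℝ} (hb : 0 < b) {e : Plane} (he : ‖e‖ = 1)
    {ρ ρ1 : Plane → ℝ}
    (hρ : Integrable ρ) (hρ1 : Integrable ρ1) (hd : ∀ x, HasLineDerivAt ℝ ρ (ρ1 x) x e) :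
    ENNReal.ofReal (interaction (gaussKernel b) e ρ1 ρ1) =
      ∫⁻ σ : ℝ, ENNReal.ofReal (Real.exp (-(Real.pi * b) * σ ^ 2) * (2 * Real.pi * σ) ^ 2) *
        ‖𝓕 (fun x => (ρ x : ℂ)) (σ • e)‖ₑ ^ 2 := by
  have hp := Real.pi_pos
  have hF : ∀ σ : ℝ, ‖𝓕 (fun x => (ρ1 x : ℂ)) (σ • e)‖ ^ 2 =
      (2 * Real.pi * σ) ^ 2 * ‖𝓕 (fun x => (ρ x : ℂ)) (σ • e)‖ ^ 2 := by
    intro σ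
    rw [fourier_hasLineDerivAt (a := fun x => (ρ x : ℂ)) (a' := fun x => (ρ1 x : ℂ))
      hρ.ofReal hρ1.ofReal
      (fun x => HasDerivAt.ofReal_comp (hd x)),
      norm_mul, mul_pow, inner_smul_right, real_inner_self_eq_norm_sq, he]
    congr 1
    simp [mul_pow]
  have hc : Continuous fun σ : ℝ => 𝓕 (fun x => (ρ1 x : ℂ)) (σ • e) :=
    (VectorFourier.fourierIntegral_continuous Real.continuous_fourierChar continuous_inner
      hρ1.ofReal).comp (by fun_prop : Continuous fun σ : ℝ => σ • e)
  rw [interaction_gaussKernel hb e hρ1, ofReal_integral_eq_lintegral_ofReal]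
  · congr 1
    ext σ
    rw [hF, ← mul_assoc, ENNReal.ofReal_mul (by positivity), ENNReal.ofReal_pow (norm_nonneg _),
      ofReal_norm]
  · refine Integrable.mul_bdd (c := (∫ x, ‖(ρ1 x : ℂ)‖) ^ 2)
      (integrable_exp_neg_mul_sq (b := Real.pi * b) (by positivity))
      (hc.norm.pow 2).aestronglyMeasurable (Eventually.of_forall fun σ => ?_)
    rw [norm_pow, norm_norm]
    gcongr
    exact norm_fourier_le _ _
  · exact Eventually.of_forall fun σ => by positivity

/-- Integration in polar coordinates. -/
theorem lintegral_polar {Φ : Plane → ℝ≥0∞} (hΦ : Measurable Φ) :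
    ∫⁻ x, Φ x = ∫⁻ e, (∫⁻ σ in Ioi (0 : ℝ), ENNReal.ofReal σ * Φ (σ • (e : Plane)))
      ∂(volume : Measure Plane).toSphere := by
  have h0 : ∫⁻ x, Φ x = ∫⁻ x : ({0}ᶜ : Set Plane), Φ x ∂((volume : Measure Plane).comap (↑)) := by
    rw [lintegral_subtype_comap (measurableSet_singleton _).compl, restrict_compl_singleton]
  have h1 := (Measure.measurePreserving_homeomorphUnitSphereProd (volume : Measure Plane))
  have h2 : Measurable fun q : Metric.sphere (0 : Plane) 1 × Ioi (0 : ℝ) =>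
      Φ ((q.2 : ℝ) • (q.1 : Plane)) := hΦ.comp (by fun_prop)
  have h3 := h1.lintegral_comp h2
  rw [h0]
  have h4 : ∀ x : ({0}ᶜ : Set Plane), Φ (((homeomorphUnitSphereProd Plane x).2 : ℝ) •
      ((homeomorphUnitSphereProd Plane x).1 : Plane)) = Φ x := by
    intro x
    congr 1
    have hx : ‖(x : Plane)‖ ≠ 0 := norm_ne_zero_iff.2 x.2
    simp only [homeomorphUnitSphereProd_apply_snd_coe, homeomorphUnitSphereProd_apply_fst_coe]
    exact smul_inv_smul₀ hx _
  simp_rw [h4] at h3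
  rw [h3, lintegral_prod _ h2.aemeasurable]
  refine lintegral_congr fun e => ?_
  have h5 : Measurable fun y : Ioi (0 : ℝ) => Φ ((y : ℝ) • (e : Plane)) := hΦ.comp (by fun_prop)
  change ∫⁻ y : Ioi (0 : ℝ), Φ ((y : ℝ) • (e : Plane)) ∂_ = _
  rw [Measure.volumeIoiPow, lintegral_withDensity_eq_lintegral_mul _ (by fun_prop)
    h5]
  rw [← lintegral_subtype_comap measurableSet_Ioi]
  refine lintegral_congr fun σ => ?_
  simp

/-- The regularised form of `lintegral_norm_mul_le_of_lines`. The half-line of negative `σ` and the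
factor `(2 π)²` are wasted. -/
theorem lintegral_gaussian_norm_mul_le {μ : Measure ℝ} [SFinite μ] {Φ : ℝ → Plane → ℝ≥0∞}
    (hΦ : Measurable (Function.uncurry Φ)) {A : ℝ≥0∞} {b : ℝ}
    (hA : ∀ e : Plane, ‖e‖ = 1 → ∫⁻ t, (∫⁻ σ : ℝ, ENNReal.ofReal
      (Real.exp (-(Real.pi * b) * σ ^ 2) * (2 * Real.pi * σ) ^ 2) * Φ t (σ • e)) ∂μ ≤ A) :
    ∫⁻ t, (∫⁻ ξ, ENNReal.ofReal (Real.exp (-(Real.pi * b) * ‖ξ‖ ^ 2) * ‖ξ‖) * Φ t ξ) ∂μ ≤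
      A * (volume : Measure Plane).toSphere univ := by
  have hm : Measurable fun q : (ℝ × Metric.sphere (0 : Plane) 1) × ℝ => ENNReal.ofReal
      (Real.exp (-(Real.pi * b) * q.2 ^ 2) * (2 * Real.pi * q.2) ^ 2) *
        Φ q.1.1 (q.2 • (q.1.2 : Plane)) := by
    have h1 : Measurable fun q : (ℝ × Metric.sphere (0 : Plane) 1) × ℝ =>
        (q.1.1, q.2 • (q.1.2 : Plane)) := by fun_prop
    exact Measurable.mul (by fun_prop) (hΦ.comp h1)
  have hm' : Measurable fun q : ℝ × Metric.sphere (0 : Plane) 1 => ∫⁻ σ : ℝ, ENNReal.ofReal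
      (Real.exp (-(Real.pi * b) * σ ^ 2) * (2 * Real.pi * σ) ^ 2) *
        Φ q.1 (σ • (q.2 : Plane)) := hm.lintegral_prod_right'
  have hpolar : ∀ t, (∫⁻ ξ, ENNReal.ofReal (Real.exp (-(Real.pi * b) * ‖ξ‖ ^ 2) * ‖ξ‖) * Φ t ξ) ≤
      ∫⁻ e, (∫⁻ σ : ℝ, ENNReal.ofReal (Real.exp (-(Real.pi * b) * σ ^ 2) *
            (2 * Real.pi * σ) ^ 2) * Φ t (σ • (e : Plane))) ∂(volume : Measure Plane).toSphere := by
    intro t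
    have h1 : Measurable fun ξ : Plane =>
        ENNReal.ofReal (Real.exp (-(Real.pi * b) * ‖ξ‖ ^ 2) * ‖ξ‖) * Φ t ξ :=
      Measurable.mul (by fun_prop) (hΦ.comp measurable_prodMk_left)
    rw [lintegral_polar h1]
    refine lintegral_mono fun e => ?_
    refine le_trans (setLIntegral_mono' measurableSet_Ioi fun σ hσ => ?_)
      (setLIntegral_le_lintegral (Ioi 0) _)
    have he : ‖(e : Plane)‖ = 1 := by simp
    have hσ0 : (0 : ℝ) < σ := hσ
    rw [← mul_assoc, ← ENNReal.ofReal_mul hσ0.le, norm_smul, he, mul_one,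
      Real.norm_of_nonneg hσ0.le]
    refine mul_le_mul_left (ENNReal.ofReal_le_ofReal ?_) _
    calc σ * (Real.exp (-(Real.pi * b) * σ ^ 2) * σ) =
        Real.exp (-(Real.pi * b) * σ ^ 2) * (1 * σ) ^ 2 := by ring
      _ ≤ _ := by
        have : 1 ≤ 2 * Real.pi := by linarith [Real.pi_gt_three]
        gcongr
  refine (lintegral_mono hpolar).trans ?_
  rw [lintegral_lintegral_swap hm'.aemeasurable]
  refine (lintegral_mono fun e : Metric.sphere (0 : Plane) 1 =>
    hA e (mem_sphere_zero_iff_norm.1 e.2)).trans ?_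
  simp

/-- A bound for integrals along all lines through the origin gives a bound on the plane: in polar
coordinates, the Jacobian takes one of the two powers of the radius. -/
theorem lintegral_norm_mul_le_of_lines {μ : Measure ℝ} [SFinite μ] {Φ : ℝ → Plane → ℝ≥0∞}
    (hΦ : Measurable (Function.uncurry Φ)) {A : ℝ≥0∞}
    (hA : ∀ b > 0, ∀ e : Plane, ‖e‖ = 1 → ∫⁻ t, (∫⁻ σ : ℝ, ENNReal.ofReal
      (Real.exp (-(Real.pi * b) * σ ^ 2) * (2 * Real.pi * σ) ^ 2) * Φ t (σ • e)) ∂μ ≤ A) :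
    ∫⁻ t, (∫⁻ ξ, ‖ξ‖ₑ * Φ t ξ) ∂μ ≤ A * (volume : Measure Plane).toSphere univ := by
  -- `b → 0` with Fatou's lemma
  obtain ⟨b, hb0, hblim⟩ : ∃ b : ℕ → ℝ, (∀ n, 0 < b n) ∧ Tendsto b atTop (𝓝 0) :=
    ⟨fun n => 1 / ((n : ℝ) + 1), fun n => Nat.one_div_pos_of_nat,
      tendsto_one_div_add_atTop_nhds_zero_nat⟩
  obtain ⟨G, hG⟩ : ∃ G : ℕ → ℝ → Plane → ℝ≥0∞, ∀ n t ξ, G n t ξ =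
    ENNReal.ofReal (Real.exp (-(Real.pi * b n) * ‖ξ‖ ^ 2) * ‖ξ‖) * Φ t ξ := ⟨_, fun _ _ _ => rfl⟩
  have hGm : ∀ n, Measurable (Function.uncurry (G n)) := by
    intro n
    have h1 : Measurable fun q : ℝ × Plane =>
        ENNReal.ofReal (Real.exp (-(Real.pi * b n) * ‖q.2‖ ^ 2) * ‖q.2‖) := by fun_prop
    have h2 : Function.uncurry (G n) = fun q : ℝ × Plane => ENNReal.ofReal
        (Real.exp (-(Real.pi * b n) * ‖q.2‖ ^ 2) * ‖q.2‖) * Function.uncurry Φ q :=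
      funext fun q => hG n q.1 q.2
    rw [h2]
    exact h1.mul hΦ
  have hGt : ∀ n t, Measurable (G n t) := fun n t => (hGm n).comp measurable_prodMk_left
  have key : ∀ n, ∫⁻ t, (∫⁻ ξ, G n t ξ) ∂μ ≤ A * (volume : Measure Plane).toSphere univ := by
    intro n
    simp_rw [hG]
    exact lintegral_gaussian_norm_mul_le hΦ (hA (b n) (hb0 n))
  have hlim : ∀ t ξ, ‖ξ‖ₑ * Φ t ξ ≤ liminf (fun n => G n t ξ) atTop := by
    intro t ξ
    have h1 : Tendsto (fun n => Real.exp (-(Real.pi * b n) * ‖ξ‖ ^ 2) * ‖ξ‖) atTop (𝓝 ‖ξ‖) := by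
      have h2 : Tendsto (fun n => -(Real.pi * b n) * ‖ξ‖ ^ 2) atTop (𝓝 0) := by
        simpa using ((hblim.const_mul Real.pi).neg).mul_const (‖ξ‖ ^ 2)
      simpa using ((Real.continuous_exp.tendsto 0).comp h2).mul_const ‖ξ‖
    have h3 : Tendsto (fun n => ENNReal.ofReal (Real.exp (-(Real.pi * b n) * ‖ξ‖ ^ 2) * ‖ξ‖)) atTop
        (𝓝 ‖ξ‖ₑ) := by
      rw [← ofReal_norm]
      exact ENNReal.tendsto_ofReal h1
    by_cases hξ : ξ = 0
    · simp [hξ]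
    · have h4 := ENNReal.Tendsto.mul_const (b := Φ t ξ) h3 (Or.inl (by simpa using hξ))
      simp_rw [hG]
      exact h4.liminf_eq.ge
  calc ∫⁻ t, (∫⁻ ξ, ‖ξ‖ₑ * Φ t ξ) ∂μ
      ≤ ∫⁻ t, (∫⁻ ξ, liminf (fun n => G n t ξ) atTop) ∂μ :=
        lintegral_mono fun t => lintegral_mono fun ξ => hlim t ξ
    _ ≤ ∫⁻ t, liminf (fun n => ∫⁻ ξ, G n t ξ) atTop ∂μ :=
        lintegral_mono fun t => lintegral_liminf_le (hGt · t)
    _ ≤ liminf (fun n => ∫⁻ t, (∫⁻ ξ, G n t ξ) ∂μ) atTop :=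
        lintegral_liminf_le fun n => (hGm n).lintegral_prod_right'
    _ ≤ _ := liminf_le_of_le (by isBoundedDefault) fun c hc => by
        obtain ⟨n, hn⟩ := hc.exists
        exact hn.trans (key n)

/-- The `L²` Fourier transform of an integrable function is given by the Fourier integral. -/
theorem fourier_toLp_ae_eq {f : Plane → ℂ} (h1 : Integrable f) (h2 : MemLp f 2) :
    (𝓕 (h2.toLp f) : L2Plane) =ᵐ[volume] 𝓕 f := by
  have hc : Continuous (𝓕 f) :=
    VectorFourier.fourierIntegral_continuous Real.continuous_fourierChar continuous_inner h1
  refine ae_eq_of_integral_contDiff_smul_eq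
    ((Lp.memLp _).locallyIntegrable (by norm_num)) hc.locallyIntegrable fun g hg hgs => ?_
  have hgt : IsTestSymbol fun x => (g x : ℂ) :=
    ⟨Complex.ofRealCLM.contDiff.comp hg, hgs.comp_left Complex.ofReal_zero⟩
  have e1 := congrArg (fun F => F hgt.toSchwartz)
    (Lp.fourier_toTemperedDistribution_eq (h2.toLp f))
  simp only [TemperedDistribution.fourier_apply, Lp.toTemperedDistribution_apply] at e1
  have e2 : ∫ x, g x • (𝓕 (h2.toLp f) : L2Plane) x =
      ∫ x, hgt.toSchwartz x • (𝓕 (h2.toLp f) : L2Plane) x := by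
    congr 1
  have e3 : ∫ x, (𝓕 hgt.toSchwartz : 𝓢(Plane, ℂ)) x • (h2.toLp f : L2Plane) x =
      ∫ x, 𝓕 (fun x => (g x : ℂ)) x • f x := by
    refine integral_congr_ae ?_
    filter_upwards [h2.coeFn_toLp] with x hx
    rw [hx, SchwartzMap.fourier_coe]; rfl
  rw [e2, ← e1, e3]
  have e4 := VectorFourier.integral_fourierIntegral_smul_eq_flip (L := innerₗ Plane)
    (μ := (volume : Measure Plane)) (ν := (volume : Measure Plane)) Real.continuous_fourierChar
    continuous_inner hgt.integrable h1
  rw [flip_innerₗ] at e4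
  exact e4

theorem lintegral_enorm_sq_eq_fourier {f : Plane → ℂ} (h1 : Integrable f) (h2 : MemLp f 2) :
    ∫⁻ x, ‖f x‖ₑ ^ 2 = ∫⁻ ξ, ‖𝓕 f ξ‖ₑ ^ 2 := by
  have e1 : eLpNorm f 2 = eLpNorm (𝓕 f) 2 := by
    rw [← eLpNorm_congr_ae (fourier_toLp_ae_eq h1 h2), ← eLpNorm_congr_ae h2.coeFn_toLp,
      ← Lp.enorm_def, ← Lp.enorm_def, ← ofReal_norm, ← ofReal_norm, Lp.norm_fourier_eq]
  have e2 : ∀ g : Plane → ℂ, eLpNorm g 2 ^ 2 = ∫⁻ x, ‖g x‖ₑ ^ 2 := by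
    intro g
    have := eLpNorm_nnreal_pow_eq_lintegral (f := g) (p := 2) (μ := volume) (by norm_num)
    simpa using this
  rw [← e2, ← e2, e1]

/-- Interpolation between the `Ḣ^(1/2)` and `L¹` norms, with a free parameter `M`. -/
theorem lintegral_enorm_sq_le_interpolation {f : Plane → ℂ} (h1 : Integrable f) (h2 : MemLp f 2)
    {M : ℝ} (hM : 0 < M) :
    ∫⁻ x, ‖f x‖ₑ ^ 2 ≤ ENNReal.ofReal M * (∫⁻ ξ, ‖ξ‖ₑ * ‖𝓕 f ξ‖ₑ ^ 2) +
      ENNReal.ofReal (M⁻¹ ^ 2) * volume (Metric.ball (0 : Plane) 1) * (∫⁻ x, ‖f x‖ₑ) ^ 2 := by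
  have hc : Continuous (𝓕 f) :=
    VectorFourier.fourierIntegral_continuous Real.continuous_fourierChar continuous_inner h1
  have hb : ∀ ξ, ‖𝓕 f ξ‖ₑ ≤ ∫⁻ x, ‖f x‖ₑ := by
    intro ξ
    rw [← ofReal_norm, ← ofReal_integral_norm_eq_lintegral_enorm h1]
    exact ENNReal.ofReal_le_ofReal (norm_fourier_le f ξ)
  -- outside the ball of radius `M⁻¹` one has `1 ≤ M |ξ|`; inside, the Fourier transform is bounded
  have hmeas : MeasurableSet (Metric.ball (0 : Plane) M⁻¹) := Metric.isOpen_ball.measurableSet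
  rw [lintegral_enorm_sq_eq_fourier h1 h2, ← lintegral_add_compl _ hmeas, add_comm]
  refine add_le_add ?_ ?_
  · rw [← lintegral_const_mul _ (by fun_prop)]
    refine (setLIntegral_mono' hmeas.compl fun ξ hξ => ?_).trans (setLIntegral_le_lintegral _ _)
    rw [← mul_assoc]
    refine le_mul_of_one_le_left (by simp) ?_
    rw [mem_compl_iff, Metric.mem_ball, dist_zero_right, not_lt] at hξ
    rw [← ofReal_norm, ← ENNReal.ofReal_mul hM.le, ENNReal.one_le_ofReal]
    calc (1 : ℝ) = M * M⁻¹ := (mul_inv_cancel₀ hM.ne').symm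
      _ ≤ _ := by gcongr
  · calc ∫⁻ ξ in Metric.ball 0 M⁻¹, ‖𝓕 f ξ‖ₑ ^ 2
        ≤ ∫⁻ _ in Metric.ball (0 : Plane) M⁻¹, (∫⁻ x, ‖f x‖ₑ) ^ 2 :=
          lintegral_mono fun ξ => by gcongr; exact hb ξ
      _ = _ := by
        rw [setLIntegral_const, Measure.addHaar_ball_of_pos _ _ (by positivity)]
        simp [mul_comm]

/-! ### Primitives of Bochner integrable functions -/

/-- On `[0, T]`, the function `P` is the primitive of the Bochner integrable function `p`. -/
structure IsPrimitive {E : Type*} [NormedAddCommGroup E] [NormedSpace ℝ E] (T : ℝ)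
    (P p : ℝ → E) : Prop where
  integrable : IntervalIntegrable p volume 0 T
  eq_add_integral : ∀ t ∈ Icc 0 T, P t = P 0 + ∫ τ in 0..t, p τ

section

variable {E F G : Type*} [NormedAddCommGroup E] [NormedSpace ℝ E]
  [NormedAddCommGroup F] [NormedSpace ℝ F]
  [NormedAddCommGroup G] [NormedSpace ℝ G]

theorem AbsolutelyContinuousOnInterval.of_dist_le {X Y : Type*} [PseudoMetricSpace X]
    [PseudoMetricSpace Y] {f : ℝ → X} {g : ℝ → Y} {a b K : ℝ}
    (hg : AbsolutelyContinuousOnInterval g a b)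
    (h : ∀ x ∈ uIcc a b, ∀ y ∈ uIcc a b, dist (f x) (f y) ≤ K * dist (g x) (g y)) :
    AbsolutelyContinuousOnInterval f a b := by
  rw [absolutelyContinuousOnInterval_iff] at hg ⊢
  intro ε hε
  obtain ⟨δ, hδ, hδ'⟩ := hg (ε / (|K| + 1)) (by positivity)
  refine ⟨δ, hδ, fun I hI hIδ => ?_⟩
  have h1 := hδ' I hI hIδ
  calc ∑ i ∈ Finset.range I.1, dist (f (I.2 i).1) (f (I.2 i).2)
      ≤ ∑ i ∈ Finset.range I.1, (|K| + 1) * dist (g (I.2 i).1) (g (I.2 i).2) := by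
        refine Finset.sum_le_sum fun i hi => ?_
        refine (h _ (hI.1 i hi).1 _ (hI.1 i hi).2).trans ?_
        gcongr
        linarith [le_abs_self K]
    _ = (|K| + 1) * ∑ i ∈ Finset.range I.1, dist (g (I.2 i).1) (g (I.2 i).2) := by
        rw [Finset.mul_sum]
    _ < (|K| + 1) * (ε / (|K| + 1)) := by gcongr
    _ = ε := by field_simp

namespace IsPrimitive

variable {T : ℝ} {P p : ℝ → E} {R r : ℝ → F}

theorem intervalIntegrable_zero (h : IsPrimitive T P p) {t : ℝ} (ht : t ∈ Icc 0 T) :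
    IntervalIntegrable p volume 0 t :=
  h.integrable.mono_set (by
    rw [uIcc_of_le ht.1, uIcc_of_le (ht.1.trans ht.2)]; exact Icc_subset_Icc_right ht.2)

theorem sub_eq (h : IsPrimitive T P p) {t t' : ℝ} (ht : t ∈ Icc 0 T) (ht' : t' ∈ Icc 0 T) :
    P t - P t' = ∫ τ in t'..t, p τ := by
  rw [h.eq_add_integral t ht, h.eq_add_integral t' ht', add_sub_add_left_eq_sub,
    intervalIntegral.integral_interval_sub_left (h.intervalIntegrable_zero ht)
      (h.intervalIntegrable_zero ht')]

theorem absolutelyContinuous (h : IsPrimitive T P p) (hT : 0 ≤ T) :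
    AbsolutelyContinuousOnInterval P 0 T := by
  have h1 := h.integrable.norm.absolutelyContinuousOnInterval_intervalIntegral
    (c := 0) (by simp [hT])
  refine h1.of_dist_le (K := 1) fun x hx y hy => ?_
  rw [uIcc_of_le hT] at hx hy
  have h2 : IsPrimitive T (fun t => ∫ τ in 0..t, ‖p τ‖) (fun τ => ‖p τ‖) :=
    ⟨h.integrable.norm, fun t _ => by simp⟩
  rw [one_mul, dist_eq_norm, dist_eq_norm, h.sub_eq hx hy, h2.sub_eq hx hy, Real.norm_eq_abs]
  exact intervalIntegral.norm_integral_le_abs_integral_norm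

theorem continuousOn (h : IsPrimitive T P p) (hT : 0 ≤ T) : ContinuousOn P (Icc 0 T) := by
  have := (h.absolutelyContinuous hT).continuousOn
  rwa [uIcc_of_le hT] at this

theorem ae_hasDerivAt [CompleteSpace E] (h : IsPrimitive T P p) (hT : 0 ≤ T) :
    ∀ᵐ t, t ∈ Ioo 0 T → HasDerivAt P (p t) t := by
  filter_upwards [h.integrable.ae_hasDerivAt_integral] with t ht hm
  have h1 := ht (by rw [uIcc_of_le hT]; exact Ioo_subset_Icc_self hm) 0 (by simp [hT])
  refine (h1.const_add (P 0)).congr_of_eventuallyEq ?_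
  filter_upwards [Ioo_mem_nhds hm.1 hm.2] with x hx
  exact h.eq_add_integral x (Ioo_subset_Icc_self hx)

theorem clm (h : IsPrimitive T P p) (S : E →L[ℝ] F) [CompleteSpace E] [CompleteSpace F]  :
    IsPrimitive T (fun t => S (P t)) (fun t => S (p t)) := by
  refine ⟨⟨S.integrable_comp h.integrable.1, S.integrable_comp h.integrable.2⟩, fun t ht => ?_⟩
  rw [h.eq_add_integral t ht, map_add, S.intervalIntegral_comp_comm (h.intervalIntegrable_zero ht)]

theorem integrable_bilin (hT : 0 ≤ T) (B : E →L[ℝ] F →L[ℝ] G)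
    (hp : IntervalIntegrable p volume 0 T) (hR : ContinuousOn R (Icc 0 T)) :
    IntervalIntegrable (fun t => B (p t) (R t)) volume 0 T := by
  rw [intervalIntegrable_iff_integrableOn_Icc_of_le hT] at hp ⊢
  obtain ⟨M, hM⟩ := isCompact_Icc.exists_bound_of_continuousOn hR
  refine Integrable.mono' (hp.norm.const_mul (‖B‖ * M)) (B.aestronglyMeasurable_comp₂
    hp.aestronglyMeasurable (hR.aestronglyMeasurable measurableSet_Icc)) ?_
  filter_upwards [ae_restrict_mem measurableSet_Icc] with t ht
  calc ‖B (p t) (R t)‖ ≤ ‖B‖ * ‖p t‖ * ‖R t‖ := B.le_opNorm₂ _ _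
    _ ≤ ‖B‖ * ‖p t‖ * M := by gcongr; exact hM t ht
    _ = ‖B‖ * M * ‖p t‖ := by ring

/-- The product rule. -/
theorem bilin [CompleteSpace E] [CompleteSpace F] [CompleteSpace G] (hP : IsPrimitive T P p)
    (hR : IsPrimitive T R r) (hT : 0 ≤ T) (B : E →L[ℝ] F →L[ℝ] G) :
    IsPrimitive T (fun t => B (P t) (R t)) (fun t => B (p t) (R t) + B (P t) (r t)) := by
  have hint : IntervalIntegrable (fun t => B (p t) (R t) + B (P t) (r t)) volume 0 T :=
    (integrable_bilin hT B hP.integrable (hR.continuousOn hT)).add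
      (integrable_bilin hT B.flip hR.integrable (hP.continuousOn hT))
  have hI : IsPrimitive T (fun t => ∫ τ in 0..t, B (p τ) (R τ) + B (P τ) (r τ))
      (fun t => B (p t) (R t) + B (P t) (r t)) := ⟨hint, fun t _ => by simp⟩
  have hN : IsPrimitive T (fun t => ∫ τ in 0..t, (‖p τ‖ + ‖r τ‖)) (fun τ => ‖p τ‖ + ‖r τ‖) :=
    ⟨hP.integrable.norm.add hR.integrable.norm, fun t _ => by simp⟩
  obtain ⟨M₁, hM₁⟩ := isCompact_Icc.exists_bound_of_continuousOn (hP.continuousOn hT)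
  obtain ⟨M₂, hM₂⟩ := isCompact_Icc.exists_bound_of_continuousOn (hR.continuousOn hT)
  have h0 : (0 : ℝ) ∈ Icc 0 T := ⟨le_rfl, hT⟩
  have hM₁0 : 0 ≤ M₁ := (norm_nonneg _).trans (hM₁ 0 h0)
  have hM₂0 : 0 ≤ M₂ := (norm_nonneg _).trans (hM₂ 0 h0)
  -- the difference of the two sides is absolutely continuous with derivative zero almost everywhere
  have hac : AbsolutelyContinuousOnInterval (fun t => B (P t) (R t)) 0 T := by
    refine (hN.absolutelyContinuous hT).of_dist_le (K := ‖B‖ * (M₁ + M₂)) ?_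
    rw [uIcc_of_le hT]
    intro x hx y hy
    have e1 : B (P x) (R x) - B (P y) (R y) = B (P x - P y) (R x) + B (P y) (R x - R y) := by
      simp only [map_sub, sub_apply]; abel
    wlog hyx : y ≤ x generalizing x y
    · rw [dist_comm, dist_comm (∫ τ in 0..x, _)]
      refine this y hy x hx ?_ (le_of_not_ge hyx)
      simp only [map_sub, sub_apply]; abel
    have i1 : IntervalIntegrable (fun τ => ‖p τ‖) volume y x := hP.integrable.norm.mono_set (by
      rw [uIcc_of_le hT, uIcc_of_le hyx]; exact Icc_subset_Icc hy.1 hx.2)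
    have i2 : IntervalIntegrable (fun τ => ‖r τ‖) volume y x := hR.integrable.norm.mono_set (by
      rw [uIcc_of_le hT, uIcc_of_le hyx]; exact Icc_subset_Icc hy.1 hx.2)
    have n1 : 0 ≤ ∫ τ in y..x, ‖p τ‖ :=
      intervalIntegral.integral_nonneg hyx fun _ _ => norm_nonneg _
    have n2 : 0 ≤ ∫ τ in y..x, ‖r τ‖ :=
      intervalIntegral.integral_nonneg hyx fun _ _ => norm_nonneg _
    have b1 : ‖P x - P y‖ ≤ ∫ τ in y..x, ‖p τ‖ := by
      rw [hP.sub_eq hx hy]; exact intervalIntegral.norm_integral_le_integral_norm hyx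
    have b2 : ‖R x - R y‖ ≤ ∫ τ in y..x, ‖r τ‖ := by
      rw [hR.sub_eq hx hy]; exact intervalIntegral.norm_integral_le_integral_norm hyx
    rw [dist_eq_norm, dist_eq_norm, hN.sub_eq hx hy, e1, intervalIntegral.integral_add i1 i2,
      Real.norm_of_nonneg (add_nonneg n1 n2)]
    calc _ ≤ ‖B (P x - P y) (R x)‖ + ‖B (P y) (R x - R y)‖ := norm_add_le _ _
      _ ≤ ‖B‖ * ‖P x - P y‖ * ‖R x‖ + ‖B‖ * ‖P y‖ * ‖R x - R y‖ :=
        add_le_add (B.le_opNorm₂ _ _) (B.le_opNorm₂ _ _)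
      _ ≤ ‖B‖ * (∫ τ in y..x, ‖p τ‖) * M₂ + ‖B‖ * M₁ * (∫ τ in y..x, ‖r τ‖) := by
        gcongr
        exacts [hM₂ x hx, hM₁ y hy]
      _ ≤ _ := by
        have := norm_nonneg B
        have m1 := mul_nonneg (mul_nonneg this n1) hM₁0
        have m2 := mul_nonneg (mul_nonneg this n2) hM₂0
        nlinarith
  obtain ⟨C, hC⟩ := (hac.sub (hI.absolutelyContinuous hT)).const_of_ae_hasDerivAt_zero (by
    have hne : ∀ᵐ t : ℝ, t ≠ 0 ∧ t ≠ T := by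
      refine (Measure.ae_ne volume 0).and (Measure.ae_ne volume T)
    filter_upwards [hP.ae_hasDerivAt hT, hR.ae_hasDerivAt hT, hI.ae_hasDerivAt hT, hne]
      with t d1 d2 d3 hne ht
    rw [uIcc_of_le hT] at ht
    have ht' : t ∈ Ioo 0 T := ⟨lt_of_le_of_ne ht.1 hne.1.symm, lt_of_le_of_ne ht.2 hne.2⟩
    have h5 := ((B.hasFDerivAt.comp_hasDerivAt t (d1 ht')).clm_apply (d2 ht')).sub (d3 ht')
    refine h5.congr_deriv ?_
    exact sub_self _)
  rw [uIcc_of_le hT] at hC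
  refine ⟨hint, fun t ht => ?_⟩
  have h1 := hC t ht
  have h2 := hC 0 h0
  simp only [Pi.sub_apply, intervalIntegral.integral_same, sub_zero] at h1 h2
  rw [h2, ← h1]; abel

end IsPrimitive

end

/-! ### The mollified equation -/

/-- Convolution with a Schwartz function, as an operator on `L²`. -/
noncomputable def schwartzConvL (k : 𝓢(Plane, ℂ)) : L2Plane →L[ℂ] L2Plane :=
  LinearMap.mkContinuous
    { toFun := fun f => (memLp_schwartzConv k (Lp.memLp f)).toLp _
      map_add' := fun f g => by
        rw [← MemLp.toLp_add]
        refine MemLp.toLp_congr _ _ (EventuallyEq.of_eq ?_)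
        rw [schwartzConv_congr k (Lp.coeFn_add f g), schwartzConv_add k (Lp.memLp f) (Lp.memLp g)]
      map_smul' := fun c f => by
        rw [RingHom.id_apply, ← MemLp.toLp_const_smul]
        refine MemLp.toLp_congr _ _ (EventuallyEq.of_eq ?_)
        rw [schwartzConv_congr k (Lp.coeFn_smul c f)]
        ext x
        simp only [schwartzConv, Pi.smul_apply, smul_eq_mul, ← integral_const_mul]
        congr 1; ext y; ring }
    (∫⁻ z, ‖k z‖ₑ).toReal fun f => by
      have h1 := eLpNorm_schwartzConv_le (p := 2) (by norm_num) (by norm_num) k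
        (Lp.stronglyMeasurable f).measurable
      have h2 := schwartz_lintegral_lt_top k
      simp only [LinearMap.coe_mk, AddHom.coe_mk]
      rw [Lp.norm_toLp, Lp.norm_def, ← ENNReal.toReal_mul]
      exact ENNReal.toReal_mono (ENNReal.mul_lt_top h2 (Lp.memLp f).eLpNorm_lt_top).ne h1

theorem coeFn_schwartzConvL (k : 𝓢(Plane, ℂ)) (f : L2Plane) :
    schwartzConvL k f =ᵐ[volume] schwartzConv k f :=
  MemLp.coeFn_toLp (memLp_schwartzConv k (Lp.memLp f))

attribute [irreducible] schwartzConvL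

/-- The function `y ↦ k (x - y)`. -/
noncomputable def reflectAt (x : Plane) : 𝓢(Plane, ℂ) →L[ℂ] 𝓢(Plane, ℂ) :=
  SchwartzMap.compCLMOfAntilipschitz ℂ (g := fun y => x - y) (K := 1) (by fun_prop)
    fun a b => by simp [edist_dist, dist_eq_norm, norm_sub_rev]

theorem reflectAt_apply (x : Plane) (k : 𝓢(Plane, ℂ)) (y : Plane) : reflectAt x k y = k (x - y) :=
  rfl

open LineDeriv in
theorem lineDerivOp_reflectAt (x v : Plane) (k : 𝓢(Plane, ℂ)) :
    ∂_{v} (reflectAt x k) = -reflectAt x (∂_{v} k) := by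
  ext y
  rw [neg_apply, reflectAt_apply, SchwartzMap.lineDerivOp_apply_eq_fderiv,
    SchwartzMap.lineDerivOp_apply_eq_fderiv]
  have h1 : HasFDerivAt (reflectAt x k)
      ((fderiv ℝ k (x - y)).comp (-ContinuousLinearMap.id ℝ Plane)) y :=
    (k.differentiableAt (x := x - y)).hasFDerivAt.comp y ((hasFDerivAt_id y).const_sub x)
  rw [h1.fderiv]
  simp

theorem laplacian_reflectAt (x : Plane) (k : 𝓢(Plane, ℂ)) :
    Δ (reflectAt x k) = reflectAt x (Δ k) := by
  rw [SchwartzMap.laplacian_eq_sum (EuclideanSpace.basisFun (Fin 2) ℝ),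
    SchwartzMap.laplacian_eq_sum (EuclideanSpace.basisFun (Fin 2) ℝ), map_sum]
  refine Finset.sum_congr rfl fun i _ => ?_
  rw [lineDerivOp_reflectAt, ← map_neg, lineDerivOp_reflectAt, ← map_neg,
    LineDeriv.lineDerivOp_neg, neg_neg]

/-- The pairing of functions of `L²` with a Schwartz function. -/
noncomputable def schwartzPairing (ψ : 𝓢(Plane, ℂ)) : L2Plane →L[ℂ] ℂ :=
  ((ContinuousLinearMap.mul ℂ ℂ).lpPairing volume 2 2).flip (ψ.toLp 2 volume)

theorem schwartzPairing_apply (ψ : 𝓢(Plane, ℂ)) (f : L2Plane) :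
    schwartzPairing ψ f = ∫ x, f x * ψ x := by
  rw [schwartzPairing, ContinuousLinearMap.flip_apply, ContinuousLinearMap.lpPairing_eq_integral]
  refine integral_congr_ae ?_
  filter_upwards [ψ.coeFn_toLp 2 volume] with x hx
  rw [hx]; rfl

theorem schwartzPairing_reflectAt (k : 𝓢(Plane, ℂ)) (f : L2Plane) (x : Plane) :
    schwartzPairing (reflectAt x k) f = schwartzConv k f x := by
  rw [schwartzPairing_apply, schwartzConv]
  simp_rw [reflectAt_apply, mul_comm]

/-- If `U` solves `i U' + Δ U = F` in the sense of distributions, then the convolution of `U` with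
a Schwartz function is differentiable almost everywhere in time as an `L²`-valued function, and it
is the primitive of its derivative. -/
theorem isPrimitive_schwartzConvL {T : ℝ} {U F : ℝ → L2Plane} (hU : Continuous U)
    (hF : IntervalIntegrable F volume 0 T)
    (heq : ∀ ψ : 𝓢(Plane, ℂ), ∀ t ∈ Icc 0 T,
      Complex.I * (schwartzPairing ψ (U t) - schwartzPairing ψ (U 0)) +
        ∫ τ in (0 : ℝ)..t, (schwartzPairing (Δ ψ) (U τ) - schwartzPairing ψ (F τ)) = 0)
    (k : 𝓢(Plane, ℂ)) :
    IsPrimitive T (fun t => schwartzConvL k (U t)) (fun t =>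
      Complex.I • (schwartzConvL (Δ k) (U t) - schwartzConvL k (F t))) := by
  have hFt : ∀ t ∈ Icc 0 T, IntervalIntegrable F volume 0 t := fun t ht => hF.mono_set (by
    rw [uIcc_of_le ht.1, uIcc_of_le (ht.1.trans ht.2)]; exact Icc_subset_Icc_right ht.2)
  have hUi : ∀ t, IntervalIntegrable U volume 0 t := fun t => hU.intervalIntegrable _ _
  have hc : ∀ {S : Type} [NormedAddCommGroup S] [NormedSpace ℂ S] (L : L2Plane →L[ℂ] S)
      {G : ℝ → L2Plane} {t : ℝ}, IntervalIntegrable G volume 0 t →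
      IntervalIntegrable (fun τ => L (G τ)) volume 0 t :=
    fun L _ _ h => ⟨L.integrable_comp h.1, L.integrable_comp h.2⟩
  refine ⟨((hc _ (hUi T)).sub (hc _ hF)).smul Complex.I, fun t ht => ?_⟩
  have e1 : ∫ τ in (0 : ℝ)..t, Complex.I • (schwartzConvL (Δ k) (U τ) - schwartzConvL k (F τ)) =
      Complex.I • (schwartzConvL (Δ k) (∫ τ in (0 : ℝ)..t, U τ) -
        schwartzConvL k (∫ τ in (0 : ℝ)..t, F τ)) := by
    rw [intervalIntegral.integral_smul, intervalIntegral.integral_sub (hc _ (hUi t))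
      (hc _ (hFt t ht)), ContinuousLinearMap.intervalIntegral_comp_comm _ (hUi t),
      ContinuousLinearMap.intervalIntegral_comp_comm _ (hFt t ht)]
  rw [e1]
  set A := ∫ τ in (0 : ℝ)..t, U τ with hA
  set B := ∫ τ in (0 : ℝ)..t, F τ with hB
  -- the equation tested against `y ↦ k (x - y)`
  have key : ∀ x, schwartzConv k (U t) x = schwartzConv k (U 0) x +
      Complex.I * (schwartzConv (Δ k) A x - schwartzConv k B x) := by
    intro x
    have h1 := heq (reflectAt x k) t ht
    rw [intervalIntegral.integral_sub (hc _ (hUi t)) (hc _ (hFt t ht)),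
      ContinuousLinearMap.intervalIntegral_comp_comm _ (hUi t),
      ContinuousLinearMap.intervalIntegral_comp_comm _ (hFt t ht), ← hA, ← hB,
      laplacian_reflectAt, schwartzPairing_reflectAt, schwartzPairing_reflectAt,
      schwartzPairing_reflectAt, schwartzPairing_reflectAt] at h1
    linear_combination (-Complex.I) * h1 + (schwartzConv k (U t) x - schwartzConv k (U 0) x) *
      Complex.I_sq
  ext1
  filter_upwards [coeFn_schwartzConvL k (U t), coeFn_schwartzConvL k (U 0),
    coeFn_schwartzConvL (Δ k) A, coeFn_schwartzConvL k B,
    Lp.coeFn_add (schwartzConvL k (U 0)) (Complex.I • (schwartzConvL (Δ k) A - schwartzConvL k B)),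
    Lp.coeFn_smul Complex.I (schwartzConvL (Δ k) A - schwartzConvL k B),
    Lp.coeFn_sub (schwartzConvL (Δ k) A) (schwartzConvL k B)] with x a1 a2 a3 a4 a5 a6 a7
  rw [a1, a5, Pi.add_apply, a6, Pi.smul_apply, a7, Pi.sub_apply, a2, a3, a4, key, smul_eq_mul]

open LineDeriv in
theorem laplacian_eq_of_orthonormal {e e' : Plane} (he : ‖e‖ = 1) (he' : ‖e'‖ = 1)
    (hee : inner ℝ e e' = 0) (k : 𝓢(Plane, ℂ)) :
    Δ k = ∂_{e} (∂_{e} k) + ∂_{e'} (∂_{e'} k) := by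
  have ho : Orthonormal ℝ ![e, e'] := by
    rw [orthonormal_iff_ite]
    intro i j
    fin_cases i <;> fin_cases j <;> simp [he, he', hee, real_inner_comm]
  have h := SchwartzMap.laplacian_eq_sum
    ((basisOfOrthonormalOfCardEqFinrank ho (by simp)).toOrthonormalBasis (by simpa using ho)) k
  rw [h]
  simp

/-! ### The cubic nonlinearity as a measurable function of time -/

/-- The truncated cubic nonlinearity `min (|z|, n)² z`. -/
noncomputable def cubicTrunc (n : ℝ≥0) (z : ℂ) : ℂ := ((min ‖z‖ n ^ 2 : ℝ) : ℂ) * z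

theorem lipschitzWith_cubicTrunc (n : ℝ≥0) : LipschitzWith (3 * n ^ 2) (cubicTrunc n) := by
  refine LipschitzWith.of_dist_le_mul fun z w => ?_
  wlog hzw : ‖w‖ ≤ ‖z‖ generalizing z w
  · rw [dist_comm, dist_comm z]
    exact this w z (le_of_not_ge hzw)
  rw [dist_eq_norm, dist_eq_norm]
  have e1 : cubicTrunc n z - cubicTrunc n w = ((min ‖z‖ n ^ 2 : ℝ) : ℂ) * (z - w) +
      ((min ‖z‖ n ^ 2 - min ‖w‖ n ^ 2 : ℝ) : ℂ) * w := by
    simp only [cubicTrunc]; push_cast; ring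
  rw [e1]
  refine (norm_add_le _ _).trans ?_
  rw [norm_mul, norm_mul, Complex.norm_real, Complex.norm_real, Real.norm_of_nonneg (by positivity)]
  have hn : (0 : ℝ) ≤ n := n.2
  have h1 : min ‖z‖ n ^ 2 * ‖z - w‖ ≤ n ^ 2 * ‖z - w‖ := by
    gcongr; exact min_le_right _ _
  have h2 : ‖min ‖z‖ (n : ℝ) ^ 2 - min ‖w‖ (n : ℝ) ^ 2‖ * ‖w‖ ≤ 2 * n ^ 2 * ‖z - w‖ := by
    rcases le_total ‖w‖ n with hw | hw
    · rw [min_eq_left hw]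
      have h3 : ‖w‖ ≤ min ‖z‖ n := le_min hzw hw
      have h4 : min ‖z‖ n ≤ ‖w‖ + ‖z - w‖ :=
        (min_le_left _ _).trans (by linarith [norm_sub_norm_le z w])
      have h5 : min ‖z‖ (n : ℝ) ≤ n := min_le_right _ _
      rw [Real.norm_of_nonneg (by nlinarith [norm_nonneg w])]
      calc (min ‖z‖ (n : ℝ) ^ 2 - ‖w‖ ^ 2) * ‖w‖
          = (min ‖z‖ (n : ℝ) - ‖w‖) * ((min ‖z‖ (n : ℝ) + ‖w‖) * ‖w‖) := by ring
        _ ≤ ‖z - w‖ * ((n + n) * n) := by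
          have := norm_nonneg w
          gcongr
          linarith
        _ = _ := by ring
    · rw [min_eq_right hw, min_eq_right (hw.trans hzw)]
      simp; positivity
  push_cast
  nlinarith

theorem cubicTrunc_zero (n : ℝ≥0) : cubicTrunc n 0 = 0 := by simp [cubicTrunc]

open Classical in
/-- The function `|f|² f`, as an element of `L²` if it is square integrable. -/
noncomputable def cubicLp (f : L2Plane) : L2Plane :=
  if h : MemLp (fun x => ((‖f x‖ ^ 2 : ℝ) : ℂ) * f x) 2 then h.toLp _ else 0

theorem coeFn_cubicLp {f : L2Plane} (h : MemLp (fun x => ((‖f x‖ ^ 2 : ℝ) : ℂ) * f x) 2) :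
    cubicLp f =ᵐ[volume] fun x => ((‖f x‖ ^ 2 : ℝ) : ℂ) * f x := by
  rw [cubicLp, dif_pos h]
  exact h.coeFn_toLp

theorem tendsto_cubicTrunc {f : L2Plane} (h : MemLp (fun x => ((‖f x‖ ^ 2 : ℝ) : ℂ) * f x) 2) :
    Tendsto (fun n : ℕ => (lipschitzWith_cubicTrunc n).compLp (cubicTrunc_zero n) f) atTop
      (𝓝 (cubicLp f)) := by
  rw [Lp.tendsto_Lp_iff_tendsto_eLpNorm']
  have e1 : ∀ n : ℕ, eLpNorm (⇑((lipschitzWith_cubicTrunc n).compLp (cubicTrunc_zero n) f) -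
      ⇑(cubicLp f)) 2 =
      eLpNorm (fun x => cubicTrunc n (f x) - ((‖f x‖ ^ 2 : ℝ) : ℂ) * f x) 2 := fun n =>
    eLpNorm_congr_ae (((lipschitzWith_cubicTrunc n).coeFn_compLp (cubicTrunc_zero n) f).sub
      (coeFn_cubicLp h))
  simp_rw [e1, eLpNorm_eq_lintegral_rpow_enorm_toReal (p := 2) (by norm_num) (by norm_num)]
  have hfin : ∫⁻ x, ‖((‖f x‖ ^ 2 : ℝ) : ℂ) * f x‖ₑ ^ (2 : ℝ≥0∞).toReal ≠ ⊤ :=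
    (lintegral_rpow_enorm_lt_top_of_eLpNorm_lt_top (by norm_num) (by norm_num) h.2).ne
  have hm : Measurable fun x => f x := (Lp.stronglyMeasurable f).measurable
  have hlim := tendsto_lintegral_of_dominated_convergence (μ := (volume : Measure Plane))
    (F := fun (n : ℕ) x => ‖cubicTrunc n (f x) - ((‖f x‖ ^ 2 : ℝ) : ℂ) * f x‖ₑ ^
      (2 : ℝ≥0∞).toReal) (f := fun _ => 0) _ (fun n => ?_) (fun n => ?_) hfin ?_
  · have := (ENNReal.continuous_rpow_const (y := 1 / (2 : ℝ≥0∞).toReal)).tendsto 0 |>.comp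
      (hlim.trans (by simp))
    simpa [Function.comp_def] using this
  · have := (lipschitzWith_cubicTrunc n).continuous.measurable.comp hm
    exact ((this.sub (by fun_prop)).enorm).pow_const _
  · refine Eventually.of_forall fun x => ?_
    simp only
    gcongr
    rw [enorm_le_iff_norm_le]
    have e2 : cubicTrunc n (f x) - ((‖f x‖ ^ 2 : ℝ) : ℂ) * f x =
        ((min ‖f x‖ n ^ 2 - ‖f x‖ ^ 2 : ℝ) : ℂ) * f x := by
      simp only [cubicTrunc]; push_cast; ring
    rw [e2, norm_mul, norm_mul, Complex.norm_real, Complex.norm_real]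
    gcongr
    rw [Real.norm_eq_abs, Real.norm_eq_abs, abs_of_nonneg (a := ‖f x‖ ^ 2) (by positivity), abs_le]
    have h5 : min ‖f x‖ n ≤ ‖f x‖ := min_le_left _ _
    have h6 : 0 ≤ min ‖f x‖ n := by positivity
    constructor <;> nlinarith
  · refine Eventually.of_forall fun x => ?_
    obtain ⟨n₀, hn₀⟩ := exists_nat_ge ‖f x‖
    refine tendsto_const_nhds.congr' ?_
    filter_upwards [eventually_ge_atTop n₀] with n hn
    have : min ‖f x‖ n = ‖f x‖ := min_eq_left (hn₀.trans (by exact_mod_cast hn))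
    simp [cubicTrunc, this]

/-- The map `f ↦ |f|² f` is not continuous in `L²`, but it is the limit of Lipschitz truncations. -/
theorem aestronglyMeasurable_cubicLp {U : ℝ → L2Plane} (hU : Continuous U) {μ : Measure ℝ}
    (h : ∀ᵐ t ∂μ, MemLp (fun x => ((‖U t x‖ ^ 2 : ℝ) : ℂ) * U t x) 2) :
    AEStronglyMeasurable (fun t => cubicLp (U t)) μ :=
  aestronglyMeasurable_of_tendsto_ae atTop
    (fun n : ℕ => (((lipschitzWith_cubicTrunc n).continuous_compLp (cubicTrunc_zero n)).comp
      hU).aestronglyMeasurable)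
    (h.mono fun _ ht => tendsto_cubicTrunc ht)

/-! ### The interaction functional along the flow -/

theorem interaction_congr_ae {θ : ℝ → ℝ} {e : Plane} {a a' c c' : Plane → ℝ}
    (ha : a =ᵐ[volume] a') (hc : c =ᵐ[volume] c') :
    interaction θ e a c = interaction θ e a' c' := by
  refine integral_congr_ae ?_
  rw [Measure.volume_eq_prod]
  filter_upwards [Measure.quasiMeasurePreserving_fst.ae ha,
    Measure.quasiMeasurePreserving_snd.ae hc] with q h1 h2
  rw [h1, h2]

/-- The bilinear interaction functional on `L¹`. -/
noncomputable def interactionL (θ : ℝ → ℝ) {X : ℝ} (hθ : Continuous θ) (hX : ∀ r, |θ r| ≤ X)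
    (e : Plane) : Lp ℝ 1 (volume : Measure Plane) →L[ℝ] Lp ℝ 1 (volume : Measure Plane) →L[ℝ] ℝ :=
  LinearMap.mkContinuous₂ (LinearMap.mk₂ ℝ (fun a c => interaction θ e a c)
    (fun a b c => by
      rw [← interaction_add_left hθ hX (L1.integrable_coeFn a) (L1.integrable_coeFn b)
        (L1.integrable_coeFn c)]
      exact interaction_congr_ae (Lp.coeFn_add a b) EventuallyEq.rfl)
    (fun r a c => by
      rw [smul_eq_mul, ← interaction_smul_left]
      exact interaction_congr_ae (Lp.coeFn_smul r a) EventuallyEq.rfl)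
    (fun a b c => by
      rw [← interaction_add_right hθ hX (L1.integrable_coeFn b) (L1.integrable_coeFn c)
        (L1.integrable_coeFn a)]
      exact interaction_congr_ae EventuallyEq.rfl (Lp.coeFn_add b c))
    (fun r a c => by
      rw [smul_eq_mul, ← interaction_smul_right]
      exact interaction_congr_ae EventuallyEq.rfl (Lp.coeFn_smul r c))) X fun a c => by
    rw [LinearMap.mk₂_apply, Real.norm_eq_abs, mul_assoc, L1.norm_eq_integral_norm,
      L1.norm_eq_integral_norm]
    exact abs_interaction_le hθ hX (L1.integrable_coeFn a) (L1.integrable_coeFn c)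

theorem interactionL_apply {θ : ℝ → ℝ} {X : ℝ} (hθ : Continuous θ) (hX : ∀ r, |θ r| ≤ X)
    (e : Plane) (a c : Lp ℝ 1 (volume : Measure Plane)) :
    interactionL θ hθ hX e a c = interaction θ e a c := rfl

/-- The pointwise real inner product, as a bilinear map `L² × L² → L¹`. -/
noncomputable def innerLp : L2Plane →L[ℝ] L2Plane →L[ℝ] Lp ℝ 1 (volume : Measure Plane) :=
  (innerSL ℝ (E := ℂ)).holderL volume 2 2 1

theorem coeFn_innerLp (f g : L2Plane) :
    innerLp f g =ᵐ[volume] fun x => inner ℝ (f x) (g x) :=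
  (innerSL ℝ (E := ℂ)).coeFn_holder (r := 1) f g

/-- Multiplication by `i`. -/
noncomputable def mulIL : L2Plane →L[ℝ] L2Plane :=
  (Complex.I • ContinuousLinearMap.id ℂ L2Plane).restrictScalars ℝ

theorem mulIL_apply (f : L2Plane) : mulIL f = Complex.I • f := rfl

theorem coeFn_mulIL (f : L2Plane) : mulIL f =ᵐ[volume] fun x => Complex.I * f x :=
  Lp.coeFn_smul Complex.I f

theorem norm_innerLp_le (f g : L2Plane) : ‖innerLp f g‖ ≤ ‖f‖ * ‖g‖ := by
  refine (innerLp.le_opNorm₂ f g).trans ?_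
  have h1 : ‖innerLp‖ ≤ 1 := ((innerSL ℝ (E := ℂ)).norm_holderL_le).trans (norm_innerSL_le ℝ)
  calc _ ≤ 1 * ‖f‖ * ‖g‖ := by gcongr
    _ = _ := by ring

theorem norm_mulIL (f : L2Plane) : ‖mulIL f‖ = ‖f‖ := by
  rw [mulIL_apply, norm_smul, Complex.norm_I, one_mul]

attribute [irreducible] interactionL innerLp mulIL

theorem exists_orthonormal_complement {e : Plane} (he : ‖e‖ = 1) :
    ∃ e' : Plane, ‖e'‖ = 1 ∧ inner ℝ e e' = 0 := by
  refine ⟨!₂[-e 1, e 0], ?_, ?_⟩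
  · rw [EuclideanSpace.norm_eq] at he ⊢
    rw [← he]
    simp [Fin.sum_univ_two, add_comm]
  · simp [PiLp.inner_apply, Fin.sum_univ_two]
    ring

theorem memLp_norm_sq_mul {w v : Plane → ℂ} {B : ℝ} (hw : ∀ x, ‖w x‖ ≤ B)
    (hwm : AEStronglyMeasurable w) (hv : MemLp v 2) :
    MemLp (fun x => ((‖w x‖ ^ 2 : ℝ) : ℂ) * v x) 2 := by
  refine MemLp.of_le_mul (c := B ^ 2) hv ?_ (Eventually.of_forall fun x => ?_)
  · exact (Complex.continuous_ofReal.comp_aestronglyMeasurable (hwm.norm.pow 2)).mul hv.1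
  · rw [norm_mul, Complex.norm_real, Real.norm_of_nonneg (by positivity)]
    gcongr
    exact hw x

theorem exists_norm_schwartzConv_le (k : 𝓢(Plane, ℂ)) (f : L2Plane) :
    ∃ B : ℝ, ∀ x, ‖schwartzConv k f x‖ ≤ B := by
  refine ⟨(eLpNorm k 2 * eLpNorm f 2).toReal, fun x => ?_⟩
  have h := enorm_schwartzConv_le k (Lp.aestronglyMeasurable f) x
  have hk : MemLp (k : Plane → ℂ) 2 := k.memLp 2
  have h1 : eLpNorm k 2 * eLpNorm f 2 ≠ ⊤ :=
    ENNReal.mul_ne_top hk.eLpNorm_ne_top (Lp.eLpNorm_ne_top f)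
  rw [← toReal_enorm]
  exact ENNReal.toReal_mono h1 h

section FixedTime

open LineDeriv

variable (k : 𝓢(Plane, ℂ)) (f F : L2Plane) {e e' : Plane}

/-- The cubic nonlinearity of the mollified function. -/
noncomputable def mollifiedCubic (k : 𝓢(Plane, ℂ)) (f : Plane → ℂ) (x : Plane) : ℂ :=
  ((‖schwartzConv k f x‖ ^ 2 : ℝ) : ℂ) * schwartzConv k f x

/-- The derivative of `mollifiedCubic` in the direction `e`. -/
noncomputable def mollifiedCubicDeriv (k : 𝓢(Plane, ℂ)) (e : Plane) (f : Plane → ℂ) (x : Plane) :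
    ℂ :=
  ((2 * inner ℝ (schwartzConv k f x) (schwartzConv (∂_{e} k) f x) : ℝ) : ℂ) * schwartzConv k f x +
    ((‖schwartzConv k f x‖ ^ 2 : ℝ) : ℂ) * schwartzConv (∂_{e} k) f x

theorem memLp_mollifiedCubic : MemLp (mollifiedCubic k f) 2 := by
  obtain ⟨B, hB⟩ := exists_norm_schwartzConv_le k f
  have hm := memLp_schwartzConv k (Lp.memLp f)
  exact memLp_norm_sq_mul hB hm.1 hm

theorem memLp_mollifiedCubicDeriv (e : Plane) : MemLp (mollifiedCubicDeriv k e f) 2 := by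
  obtain ⟨B, hB⟩ := exists_norm_schwartzConv_le k f
  obtain ⟨B1, hB1⟩ := exists_norm_schwartzConv_le (∂_{e} k) f
  have hm := memLp_schwartzConv k (Lp.memLp f)
  have hm1 := memLp_schwartzConv (∂_{e} k) (Lp.memLp f)
  refine MemLp.add ?_ (memLp_norm_sq_mul hB hm.1 hm1)
  refine MemLp.of_le_mul (c := 2 * (B * B1)) hm ?_ (Eventually.of_forall fun x => ?_)
  · exact (Complex.continuous_ofReal.comp_aestronglyMeasurable
      ((hm.1.inner (𝕜 := ℝ) hm1.1).const_mul 2)).mul hm.1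
  · rw [norm_mul, Complex.norm_real, norm_mul, Real.norm_ofNat]
    gcongr
    refine (norm_inner_le_norm _ _).trans ?_
    have := hB x
    have := hB1 x
    have := (norm_nonneg _).trans (hB x)
    gcongr

theorem hasLineDerivAt_mollifiedCubic (x e : Plane) :
    HasLineDerivAt ℝ (mollifiedCubic k f) (mollifiedCubicDeriv k e f x) x e := by
  have hD := schwartzConv_hasLineDerivAt k (Lp.memLp f) x e
  have h1 := hD.inner_real hD
  rw [real_inner_comm (schwartzConv k f x) (schwartzConv (∂_{e} k) f x), ← two_mul] at h1
  have h2 := (HasDerivAt.ofReal_comp h1).mul hD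
  simp only [zero_smul, add_zero] at h2
  have h3 : mollifiedCubic k f = fun x =>
      ((inner ℝ (schwartzConv k f x) (schwartzConv k f x) : ℝ) : ℂ) * schwartzConv k f x := by
    ext x; rw [mollifiedCubic, real_inner_self_eq_norm_sq]
  rw [h3, mollifiedCubicDeriv, ← real_inner_self_eq_norm_sq]
  exact h2

/-- The forcing `S_k F - |S_k f|² S_k f` of the mollified equation. -/
noncomputable def mollifierError (k : 𝓢(Plane, ℂ)) (f F : Plane → ℂ) (x : Plane) : ℂ :=
  schwartzConv k F x - mollifiedCubic k f x

theorem coeFn_schwartzConvL_equation (he : ‖e‖ = 1) (he' : ‖e'‖ = 1) (hee : inner ℝ e e' = 0) :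
    (Complex.I • (schwartzConvL (Δ k) f - schwartzConvL k F) : L2Plane) =ᵐ[volume]
      fun x => Complex.I * (schwartzConv (∂_{e} (∂_{e} k)) f x +
        schwartzConv (∂_{e'} (∂_{e'} k)) f x - schwartzConv k F x) := by
  filter_upwards [Lp.coeFn_smul Complex.I (schwartzConvL (Δ k) f - schwartzConvL k F),
    Lp.coeFn_sub (schwartzConvL (Δ k) f) (schwartzConvL k F), coeFn_schwartzConvL (Δ k) f,
    coeFn_schwartzConvL k F] with x h1 h2 h3 h4
  rw [h1, Pi.smul_apply, h2, Pi.sub_apply, h3, h4, laplacian_eq_of_orthonormal he he' hee,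
    schwartzConv_add_left _ _ (Lp.memLp f), smul_eq_mul, Pi.add_apply]

theorem coeFn_innerLp_momentum {W W1 G G1 : L2Plane} {w w1 l h l1 h1 : Plane → ℂ}
    (aW : W =ᵐ[volume] w) (aW1 : W1 =ᵐ[volume] w1)
    (aG : G =ᵐ[volume] fun x => Complex.I * (l x - h x))
    (aG1 : G1 =ᵐ[volume] fun x => Complex.I * (l1 x - h1 x)) :
    (innerLp (mulIL G) W1 + innerLp (mulIL W) G1 : Lp ℝ 1 (volume : Measure Plane)) =ᵐ[volume]
      fun x => inner ℝ (w x) (l1 x) - inner ℝ (l x) (w1 x) + inner ℝ (h x) (w1 x) -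
        inner ℝ (w x) (h1 x) := by
  filter_upwards [Lp.coeFn_add (innerLp (mulIL G) W1) (innerLp (mulIL W) G1),
    coeFn_innerLp (mulIL G) W1, coeFn_innerLp (mulIL W) G1, coeFn_mulIL G, coeFn_mulIL W,
    aW, aW1, aG, aG1] with x h1 h2 h3 h4 h5 h6 h7 h8 h9
  rw [h1, Pi.add_apply, h2, h3, h4, h5, h6, h7, h8, h9, inner_I_mul, ← mul_assoc, ← mul_assoc,
    Complex.I_mul_I]
  simp only [neg_mul, one_mul, inner_neg_left, inner_sub_left, inner_sub_right]
  ring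

theorem coeFn_innerLp_mass {W G : L2Plane} {w g : Plane → ℂ} (aW : W =ᵐ[volume] w)
    (aG : G =ᵐ[volume] g) :
    (innerLp G W + innerLp W G : Lp ℝ 1 (volume : Measure Plane)) =ᵐ[volume]
      fun x => 2 * inner ℝ (w x) (g x) := by
  filter_upwards [Lp.coeFn_add (innerLp G W) (innerLp W G), coeFn_innerLp G W,
    coeFn_innerLp W G, aW, aG] with x h1 h2 h3 h4 h5
  rw [h1, Pi.add_apply, h2, h3, real_inner_comm, ← two_mul, h4, h5]

/-- The interaction Morawetz inequality for the mollification of the equation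
`i f_t + Δ f = F`, at a fixed time. -/
theorem interaction_morawetz_mollified {χ κ : ℝ → ℝ} {X Y : ℝ} (hd : ∀ r, HasDerivAt χ (κ r) r)
    (hχ : Continuous χ) (hκ : Continuous κ) (hX : ∀ r, |χ r| ≤ X) (hY : ∀ r, |κ r| ≤ Y)
    (hpos : ∀ r, 0 ≤ κ r) (heven : ∀ r, κ (-r) = κ r) (he : ‖e‖ = 1) (hee : inner ℝ e e' = 0)
    {W W1 G G1 : L2Plane} (aW : W =ᵐ[volume] schwartzConv k f)
    (aW1 : W1 =ᵐ[volume] schwartzConv (∂_{e} k) f)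
    (aG : G =ᵐ[volume] fun x => Complex.I * (schwartzConv (∂_{e} (∂_{e} k)) f x +
      schwartzConv (∂_{e'} (∂_{e'} k)) f x - schwartzConv k F x))
    (aG1 : G1 =ᵐ[volume] fun x => Complex.I * (schwartzConv (∂_{e} (∂_{e} (∂_{e} k))) f x +
      schwartzConv (∂_{e'} (∂_{e'} (∂_{e} k))) f x - schwartzConv (∂_{e} k) F x)) :
    interaction κ e
        (fun x => 2 * inner ℝ (schwartzConv k f x) (schwartzConv (∂_{e} k) f x))
        (fun x => 2 * inner ℝ (schwartzConv k f x) (schwartzConv (∂_{e} k) f x)) -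
      6 * X * ((eLpNorm (mollifierError k f F) 2).toReal * (eLpNorm (schwartzConv k f) 2).toReal ^ 2
        * (eLpNorm (schwartzConv (∂_{e} k) f) 2).toReal) ≤
    interactionL χ hχ hX e (innerLp (mulIL G) W1 + innerLp (mulIL W) G1) (innerLp W W) +
      interactionL χ hχ hX e (innerLp (mulIL W) W1) (innerLp G W + innerLp W G) := by
  have hm : ∀ k : 𝓢(Plane, ℂ), MemLp (schwartzConv k f) 2 := fun k =>
    memLp_schwartzConv k (Lp.memLp f)
  have hmF : ∀ k : 𝓢(Plane, ℂ), MemLp (schwartzConv k F) 2 := fun k =>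
    memLp_schwartzConv k (Lp.memLp F)
  have hD : ∀ (k : 𝓢(Plane, ℂ)) (v x : Plane),
      HasLineDerivAt ℝ (schwartzConv k f) (schwartzConv (∂_{v} k) f x) x v := fun k v x =>
    schwartzConv_hasLineDerivAt k (Lp.memLp f) x v
  have hcm := memLp_mollifiedCubic k f
  have hc1m := memLp_mollifiedCubicDeriv k f e
  have dc := fun x => hasLineDerivAt_mollifiedCubic k f x e
  have aWW : (innerLp W W : Lp ℝ 1 (volume : Measure Plane)) =ᵐ[volume]
      fun x => inner ℝ (schwartzConv k f x) (schwartzConv k f x) := by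
    filter_upwards [coeFn_innerLp W W, aW] with x h1 h2
    rw [h1, h2]
  have aWW1 : (innerLp (mulIL W) W1 : Lp ℝ 1 (volume : Measure Plane)) =ᵐ[volume]
      fun x => inner ℝ (Complex.I * schwartzConv k f x) (schwartzConv (∂_{e} k) f x) := by
    filter_upwards [coeFn_innerLp (mulIL W) W1, coeFn_mulIL W, aW, aW1] with x h1 h2 h3 h4
    rw [h1, h2, h3, h4]
  have aP := coeFn_innerLp_momentum aW aW1 aG aG1
  have aR := coeFn_innerLp_mass aW aG
  have key := interaction_morawetz hd hκ hX hY hpos heven he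
    (by rw [real_inner_comm]; exact hee) (hm k) (hm (∂_{e} k)) (hm (∂_{e'} k))
    (hm (∂_{e} (∂_{e} k))) (hm (∂_{e'} (∂_{e} k))) (hm (∂_{e'} (∂_{e'} k)))
    (hm (∂_{e} (∂_{e} (∂_{e} k)))) (hm (∂_{e'} (∂_{e'} (∂_{e} k)))) hcm hc1m
    (E := mollifierError k f F)
    (E1 := fun x => schwartzConv (∂_{e} k) F x - mollifiedCubicDeriv k e f x)
    ((hmF k).sub hcm) ((hmF _).sub hc1m) (hD _ _) (hD _ _) (hD _ _) (hD _ _) (hD _ _) (hD _ _)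
    (hD _ _) (fun x => HasDerivAt.sub (schwartzConv_hasLineDerivAt k (Lp.memLp F) x e) (dc x)) dc
    (fun x => rfl) (fun x => rfl)
  have e1 : ∀ x, mollifiedCubic k f x + mollifierError k f F x = schwartzConv k F x := fun x => by
    simp [mollifierError]
  have e2 : ∀ x, mollifiedCubicDeriv k e f x + (schwartzConv (∂_{e} k) F x -
      mollifiedCubicDeriv k e f x) = schwartzConv (∂_{e} k) F x := fun x => by ring
  simp only [e1, e2] at key
  rw [interactionL_apply, interactionL_apply, interaction_congr_ae aP aWW,
    interaction_congr_ae aWW1 aR]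
  exact key

end FixedTime

/-! ### The time-integrated Morawetz inequality -/

/-- `U` is a continuous `L²`-valued solution of `i U' + Δ U = |U|² U` on `[0, T]`, in the sense of
distributions, with a nonlinearity `F` that is Bochner integrable in `L²`. -/
structure IsMildSolution (T : ℝ) (U F : ℝ → L2Plane) : Prop where
  continuous : Continuous U
  integrable : IntervalIntegrable F volume 0 T
  nonlinearity : ∀ᵐ t ∂volume.restrict (Icc 0 T),
    F t =ᵐ[volume] fun x => ((‖U t x‖ ^ 2 : ℝ) : ℂ) * U t x
  equation : ∀ ψ : 𝓢(Plane, ℂ), ∀ t ∈ Icc 0 T,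
    Complex.I * (schwartzPairing ψ (U t) - schwartzPairing ψ (U 0)) +
      ∫ τ in (0 : ℝ)..t, (schwartzPairing (Δ ψ) (U τ) - schwartzPairing ψ (F τ)) = 0

/-- The elementary estimate behind the Morawetz inequality: `b ≤ m + η` and `m = M'`. -/
theorem lintegral_le_of_le_add {T : ℝ} (hT : 0 ≤ T) {b m : ℝ → ℝ} {η : ℝ → ℝ≥0∞}
    (hb : Continuous b) (hb0 : ∀ t, 0 ≤ b t) (hm : IntervalIntegrable m volume 0 T)
    (h : ∀ t, ENNReal.ofReal (b t - m t) ≤ η t) :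
    ∫⁻ t in Icc 0 T, ENNReal.ofReal (b t) ≤
      ENNReal.ofReal (∫ t in 0..T, m t) + ∫⁻ t in Icc 0 T, η t := by
  have hbi : IntegrableOn b (Icc 0 T) := hb.continuousOn.integrableOn_Icc
  rw [intervalIntegrable_iff_integrableOn_Icc_of_le hT] at hm
  have hpos : Integrable (fun t => max (b t - m t) 0) (volume.restrict (Icc 0 T)) :=
    (hbi.sub hm).pos_part
  have h1 : ∫⁻ t in Icc 0 T, ENNReal.ofReal (max (b t - m t) 0) ≤ ∫⁻ t in Icc 0 T, η t :=
    lintegral_mono fun t => by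
      rw [ENNReal.ofReal_max, ENNReal.ofReal_zero, max_eq_left (by simp)]; exact h t
  refine le_trans ?_ (add_le_add_right h1 _)
  rw [← ofReal_integral_eq_lintegral_ofReal hpos (Eventually.of_forall fun _ => le_max_right _ _),
    ← ofReal_integral_eq_lintegral_ofReal hbi (Eventually.of_forall hb0),
    intervalIntegral.integral_of_le hT, ← integral_Icc_eq_integral_Ioc]
  refine (ENNReal.ofReal_le_ofReal ?_).trans ENNReal.ofReal_add_le
  rw [← integral_add hm hpos]
  exact integral_mono hbi (hm.add hpos) fun t => by
    have := le_max_left (b t - m t) 0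
    simp only; linarith

section

open LineDeriv

variable {T : ℝ} {U F : ℝ → L2Plane} (h : IsMildSolution T U F) (hT : 0 ≤ T) (k : 𝓢(Plane, ℂ))

theorem norm_schwartzConvL (k : 𝓢(Plane, ℂ)) (f : L2Plane) :
    ‖schwartzConvL k f‖ = (eLpNorm (schwartzConv k f) 2).toReal := by
  rw [Lp.norm_def, eLpNorm_congr_ae (coeFn_schwartzConvL k f)]

theorem enorm_schwartzConvL (k : 𝓢(Plane, ℂ)) (f : L2Plane) :
    ‖schwartzConvL k f‖ₑ = eLpNorm (schwartzConv k f) 2 := by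
  rw [Lp.enorm_def, eLpNorm_congr_ae (coeFn_schwartzConvL k f)]

theorem interaction_eq_interactionL {θ : ℝ → ℝ} {Y : ℝ} (hθ : Continuous θ) (hY : ∀ r, |θ r| ≤ Y)
    (e : Plane) (f : L2Plane) :
    interaction θ e
        (fun x => 2 * inner ℝ (schwartzConv k f x) (schwartzConv (∂_{e} k) f x))
        (fun x => 2 * inner ℝ (schwartzConv k f x) (schwartzConv (∂_{e} k) f x)) =
      interactionL θ hθ hY e
      ((2 : ℝ) • innerLp (schwartzConvL k f) (schwartzConvL (∂_{e} k) f))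
      ((2 : ℝ) • innerLp (schwartzConvL k f) (schwartzConvL (∂_{e} k) f)) := by
  have h1 : (fun x => 2 * inner ℝ (schwartzConv k f x) (schwartzConv (∂_{e} k) f x))
      =ᵐ[volume] ((2 : ℝ) • innerLp (schwartzConvL k f) (schwartzConvL (∂_{e} k) f) :
        Lp ℝ 1 (volume : Measure Plane)) := by
    filter_upwards [Lp.coeFn_smul (2 : ℝ) (innerLp (schwartzConvL k f)
      (schwartzConvL (∂_{e} k) f)), coeFn_innerLp (schwartzConvL k f)
      (schwartzConvL (∂_{e} k) f), coeFn_schwartzConvL k f,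
      coeFn_schwartzConvL (∂_{e} k) f] with x a1 a2 a3 a4
    rw [a1, Pi.smul_apply, a2, a3, a4, smul_eq_mul]
  rw [interactionL_apply]
  exact interaction_congr_ae h1 h1

theorem abs_interactionL_le {θ : ℝ → ℝ} (hθ : Continuous θ) (hX : ∀ r, |θ r| ≤ 1) (e : Plane)
    (f g : L2Plane) :
    |interactionL θ hθ hX e (innerLp (mulIL f) g) (innerLp f f)| ≤ ‖f‖ ^ 3 * ‖g‖ := by
  have h1 := abs_interaction_le (e := e) hθ hX (L1.integrable_coeFn (innerLp (mulIL f) g))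
    (L1.integrable_coeFn (innerLp f f))
  rw [← L1.norm_eq_integral_norm, ← L1.norm_eq_integral_norm, one_mul] at h1
  rw [interactionL_apply]
  refine h1.trans ((mul_le_mul (norm_innerLp_le _ _) (norm_innerLp_le _ _) (norm_nonneg _)
    (by positivity)).trans (le_of_eq ?_))
  rw [norm_mulIL]; ring

theorem ofReal_mollifierError_term (f F : L2Plane) (e : Plane) :
    ENNReal.ofReal (6 * ((eLpNorm (mollifierError k f F) 2).toReal *
      (eLpNorm (schwartzConv k f) 2).toReal ^ 2 * (eLpNorm (schwartzConv (∂_{e} k) f) 2).toReal)) =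
    6 * (eLpNorm (mollifierError k f F) 2 * eLpNorm (schwartzConv k f) 2 ^ 2 *
      eLpNorm (schwartzConv (∂_{e} k) f) 2) := by
  have h0 : eLpNorm (mollifierError k f F) 2 ≠ ⊤ :=
    ((memLp_schwartzConv k (Lp.memLp F)).sub (memLp_mollifiedCubic k f)).eLpNorm_ne_top
  have h1 := (memLp_schwartzConv k (Lp.memLp f)).eLpNorm_ne_top
  have h2 := (memLp_schwartzConv (∂_{e} k) (Lp.memLp f)).eLpNorm_ne_top
  rw [ENNReal.ofReal_mul (by norm_num), ENNReal.ofReal_mul (by positivity),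
    ENNReal.ofReal_mul (by positivity), ENNReal.ofReal_pow (by positivity),
    ENNReal.ofReal_toReal h0, ENNReal.ofReal_toReal h1, ENNReal.ofReal_toReal h2,
    ENNReal.ofReal_ofNat]

set_option maxHeartbeats 1000000 in
include h hT in
/-- The interaction Morawetz inequality in the direction `e`, with the kernel `gaussKernel b`. -/
theorem IsMildSolution.lintegral_interaction_le {e e' : Plane} (he : ‖e‖ = 1) (he' : ‖e'‖ = 1)
    (hee : inner ℝ e e' = 0) {b : ℝ} (hb : 0 < b) {Q : ℝ≥0∞}
    (hQ : ∀ t ∈ Icc 0 T, eLpNorm (schwartzConv k (U t)) 2 ^ 3 *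
      eLpNorm (schwartzConv (∂_{e} k) (U t)) 2 ≤ Q)
    (hpos : ∀ t, 0 ≤ interaction (gaussKernel b) e
        (fun x => 2 * inner ℝ (schwartzConv k (U t) x) (schwartzConv (∂_{e} k) (U t) x))
        (fun x => 2 * inner ℝ (schwartzConv k (U t) x) (schwartzConv (∂_{e} k) (U t) x))) :
    ∫⁻ t in Icc 0 T, ENNReal.ofReal (interaction (gaussKernel b) e
        (fun x => 2 * inner ℝ (schwartzConv k (U t) x) (schwartzConv (∂_{e} k) (U t) x))
        (fun x => 2 * inner ℝ (schwartzConv k (U t) x) (schwartzConv (∂_{e} k) (U t) x))) ≤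
      2 * Q + 6 * ∫⁻ t in Icc 0 T, eLpNorm (mollifierError k (U t) (F t)) 2 *
        eLpNorm (schwartzConv k (U t)) 2 ^ 2 * eLpNorm (schwartzConv (∂_{e} k) (U t)) 2 := by
  have hd := fun r => hasDerivAt_gaussPrimitive b r
  have hχ : Continuous (gaussPrimitive b) :=
    continuous_iff_continuousAt.2 fun r => (hd r).continuousAt
  have hκ := gaussKernel_continuous b
  have hX := abs_gaussPrimitive_le hb
  have hY := abs_gaussKernel_le hb
  have p0 := isPrimitive_schwartzConvL h.continuous h.integrable h.equation k
  have p1 := isPrimitive_schwartzConvL h.continuous h.integrable h.equation (∂_{e} k)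
  -- the Morawetz functional is the primitive of its formal time derivative
  have pM := ((p0.clm mulIL).bilin p1 hT innerLp).bilin (p0.bilin p0 hT innerLp) hT
    (interactionL (gaussPrimitive b) hχ hX e)
  have hcont : Continuous fun t => interactionL (gaussKernel b) hκ hY e
      ((2 : ℝ) • innerLp (schwartzConvL k (U t)) (schwartzConvL (∂_{e} k) (U t)))
      ((2 : ℝ) • innerLp (schwartzConvL k (U t)) (schwartzConvL (∂_{e} k) (U t))) := by
    have c0 : Continuous fun t => schwartzConvL k (U t) :=
      (schwartzConvL k).continuous.comp h.continuous
    have c1 : Continuous fun t => schwartzConvL (∂_{e} k) (U t) :=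
      (schwartzConvL (∂_{e} k)).continuous.comp h.continuous
    have c2 := (innerLp.continuous₂.comp (c0.prodMk c1)).const_smul (2 : ℝ)
    exact (interactionL (gaussKernel b) hκ hY e).continuous₂.comp (c2.prodMk c2)
  simp_rw [interaction_eq_interactionL k hκ hY] at hpos ⊢
  refine (lintegral_le_of_le_add hT hcont hpos pM.integrable
    (η := fun t => 6 * (eLpNorm (mollifierError k (U t) (F t)) 2 *
        eLpNorm (schwartzConv k (U t)) 2 ^ 2 * eLpNorm (schwartzConv (∂_{e} k) (U t)) 2))
        (fun t => ?_)).trans ?_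
  · have key := interaction_morawetz_mollified k (U t) (F t) hd hχ hκ hX hY (gaussKernel_nonneg b)
      (gaussKernel_neg b) he hee (coeFn_schwartzConvL k (U t)) (coeFn_schwartzConvL _ (U t))
      (coeFn_schwartzConvL_equation k (U t) (F t) he he' hee)
      (coeFn_schwartzConvL_equation (∂_{e} k) (U t) (F t) he he' hee)
    rw [interaction_eq_interactionL k hκ hY, mul_one] at key
    rw [← ofReal_mollifierError_term]
    exact ENNReal.ofReal_le_ofReal (sub_le_comm.1 key)
  rw [lintegral_const_mul' _ _ (by norm_num)]
  refine add_le_add_left ?_ _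
  have hM := pM.eq_add_integral T ⟨hT, le_rfl⟩
  rw [← sub_eq_iff_eq_add'] at hM
  rw [← hM]
  -- the functional at the two endpoints accounts for `2 Q`
  have hbound : ∀ t ∈ Icc 0 T, ENNReal.ofReal |interactionL (gaussPrimitive b) hχ hX e
      (innerLp (mulIL (schwartzConvL k (U t))) (schwartzConvL (∂_{e} k) (U t)))
      (innerLp (schwartzConvL k (U t)) (schwartzConvL k (U t)))| ≤ Q := by
    intro t ht
    refine le_trans ?_ (hQ t ht)
    rw [← enorm_schwartzConvL, ← enorm_schwartzConvL, ← ofReal_norm, ← ofReal_norm,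
      ← ENNReal.ofReal_pow (norm_nonneg _), ← ENNReal.ofReal_mul (by positivity)]
    exact ENNReal.ofReal_le_ofReal (abs_interactionL_le hχ hX e _ _)
  refine (ENNReal.ofReal_le_ofReal ((le_abs_self _).trans (abs_sub _ _))).trans ?_
  refine ENNReal.ofReal_add_le.trans ?_
  rw [two_mul]
  exact add_le_add (hbound T ⟨hT, le_rfl⟩) (hbound 0 ⟨le_rfl, hT⟩)

end

/-! ### The space-time `L⁴` bound -/

theorem continuous_fourier_ofReal (ξ : Plane) :
    Continuous fun a : Lp ℝ 1 (volume : Measure Plane) => 𝓕 (fun x => (a x : ℂ)) ξ := by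
  refine LipschitzWith.continuous (K := 1) (LipschitzWith.of_dist_le_mul fun a c => ?_)
  have ha : Integrable fun x => (a x : ℂ) := (L1.integrable_coeFn a).ofReal
  have hc : Integrable fun x => (c x : ℂ) := (L1.integrable_coeFn c).ofReal
  have h1 : 𝓕 (fun x => (a x : ℂ)) ξ - 𝓕 (fun x => (c x : ℂ)) ξ =
      𝓕 (fun x => (a x : ℂ) - (c x : ℂ)) ξ := by
    simp only [Real.fourier_eq]
    rw [← integral_sub]
    · simp only [smul_sub]
    · exact (Real.fourierIntegral_convergent_iff ξ).2 ha
    · exact (Real.fourierIntegral_convergent_iff ξ).2 hc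
  rw [dist_eq_norm, dist_eq_norm, h1, NNReal.coe_one, one_mul, L1.norm_eq_integral_norm]
  refine (norm_fourier_le _ ξ).trans (le_of_eq (integral_congr_ae ?_))
  filter_upwards [Lp.coeFn_sub a c] with x hx
  rw [hx, Pi.sub_apply, ← Complex.ofReal_sub, Complex.norm_real]

theorem fourier_ofReal_congr_ae {f g : Plane → ℝ} (h : f =ᵐ[volume] g) (ξ : Plane) :
    𝓕 (fun x => (f x : ℂ)) ξ = 𝓕 (fun x => (g x : ℂ)) ξ := by
  simp only [Real.fourier_eq]
  exact integral_congr_ae (h.mono fun x hx => by simp only [hx])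

/-- The exponent `1/3` of `T` balances the two terms of the interpolation inequality. -/
theorem lintegral_le_of_interpolation {T : ℝ} (hT : 0 < T) {g D : ℝ → ℝ≥0∞} {B c : ℝ≥0∞}
    (hD : Measurable D)
    (hg : ∀ t ∈ Icc 0 T, g t ≤ ENNReal.ofReal (T ^ (1 / 3 : ℝ)) * D t +
      ENNReal.ofReal ((T ^ (1 / 3 : ℝ))⁻¹ ^ 2) * c)
    (hB : ∫⁻ t in Icc 0 T, D t ≤ B) :
    ∫⁻ t in Icc 0 T, g t ≤ ENNReal.ofReal (T ^ (1 / 3 : ℝ)) * (B + c) := by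
  have e1 : (T ^ (1 / 3 : ℝ))⁻¹ ^ 2 * T = T ^ (1 / 3 : ℝ) := by
    have h3 : (T ^ (1 / 3 : ℝ)) ^ 3 = T := by
      rw [← Real.rpow_natCast, ← Real.rpow_mul hT.le]; norm_num
    calc (T ^ (1 / 3 : ℝ))⁻¹ ^ 2 * T =
        (T ^ (1 / 3 : ℝ))⁻¹ ^ 2 * (T ^ (1 / 3 : ℝ)) ^ 3 := by rw [h3]
      _ = _ := by field_simp
  calc ∫⁻ t in Icc 0 T, g t
      ≤ ∫⁻ t in Icc 0 T, (ENNReal.ofReal (T ^ (1 / 3 : ℝ)) * D t +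
          ENNReal.ofReal ((T ^ (1 / 3 : ℝ))⁻¹ ^ 2) * c) :=
        setLIntegral_mono' measurableSet_Icc hg
    _ = ENNReal.ofReal (T ^ (1 / 3 : ℝ)) * (∫⁻ t in Icc 0 T, D t) +
          ENNReal.ofReal ((T ^ (1 / 3 : ℝ))⁻¹ ^ 2) * c * ENNReal.ofReal T := by
        rw [lintegral_add_right _ measurable_const, lintegral_const_mul _ hD, setLIntegral_const,
          Real.volume_Icc, sub_zero]
    _ ≤ ENNReal.ofReal (T ^ (1 / 3 : ℝ)) * B + ENNReal.ofReal (T ^ (1 / 3 : ℝ)) * c := by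
        rw [mul_right_comm, ← ENNReal.ofReal_mul (by positivity), e1]
        gcongr
    _ = _ := by rw [mul_add]

section

open LineDeriv

variable {T : ℝ} {U F : ℝ → L2Plane} (k : 𝓢(Plane, ℂ))

/-- The mass density of the mollified function. -/
noncomputable def mollifiedDensity (k : 𝓢(Plane, ℂ)) (f : Plane → ℂ) (x : Plane) : ℝ :=
  ‖schwartzConv k f x‖ ^ 2

theorem mollifiedDensity_ae_eq (f : L2Plane) :
    innerLp (schwartzConvL k f) (schwartzConvL k f) =ᵐ[volume] mollifiedDensity k f := by
  filter_upwards [coeFn_innerLp (schwartzConvL k f) (schwartzConvL k f),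
    coeFn_schwartzConvL k f] with x h1 h2
  rw [h1, h2, real_inner_self_eq_norm_sq, mollifiedDensity]

theorem integrable_mollifiedDensity (f : L2Plane) : Integrable (mollifiedDensity k f) :=
  (L1.integrable_coeFn _).congr (mollifiedDensity_ae_eq k f)

theorem integrable_ofReal_mollifiedDensity (f : L2Plane) :
    Integrable fun x => (mollifiedDensity k f x : ℂ) :=
  (integrable_mollifiedDensity k f).ofReal

theorem memLp_mollifiedDensity (f : L2Plane) :
    MemLp (fun x => (mollifiedDensity k f x : ℂ)) 2 := by
  obtain ⟨B, hB⟩ := exists_norm_schwartzConv_le k f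
  have hm := memLp_schwartzConv k (Lp.memLp f)
  refine MemLp.of_le_mul (c := B) hm
    (integrable_ofReal_mollifiedDensity k f).aestronglyMeasurable
    (Eventually.of_forall fun x => ?_)
  rw [Complex.norm_real, mollifiedDensity, Real.norm_of_nonneg (by positivity), sq]
  gcongr
  exact hB x

theorem measurable_fourier_mollifiedDensity (hU : Continuous U) :
    Measurable (Function.uncurry fun (t : ℝ) (ξ : Plane) =>
      ‖𝓕 (fun x => (mollifiedDensity k (U t) x : ℂ)) ξ‖ₑ ^ 2) := by
  have hW : Continuous fun t => schwartzConvL k (U t) := (schwartzConvL k).continuous.comp hU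
  have hR : Continuous fun t => innerLp (schwartzConvL k (U t)) (schwartzConvL k (U t)) :=
    innerLp.continuous₂.comp (hW.prodMk hW)
  have h1 : ∀ t ξ, 𝓕 (fun x => (mollifiedDensity k (U t) x : ℂ)) ξ = 𝓕 (fun x =>
      ((innerLp (schwartzConvL k (U t)) (schwartzConvL k (U t)) :
        Lp ℝ 1 (volume : Measure Plane)) x : ℂ)) ξ := fun t ξ =>
    fourier_ofReal_congr_ae (mollifiedDensity_ae_eq k (U t)).symm ξ
  have h2 := measurable_uncurry_of_continuous_of_measurable (u := fun (t : ℝ) (ξ : Plane) =>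
      𝓕 (fun x => (mollifiedDensity k (U t) x : ℂ)) ξ) (fun ξ => by
        simp_rw [h1]
        exact (continuous_fourier_ofReal ξ).comp hR) fun t =>
      (VectorFourier.fourierIntegral_continuous Real.continuous_fourierChar continuous_inner
        (integrable_ofReal_mollifiedDensity k (U t))).measurable
  exact h2.enorm.pow_const 2

/-- The interaction Morawetz inequalities in all directions control `∫∫ |ξ| |ρ̂|²`, where `ρ` is the
mass density. -/
theorem IsMildSolution.lintegral_norm_mul_fourier_le (h : IsMildSolution T U F) (hT : 0 ≤ T)
    {Q η : ℝ≥0∞}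
    (hQ : ∀ e : Plane, ‖e‖ = 1 → ∀ t ∈ Icc 0 T, eLpNorm (schwartzConv k (U t)) 2 ^ 3 *
      eLpNorm (schwartzConv (∂_{e} k) (U t)) 2 ≤ Q)
    (hη : ∀ e : Plane, ‖e‖ = 1 → ∫⁻ t in Icc 0 T, eLpNorm (mollifierError k (U t) (F t)) 2 *
        eLpNorm (schwartzConv k (U t)) 2 ^ 2 * eLpNorm (schwartzConv (∂_{e} k) (U t)) 2 ≤ η) :
    ∫⁻ t in Icc 0 T, (∫⁻ ξ, ‖ξ‖ₑ * ‖𝓕 (fun x => (mollifiedDensity k (U t) x : ℂ)) ξ‖ₑ ^ 2) ≤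
      (2 * Q + 6 * η) * (volume : Measure Plane).toSphere univ := by
  refine lintegral_norm_mul_le_of_lines (measurable_fourier_mollifiedDensity k h.continuous)
    fun b hb e he => ?_
  have hρ := fun t => integrable_mollifiedDensity k (U t)
  have hρ1 : ∀ t, Integrable fun x =>
      2 * (inner ℝ (schwartzConv k (U t) x) (schwartzConv (∂_{e} k) (U t) x) : ℝ) := fun t =>
    (integrable_inner_real (memLp_schwartzConv k (Lp.memLp (U t)))
      (memLp_schwartzConv (∂_{e} k) (Lp.memLp (U t)))).const_mul 2
  have hd : ∀ t x, HasLineDerivAt ℝ (mollifiedDensity k (U t))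
      (2 * (inner ℝ (schwartzConv k (U t) x) (schwartzConv (∂_{e} k) (U t) x) : ℝ)) x e := by
    intro t x
    have hD := schwartzConv_hasLineDerivAt k (Lp.memLp (U t)) x e
    have h1 := hD.inner_real hD
    rw [real_inner_comm (schwartzConv k (U t) x) (schwartzConv (∂_{e} k) (U t) x), ← two_mul] at h1
    have h3 : mollifiedDensity k (U t) = fun x =>
        (inner ℝ (schwartzConv k (U t) x) (schwartzConv k (U t) x) : ℝ) := by
      ext x; rw [mollifiedDensity, real_inner_self_eq_norm_sq]
    rw [h3]
    exact h1
  have hpos : ∀ t, 0 ≤ interaction (gaussKernel b) e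
      (fun x => 2 * inner ℝ (schwartzConv k (U t) x) (schwartzConv (∂_{e} k) (U t) x))
      (fun x => 2 * inner ℝ (schwartzConv k (U t) x) (schwartzConv (∂_{e} k) (U t) x)) :=
          fun t => by
    rw [interaction_gaussKernel hb e (hρ1 t)]
    exact integral_nonneg fun σ => by positivity
  refine (exists_orthonormal_complement he).elim fun e' he' => ?_
  have key := h.lintegral_interaction_le hT k he he'.1 he'.2 hb (hQ e he) hpos
  simp_rw [fun t => ofReal_interaction_gaussKernel hb he (hρ t) (hρ1 t) (hd t)] at key
  refine key.trans ?_
  gcongr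
  exact hη e he

/-- The interaction Morawetz inequality, integrated over all directions and interpolated with the
conservation of mass, bounds the space-time `L⁴` norm. -/
theorem IsMildSolution.lintegral_eLpNorm_four_le (h : IsMildSolution T U F) (hT : 0 < T)
    {Q η m : ℝ≥0∞}
    (hQ : ∀ e : Plane, ‖e‖ = 1 → ∀ t ∈ Icc 0 T, eLpNorm (schwartzConv k (U t)) 2 ^ 3 *
      eLpNorm (schwartzConv (∂_{e} k) (U t)) 2 ≤ Q)
    (hη : ∀ e : Plane, ‖e‖ = 1 → ∫⁻ t in Icc 0 T, eLpNorm (mollifierError k (U t) (F t)) 2 *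
        eLpNorm (schwartzConv k (U t)) 2 ^ 2 * eLpNorm (schwartzConv (∂_{e} k) (U t)) 2 ≤ η)
    (hm : ∀ t ∈ Icc 0 T, eLpNorm (schwartzConv k (U t)) 2 ≤ m) :
    ∫⁻ t in Icc 0 T, eLpNorm (schwartzConv k (U t)) 4 ^ 4 ≤
      ENNReal.ofReal (T ^ (1 / 3 : ℝ)) * ((2 * Q + 6 * η) * (volume : Measure Plane).toSphere univ +
        volume (Metric.ball (0 : Plane) 1) * m ^ 4) := by
  have hM : 0 < T ^ (1 / 3 : ℝ) := by positivity
  have h4 : ∀ t, eLpNorm (schwartzConv k (U t)) 4 ^ 4 =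
      ∫⁻ x, ‖(mollifiedDensity k (U t) x : ℂ)‖ₑ ^ 2 := by
    intro t
    have := eLpNorm_nnreal_pow_eq_lintegral (f := schwartzConv k (U t)) (p := 4)
      (μ := (volume : Measure Plane)) (by norm_num)
    norm_num at this
    rw [this]
    refine lintegral_congr fun x => ?_
    rw [mollifiedDensity]
    simp only [Complex.ofReal_pow, enorm_pow, ← pow_mul]
    congr 1
    rw [← ofReal_norm, ← ofReal_norm, Complex.norm_real, norm_norm]
  have h1 : ∀ t, ∫⁻ x, ‖(mollifiedDensity k (U t) x : ℂ)‖ₑ =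
      eLpNorm (schwartzConv k (U t)) 2 ^ 2 := by
    intro t
    have := eLpNorm_nnreal_pow_eq_lintegral (f := schwartzConv k (U t)) (p := 2)
      (μ := (volume : Measure Plane)) (by norm_num)
    norm_num at this
    rw [this]
    refine lintegral_congr fun x => ?_
    rw [mollifiedDensity]
    simp only [Complex.ofReal_pow, enorm_pow]
    congr 1
    rw [← ofReal_norm, ← ofReal_norm, Complex.norm_real, norm_norm]
  have hmeas : Measurable fun t =>
      ∫⁻ ξ, ‖ξ‖ₑ * ‖𝓕 (fun x => (mollifiedDensity k (U t) x : ℂ)) ξ‖ₑ ^ 2 := by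
    refine Measurable.lintegral_prod_right' (f := fun q : ℝ × Plane =>
      ‖q.2‖ₑ * ‖𝓕 (fun x => (mollifiedDensity k (U q.1) x : ℂ)) q.2‖ₑ ^ 2) ?_
    exact measurable_snd.enorm.mul (measurable_fourier_mollifiedDensity k h.continuous)
  refine lintegral_le_of_interpolation hT hmeas (fun t ht => ?_)
    (h.lintegral_norm_mul_fourier_le k hT.le hQ hη)
  rw [h4]
  refine (lintegral_enorm_sq_le_interpolation (integrable_ofReal_mollifiedDensity k (U t))
    (memLp_mollifiedDensity k (U t)) hM).trans ?_
  rw [h1, ← pow_mul, mul_assoc]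
  exact add_le_add le_rfl (mul_le_mul_right (mul_le_mul_right (pow_le_pow_left' (hm t ht) _) _) _)

end

/-! ### Conservation of mass -/

theorem IsPrimitive.congr {E : Type*} [NormedAddCommGroup E] [NormedSpace ℝ E] {T : ℝ}
    {P p P' p' : ℝ → E} (h : IsPrimitive T P p) (hP : ∀ t, P t = P' t) (hp : ∀ t, p t = p' t) :
    IsPrimitive T P' p' := by
  rw [← funext hP, ← funext hp]
  exact h

section

open LineDeriv

/-- The integral, as a functional on `L¹`. -/
noncomputable def integralL : Lp ℝ 1 (volume : Measure Plane) →L[ℝ] ℝ := L1.integralCLM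

theorem integralL_apply (a : Lp ℝ 1 (volume : Measure Plane)) : integralL a = ∫ x, a x := by
  rw [integralL, ← L1.integral_eq, L1.integral_eq_integral]

theorem abs_integralL_le (a : Lp ℝ 1 (volume : Measure Plane)) : |integralL a| ≤ ‖a‖ := by
  rw [integralL_apply, L1.norm_eq_integral_norm]
  exact norm_integral_le_integral_norm (⇑a)

theorem integralL_innerLp (f g : L2Plane) :
    integralL (innerLp f g) = ∫ x, (inner ℝ (f x) (g x) : ℝ) := by
  rw [integralL_apply]
  exact integral_congr_ae (coeFn_innerLp f g)

theorem integralL_innerLp_comm (f g : L2Plane) :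
    integralL (innerLp f g) = integralL (innerLp g f) := by
  rw [integralL_innerLp, integralL_innerLp]
  exact integral_congr_ae (Eventually.of_forall fun x => real_inner_comm _ _)

theorem integralL_innerLp_self (f : L2Plane) : integralL (innerLp f f) = ‖f‖ ^ 2 := by
  rw [integralL_innerLp, ← inner_self_eq_norm_sq (𝕜 := ℂ) f, L2.inner_def, ← integral_re
    (L2.integrable_inner f f)]
  refine integral_congr_ae (Eventually.of_forall fun x => ?_)
  simp only [real_inner_self_eq_norm_sq, inner_self_eq_norm_sq]

/-- Integration by parts in the direction `e`. -/
theorem schwartzConvL_lineDeriv_inner_eq_zero (k : 𝓢(Plane, ℂ)) (f : L2Plane) (e : Plane) :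
    ∫ x, (inner ℝ (Complex.I * schwartzConv k f x) (schwartzConv (∂_{e} (∂_{e} k)) f x) : ℝ) =
      0 := by
  have hm : ∀ k : 𝓢(Plane, ℂ), MemLp (schwartzConv k f) 2 := fun k =>
    memLp_schwartzConv k (Lp.memLp f)
  have hI : ∀ k : 𝓢(Plane, ℂ), MemLp (fun x => Complex.I * schwartzConv k f x) 2 := fun k =>
    (hm k).const_mul _
  have hD : ∀ (k : 𝓢(Plane, ℂ)) (x : Plane),
      HasLineDerivAt ℝ (schwartzConv k f) (schwartzConv (∂_{e} k) f x) x e := fun k x =>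
    schwartzConv_hasLineDerivAt k (Lp.memLp f) x e
  have key : ∫ x, (inner ℝ (Complex.I * schwartzConv k f x)
      (schwartzConv (∂_{e} (∂_{e} k)) f x) : ℝ) =
      -∫ x, (inner ℝ (Complex.I * schwartzConv (∂_{e} k) f x)
        (schwartzConv (∂_{e} k) f x) : ℝ) :=
    integral_bilinear_hasLineDerivAt_right_eq_neg_left_of_integrable
    (μ := (volume : Measure Plane)) (B := innerSL ℝ (E := ℂ)) (v := e)
    (f := fun x => Complex.I * schwartzConv k f x)
    (f' := fun x => Complex.I * schwartzConv (∂_{e} k) f x)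
    (g := schwartzConv (∂_{e} k) f) (g' := schwartzConv (∂_{e} (∂_{e} k)) f)
    (integrable_inner_real (hI _) (hm _)) (integrable_inner_real (hI _) (hm _))
    (integrable_inner_real (hI _) (hm _))
    (fun x _ => HasDerivAt.const_mul Complex.I (hD k x)) (fun x _ => hD _ x)
  simp only [inner_I_mul_self, integral_zero, neg_zero] at key
  exact key

/-- The Laplacian does not contribute to the time derivative of the mass. -/
theorem integralL_innerLp_laplacian (k : 𝓢(Plane, ℂ)) (f : L2Plane) :
    integralL (innerLp (schwartzConvL k f) (Complex.I • schwartzConvL (Δ k) f)) = 0 := by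
  have he : ‖(EuclideanSpace.single 0 1 : Plane)‖ = 1 := by simp
  refine (exists_orthonormal_complement he).elim fun e' he' => ?_
  rw [integralL_innerLp]
  have hm : ∀ k : 𝓢(Plane, ℂ), MemLp (schwartzConv k f) 2 := fun k =>
    memLp_schwartzConv k (Lp.memLp f)
  have hI : MemLp (fun x => Complex.I * schwartzConv k f x) 2 := (hm k).const_mul _
  have h1 : (fun x => (inner ℝ (schwartzConvL k f x)
      ((Complex.I • schwartzConvL (Δ k) f : L2Plane) x) : ℝ)) =ᵐ[volume] fun x =>
      -((inner ℝ (Complex.I * schwartzConv k f x) (schwartzConv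
        (∂_{(EuclideanSpace.single 0 1 : Plane)} (∂_{(EuclideanSpace.single 0 1 : Plane)} k)) f x) :
          ℝ)
        + inner ℝ (Complex.I * schwartzConv k f x) (schwartzConv (∂_{e'} (∂_{e'} k)) f x)) := by
    filter_upwards [coeFn_schwartzConvL k f, coeFn_schwartzConvL (Δ k) f,
      Lp.coeFn_smul Complex.I (schwartzConvL (Δ k) f)] with x a1 a2 a3
    rw [a1, a3, Pi.smul_apply, a2, laplacian_eq_of_orthonormal he he'.1 he'.2,
      schwartzConv_add_left _ _ (Lp.memLp f), smul_eq_mul, inner_I_mul, Pi.add_apply,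
      inner_add_right]
  rw [integral_congr_ae h1, integral_neg, integral_add (integrable_inner_real hI (hm _))
    (integrable_inner_real hI (hm _)), schwartzConvL_lineDeriv_inner_eq_zero,
    schwartzConvL_lineDeriv_inner_eq_zero]
  simp

theorem norm_schwartzConvL_le {b : 𝓢(Plane, ℂ)} {C : ℝ} (hC : ∀ ξ, ‖b ξ‖ ≤ C) (f : L2Plane) :
    ‖schwartzConvL (𝓕⁻ b) f‖ ≤ C * ‖f‖ := by
  have hC0 : 0 ≤ C := (norm_nonneg _).trans (hC 0)
  rw [norm_schwartzConvL, eLpNorm_schwartzConv_two, ← Lp.norm_fourier_eq f, Lp.norm_def]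
  have h1 := eLpNorm_le_mul_eLpNorm_of_ae_le_mul (p := 2) (μ := (volume : Measure Plane))
    (f := fun ξ => b ξ * (𝓕 f : L2Plane) ξ) (g := (𝓕 f : L2Plane)) (c := C)
    (Eventually.of_forall fun ξ => by
      rw [norm_mul]; gcongr; exact hC ξ)
  refine (ENNReal.toReal_mono (ENNReal.mul_ne_top (by simp) (Lp.eLpNorm_ne_top _)) h1).trans ?_
  rw [ENNReal.toReal_mul, ENNReal.toReal_ofReal hC0]

theorem tendsto_schwartzConvL {b : ℕ → 𝓢(Plane, ℂ)} {σ : Plane → ℂ} {C : ℝ}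
    (hC : ∀ J ξ, ‖b J ξ‖ ≤ C) (hlim : ∀ ξ, Tendsto (fun J => b J ξ) atTop (𝓝 (σ ξ)))
    {f g : L2Plane} (hg : ∀ᵐ ξ, (𝓕 g : L2Plane) ξ = σ ξ * (𝓕 f : L2Plane) ξ) :
    Tendsto (fun J => schwartzConvL (𝓕⁻ (b J)) f) atTop (𝓝 g) := by
  rw [Lp.tendsto_Lp_iff_tendsto_eLpNorm']
  have h1 : ∀ J, eLpNorm (⇑(schwartzConvL (𝓕⁻ (b J)) f) - ⇑g) 2 =
      eLpNorm (schwartzConv (𝓕⁻ (b J)) f - ⇑g) 2 := fun J =>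
    eLpNorm_congr_ae ((coeFn_schwartzConvL _ f).sub EventuallyEq.rfl)
  simp_rw [h1]
  exact tendsto_schwartzConv hC hlim hg

/-- A sequence of multipliers that converges to the identity. -/
noncomputable def freqCutoff (J : ℕ) : 𝓢(Plane, ℂ) :=
  (isTestSymbol_freqBump (a := ((2 : ℝ) ^ (J + 1))⁻¹) (by positivity)).toSchwartz

theorem norm_freqCutoff_le (J : ℕ) (ξ : Plane) : ‖freqCutoff J ξ‖ ≤ 1 := by
  rw [freqCutoff, IsTestSymbol.toSchwartz_apply, Complex.norm_real, Real.norm_of_nonneg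
    freqBump.nonneg]
  exact freqBump.le_one

theorem tendsto_freqBump_smul (ξ : Plane) :
    Tendsto (fun J : ℕ => (freqBump (((2 : ℝ) ^ (J + 1))⁻¹ • ξ) : ℂ)) atTop (𝓝 1) := by
  have h1 : Tendsto (fun J : ℕ => ((2 : ℝ) ^ (J + 1))⁻¹ • ξ) atTop (𝓝 0) := by
    have h2 : Tendsto (fun J : ℕ => ((2 : ℝ) ^ (J + 1))⁻¹) atTop (𝓝 0) :=
      tendsto_inv_atTop_zero.comp
        ((tendsto_pow_atTop_atTop_of_one_lt one_lt_two).comp (tendsto_add_atTop_nat 1))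
    simpa using h2.smul_const ξ
  have h4 := (Complex.continuous_ofReal.comp freqBump.continuous).tendsto (0 : Plane)
  rw [Function.comp_apply, freqBump_eq_one (z := 0) (by simp), Complex.ofReal_one] at h4
  exact h4.comp h1

theorem tendsto_freqCutoff (f : L2Plane) :
    Tendsto (fun J => schwartzConvL (𝓕⁻ (freqCutoff J)) f) atTop (𝓝 f) :=
  tendsto_schwartzConvL norm_freqCutoff_le tendsto_freqBump_smul
    (Eventually.of_forall fun _ => (one_mul _).symm)

theorem integralL_innerLp_add_comm (f g : L2Plane) :
    integralL (innerLp g f + innerLp f g) = 2 * integralL (innerLp f g) := by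
  have h1 : integralL (innerLp g f + innerLp f g) =
      integralL (innerLp g f) + integralL (innerLp f g) := integralL.map_add _ _
  linarith [integralL_innerLp_comm g f]

theorem integralL_innerLp_equation (k : 𝓢(Plane, ℂ)) (f g : L2Plane) :
    integralL (innerLp (schwartzConvL k f) (Complex.I •
      (schwartzConvL (Δ k) f - schwartzConvL k g))) =
      -integralL (innerLp (schwartzConvL k f) (mulIL (schwartzConvL k g))) := by
  have h1 : innerLp (schwartzConvL k f) (Complex.I •
      (schwartzConvL (Δ k) f - schwartzConvL k g)) =
      innerLp (schwartzConvL k f) (Complex.I • schwartzConvL (Δ k) f) -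
        innerLp (schwartzConvL k f) (mulIL (schwartzConvL k g)) := by
    rw [mulIL_apply, smul_sub]
    exact (innerLp (schwartzConvL k f)).map_sub _ _
  rw [h1]
  refine (integralL.map_sub _ _).trans ?_
  rw [integralL_innerLp_laplacian, zero_sub]

variable {T : ℝ} {U F : ℝ → L2Plane}

/-- The mass of a mollified solution. -/
theorem IsMildSolution.norm_sq_schwartzConvL (h : IsMildSolution T U F) (hT : 0 ≤ T)
    (k : 𝓢(Plane, ℂ)) :
    IsPrimitive T (fun t => ‖schwartzConvL k (U t)‖ ^ 2) (fun t =>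
      -2 * integralL (innerLp (schwartzConvL k (U t)) (mulIL (schwartzConvL k (F t))))) := by
  have p0 := isPrimitive_schwartzConvL h.continuous h.integrable h.equation k
  have pM := (p0.bilin p0 hT innerLp).clm integralL
  refine pM.congr (fun t => integralL_innerLp_self _) fun t => ?_
  refine (integralL_innerLp_add_comm _ _).trans ?_
  rw [integralL_innerLp_equation]
  ring

theorem integralL_innerLp_mulIL_cubic {f g : L2Plane}
    (hg : g =ᵐ[volume] fun x => ((‖f x‖ ^ 2 : ℝ) : ℂ) * f x) :
    integralL (innerLp f (mulIL g)) = 0 := by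
  rw [integralL_innerLp]
  refine integral_eq_zero_of_ae ?_
  filter_upwards [hg, coeFn_mulIL g] with x h1 h2
  rw [h2, h1, inner_I_mul, ← Complex.real_smul, inner_smul_right, inner_I_mul_self]
  simp

/-- Conservation of mass. The mass of the mollified solution changes only through the commutator of
the mollification with the nonlinearity, which vanishes in the limit. -/
theorem IsMildSolution.norm_eq (h : IsMildSolution T U F) (hT : 0 ≤ T) {t : ℝ}
    (ht : t ∈ Icc 0 T) : ‖U t‖ = ‖U 0‖ := by
  obtain ⟨M, hM⟩ := isCompact_Icc.exists_bound_of_continuousOn (h.continuous.continuousOn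
    (s := Icc 0 T))
  have hM0 : 0 ≤ M := (norm_nonneg _).trans (hM 0 ⟨le_rfl, hT⟩)
  have hF := h.integrable
  have hS : ∀ J f, ‖schwartzConvL (𝓕⁻ (freqCutoff J)) f‖ ≤ ‖f‖ := fun J f => by
    simpa using norm_schwartzConvL_le (norm_freqCutoff_le J) f
  have hsub : uIoc 0 t ⊆ Icc 0 T := by
    rw [uIoc_of_le ht.1]; exact fun x hx => ⟨hx.1.le, hx.2.trans ht.2⟩
  have hlim := intervalIntegral.tendsto_integral_filter_of_dominated_convergence
    (μ := volume) (a := 0) (b := t) (l := atTop)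
    (F := fun (J : ℕ) τ => -2 * integralL (innerLp (schwartzConvL (𝓕⁻ (freqCutoff J)) (U τ))
      (mulIL (schwartzConvL (𝓕⁻ (freqCutoff J)) (F τ))))) (f := fun _ => 0)
    (fun τ => 2 * M * ‖F τ‖) (Eventually.of_forall fun J => ?_) (Eventually.of_forall fun J => ?_)
    ?_ ?_
  · have h1 : Tendsto (fun J => ‖schwartzConvL (𝓕⁻ (freqCutoff J)) (U t)‖ ^ 2 -
        ‖schwartzConvL (𝓕⁻ (freqCutoff J)) (U 0)‖ ^ 2) atTop (𝓝 (‖U t‖ ^ 2 - ‖U 0‖ ^ 2)) :=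
      ((tendsto_freqCutoff (U t)).norm.pow 2).sub ((tendsto_freqCutoff (U 0)).norm.pow 2)
    have h2 := tendsto_nhds_unique (h1.congr fun J => by
      rw [(h.norm_sq_schwartzConvL hT (𝓕⁻ (freqCutoff J))).eq_add_integral t ht,
        add_sub_cancel_left]) hlim
    rw [intervalIntegral.integral_zero, sub_eq_zero] at h2
    exact (pow_left_inj₀ (norm_nonneg _) (norm_nonneg _) two_ne_zero).1 h2
  · have := ((h.norm_sq_schwartzConvL hT (𝓕⁻ (freqCutoff J))).intervalIntegrable_zero ht)
    exact this.def'.aestronglyMeasurable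
  · refine Eventually.of_forall fun τ hτ => ?_
    rw [norm_mul, norm_neg, Real.norm_ofNat, mul_assoc]
    gcongr
    refine (abs_integralL_le _).trans ((norm_innerLp_le _ _).trans ?_)
    rw [norm_mulIL]
    exact mul_le_mul ((hS J _).trans (hM τ (hsub hτ))) (hS J _) (norm_nonneg _) hM0
  · exact ((hF.mono_set (by
      rw [uIcc_of_le ht.1, uIcc_of_le hT]; exact Icc_subset_Icc_right ht.2)).norm.const_mul _)
  · have h3 := (ae_restrict_iff' measurableSet_Icc).1 h.nonlinearity
    filter_upwards [h3] with τ hτ hm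
    have h4 := integralL_innerLp_mulIL_cubic (hτ (hsub hm))
    have h5 : Tendsto (fun J => -2 * integralL (innerLp (schwartzConvL (𝓕⁻ (freqCutoff J)) (U τ))
      (mulIL (schwartzConvL (𝓕⁻ (freqCutoff J)) (F τ))))) atTop
        (𝓝 (-2 * integralL (innerLp (U τ) (mulIL (F τ))))) := by
      refine Tendsto.const_mul _ ((integralL.continuous.tendsto _).comp ?_)
      exact (innerLp.continuous₂.tendsto (U τ, mulIL (F τ))).comp
        ((tendsto_freqCutoff (U τ)).prodMk_nhds
          ((mulIL.continuous.tendsto _).comp (tendsto_freqCutoff (F τ))))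
    rw [h4, mul_zero] at h5
    exact h5

end

/-! ### The multipliers `I_N` and `⟨D⟩ I_N` -/

section

variable {s : ℝ} {φ : ℝ → ℝ}

theorem eLpNorm_fourier (f : L2Plane) : eLpNorm (𝓕 f : L2Plane) 2 = eLpNorm f 2 := by
  rw [← Lp.enorm_def, ← Lp.enorm_def, ← ofReal_norm, ← ofReal_norm, Lp.norm_fourier_eq]

theorem fourier_fourierMul {σ : Plane → ℝ} {f : L2Plane} (h : MemLp (symbolMul σ f) 2) :
    (𝓕 (fourierMul σ f) : L2Plane) =ᵐ[volume] symbolMul σ f := by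
  rw [fourierMul, dif_pos h, FourierTransform.fourier_fourierInv_eq]
  exact h.coeFn_toLp

theorem aestronglyMeasurable_symbolMul {σ : Plane → ℝ} (hσ : Continuous σ) (f : L2Plane) :
    AEStronglyMeasurable (symbolMul σ f) :=
  (Continuous.aestronglyMeasurable (by fun_prop)).mul (Lp.aestronglyMeasurable _)

theorem continuous_japaneseBracket : Continuous japaneseBracket := by
  unfold japaneseBracket; fun_prop

theorem one_le_japaneseBracket (z : Plane) : 1 ≤ japaneseBracket z := by
  rw [japaneseBracket, Real.one_le_sqrt]
  have := sq_nonneg ‖z‖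
  linarith

theorem norm_le_japaneseBracket (z : Plane) : ‖z‖ ≤ japaneseBracket z :=
  Real.le_sqrt_of_sq_le (by linarith)

/-- The `H^s` norm dominates the `L²` norm. -/
theorem enorm_le_sobolevNorm (hs0 : 0 ≤ s) (f : L2Plane) : ‖f‖ₑ ≤ sobolevNorm s f := by
  rw [Lp.enorm_def, ← eLpNorm_fourier]
  refine eLpNorm_mono fun ξ => ?_
  rw [symbolMul, norm_mul, Complex.norm_real]
  refine le_mul_of_one_le_left (norm_nonneg _) ?_
  exact (Real.one_le_rpow (one_le_japaneseBracket _) hs0).trans (le_abs_self _)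

theorem IsIProfile.exists_le (hs1 : s < 1) (hφ : IsIProfile s φ) :
    ∃ M : ℝ≥0, 1 ≤ M ∧ ∀ r, φ r ≤ M := by
  obtain ⟨C, hC⟩ := (isCompact_Icc (a := (1 : ℝ)) (b := 2)).exists_bound_of_continuousOn
    hφ.smooth.continuous.continuousOn
  refine ⟨max 1 C.toNNReal, le_max_left _ _, fun r => ?_⟩
  rw [NNReal.coe_max, NNReal.coe_one, Real.coe_toNNReal']
  rcases le_total r 1 with h1 | h1
  · rw [hφ.eq_one r h1]; exact le_max_left _ _
  rcases le_or_gt r 2 with h2 | h2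
  · exact (le_abs_self _).trans ((hC r ⟨h1, h2⟩).trans ((le_max_left _ _).trans (le_max_right _ _)))
  · rw [hφ.eq_rpow r h2]
    exact (Real.rpow_le_one_of_one_le_of_nonpos h1 (by linarith)).trans (le_max_left _ _)

/-- For fixed `N`, the multiplier `⟨D⟩ I_N` is of order `s`. -/
theorem IsIProfile.exists_bracket_le (hs0 : 0 < s) (hs1 : s < 1) (hφ : IsIProfile s φ) {N : ℝ}
    (hN : 1 ≤ N) :
    ∃ C : ℝ, ∀ z : Plane, japaneseBracket z * φ (‖z‖ / N) ≤ C * japaneseBracket z ^ s := by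
  obtain ⟨M, hM1, hM⟩ := hφ.exists_le hs1
  have hN0 : 0 < N := by linarith
  refine ⟨max (√(1 + (2 * N) ^ 2) * M) (2 * N), fun z => ?_⟩
  have hj := japaneseBracket_pos z
  have hj1 := one_le_japaneseBracket z
  have hjs : japaneseBracket z = japaneseBracket z ^ (1 - s) * japaneseBracket z ^ s := by
    rw [← Real.rpow_add hj]; simp
  have hfac : 0 ≤ japaneseBracket z ^ s := by positivity
  suffices h : japaneseBracket z ^ (1 - s) * φ (‖z‖ / N) ≤ max (√(1 + (2 * N) ^ 2) * M) (2 * N) by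
    calc japaneseBracket z * φ (‖z‖ / N) =
        (japaneseBracket z ^ (1 - s) * φ (‖z‖ / N)) * japaneseBracket z ^ s := by
          rw [mul_right_comm, ← hjs]
      _ ≤ _ := by gcongr
  rcases le_or_gt (‖z‖ / N) 2 with h | h
  · refine le_trans ?_ (le_max_left _ _)
    have h1 : ‖z‖ ≤ 2 * N := (div_le_iff₀ hN0).1 h
    have h2 : japaneseBracket z ^ (1 - s) ≤ √(1 + (2 * N) ^ 2) := by
      refine (Real.rpow_le_rpow_of_exponent_le hj1 (by linarith : 1 - s ≤ 1)).trans ?_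
      rw [Real.rpow_one, japaneseBracket]
      gcongr
    exact mul_le_mul h2 (hM _) (hφ.pos _).le (Real.sqrt_nonneg _)
  · refine le_trans ?_ (le_max_right _ _)
    rw [hφ.eq_rpow _ h]
    have h1 : 2 * N < ‖z‖ := (lt_div_iff₀ hN0).1 h
    have h2 : japaneseBracket z ≤ 2 * N * (‖z‖ / N) := by
      have : 2 * N * (‖z‖ / N) = 2 * ‖z‖ := by field_simp
      rw [this, japaneseBracket, Real.sqrt_le_left (by positivity)]
      nlinarith
    have h3 : 0 < ‖z‖ / N := by linarith
    calc japaneseBracket z ^ (1 - s) * (‖z‖ / N) ^ (s - 1)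
        ≤ (2 * N * (‖z‖ / N)) ^ (1 - s) * (‖z‖ / N) ^ (s - 1) := by
          gcongr
      _ = (2 * N) ^ (1 - s) * ((‖z‖ / N) ^ (1 - s) * (‖z‖ / N) ^ (s - 1)) := by
          rw [Real.mul_rpow (by positivity) h3.le, mul_assoc]
      _ = (2 * N) ^ (1 - s) := by
          rw [← Real.rpow_add h3]; simp
      _ ≤ (2 * N) ^ (1 : ℝ) :=
          Real.rpow_le_rpow_of_exponent_le (by linarith) (by linarith)
      _ = _ := Real.rpow_one _

theorem IsIProfile.continuous (hφ : IsIProfile s φ) : Continuous φ := hφ.smooth.continuous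

theorem fourier_iOperator (hs1 : s < 1) (hφ : IsIProfile s φ) (N : ℝ) (f : L2Plane) :
    (𝓕 (iOperator φ N f) : L2Plane) =ᵐ[volume] fun ξ =>
      (φ (‖(2 * Real.pi) • ξ‖ / N) : ℂ) * (𝓕 f : L2Plane) ξ := by
  obtain ⟨M, -, hM⟩ := hφ.exists_le hs1
  refine fourier_fourierMul ?_
  refine MemLp.of_le_mul (c := M) (Lp.memLp (𝓕 f : L2Plane)) (aestronglyMeasurable_symbolMul
    (hφ.continuous.comp (by fun_prop)) f) (Eventually.of_forall fun ξ => ?_)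
  rw [symbolMul, norm_mul, Complex.norm_real, Real.norm_of_nonneg (hφ.pos _).le]
  gcongr
  exact hM _

/-- For `f ∈ H^s` the operator `⟨D⟩ I_N` does not take its junk value. -/
theorem fourier_bracket_iOperator (hs0 : 0 < s) (hs1 : s < 1) (hφ : IsIProfile s φ) {N : ℝ}
    (hN : 1 ≤ N) {f : L2Plane} (hf : sobolevNorm s f < ⊤) :
    ∀ᵐ ξ, (𝓕 (fourierMul japaneseBracket (iOperator φ N f)) : L2Plane) ξ =
      (bracketISymbol φ N ξ : ℂ) * (𝓕 f : L2Plane) ξ := by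
  obtain ⟨C, hC⟩ := hφ.exists_bracket_le hs0 hs1 hN
  have e1 : symbolMul japaneseBracket (iOperator φ N f) =ᵐ[volume] fun ξ =>
      (bracketISymbol φ N ξ : ℂ) * (𝓕 f : L2Plane) ξ := by
    filter_upwards [fourier_iOperator hs1 hφ N f] with ξ h1
    rw [symbolMul, h1, bracketISymbol]
    push_cast
    ring
  have hm : MemLp (symbolMul japaneseBracket (iOperator φ N f)) 2 := by
    have hg : MemLp (symbolMul (fun ξ => japaneseBracket ξ ^ s) f) 2 :=
      ⟨aestronglyMeasurable_symbolMul (continuous_japaneseBracket.rpow_const fun z =>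
        Or.inl (japaneseBracket_pos z).ne') f, hf⟩
    refine MemLp.of_le_mul (c := C) hg
      (aestronglyMeasurable_symbolMul continuous_japaneseBracket _) ?_
    filter_upwards [e1] with ξ h1
    have hp := japaneseBracket_pos ((2 * Real.pi) • ξ)
    rw [h1, symbolMul, norm_mul, norm_mul, Complex.norm_real, Complex.norm_real, bracketISymbol,
      Real.norm_of_nonneg (mul_pos hp (hφ.pos _)).le, Real.norm_of_nonneg (by positivity),
      ← mul_assoc]
    exact mul_le_mul_of_nonneg_right (hC _) (norm_nonneg _)
  exact (fourier_fourierMul hm).trans e1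

section Truncated

open LineDeriv

variable {N : ℝ}

theorem norm_truncSymbol_le (hφ : IsIProfile s φ) (hN : 1 ≤ N) (J : ℕ) (ξ : Plane) :
    ‖truncSymbol hφ hN J ξ‖ ≤ φ (‖(2 * Real.pi) • ξ‖ / N) := by
  rw [truncSymbol_apply, iSymbol, ← norm_two_pi_smul_div hN, Complex.norm_real,
    Real.norm_of_nonneg (mul_nonneg (hφ.pos _).le freqBump.nonneg)]
  exact mul_le_of_le_one_right (hφ.pos _).le freqBump.le_one

theorem tendsto_truncSymbol (hφ : IsIProfile s φ) (hN : 1 ≤ N) (ξ : Plane) :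
    Tendsto (fun J => truncSymbol hφ hN J ξ) atTop (𝓝 (φ (‖(2 * Real.pi) • ξ‖ / N) : ℂ)) := by
  have h := (tendsto_freqBump_smul ((2 * Real.pi / N) • ξ)).const_mul
    (φ (‖(2 * Real.pi) • ξ‖ / N) : ℂ)
  rw [mul_one] at h
  refine h.congr fun J => ?_
  rw [truncSymbol_apply, iSymbol, ← norm_two_pi_smul_div hN]
  push_cast
  rfl

/-- The truncated operators converge strongly to `I_N`. -/
theorem tendsto_truncKernel (hs1 : s < 1) (hφ : IsIProfile s φ) (hN : 1 ≤ N) (f : L2Plane) :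
    Tendsto (fun J => schwartzConvL (truncKernel hφ hN J) f) atTop (𝓝 (iOperator φ N f)) := by
  obtain ⟨M, -, hM⟩ := hφ.exists_le hs1
  exact tendsto_schwartzConvL (fun J ξ => (norm_truncSymbol_le hφ hN J ξ).trans (hM _))
    (tendsto_truncSymbol hφ hN) (fourier_iOperator hs1 hφ N f)

theorem eLpNorm_truncKernel_le (hφ : IsIProfile s φ) (hN : 1 ≤ N) (J : ℕ) (f : L2Plane) {M : ℝ≥0}
    (hM : ∀ r, φ r ≤ M) :
    eLpNorm (schwartzConv (truncKernel hφ hN J) f) 2 ≤ M * ‖f‖ₑ := by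
  rw [← enorm_schwartzConvL, ← ofReal_norm, ← ofReal_norm, ← ENNReal.ofReal_coe_nnreal,
    ← ENNReal.ofReal_mul (NNReal.coe_nonneg M)]
  exact ENNReal.ofReal_le_ofReal
    (norm_schwartzConvL_le (fun ξ => (norm_truncSymbol_le hφ hN J ξ).trans (hM _)) f)

theorem eLpNorm_truncKernel_le_bracket (hφ : IsIProfile s φ) (hN : 1 ≤ N) (J : ℕ) {f v : L2Plane}
    (hv : ∀ᵐ ξ, (𝓕 v : L2Plane) ξ = (bracketISymbol φ N ξ : ℂ) * (𝓕 f : L2Plane) ξ) :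
    eLpNorm (schwartzConv (truncKernel hφ hN J) f) 2 ≤ eLpNorm v 2 := by
  rw [truncKernel, eLpNorm_schwartzConv_two, ← eLpNorm_fourier v]
  refine eLpNorm_mono_ae (hv.mono fun ξ h1 => ?_)
  rw [h1, norm_mul, norm_mul]
  gcongr
  refine (norm_truncSymbol_le hφ hN J ξ).trans ?_
  rw [bracketISymbol, Complex.norm_real]
  exact (le_mul_of_one_le_left (hφ.pos _).le (one_le_japaneseBracket _)).trans (le_abs_self _)

theorem eLpNorm_deriv_truncKernel (hφ : IsIProfile s φ) (hN : 1 ≤ N) (J : ℕ) (f : L2Plane)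
    (e : Plane) :
    ∃ σ : Plane → ℂ, (∀ ξ, ‖σ ξ‖ ≤ ‖e‖ * (‖(2 * Real.pi) • ξ‖ * φ (‖(2 * Real.pi) • ξ‖ / N))) ∧
    eLpNorm (schwartzConv (∂_{e} (truncKernel hφ hN J)) f) 2 =
      eLpNorm (fun ξ => σ ξ * (𝓕 f : L2Plane) ξ) 2 := by
  rw [truncKernel, SchwartzMap.lineDerivOp_fourierInv_eq]
  refine ⟨_, fun ξ => ?_, eLpNorm_schwartzConv_two _ f⟩
  rw [smul_apply, SchwartzMap.smulLeftCLM_apply_apply (by fun_prop)]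
  have h1 := norm_truncSymbol_le hφ hN J ξ
  have h2 : ‖(inner ℝ ξ e : ℝ)‖ ≤ ‖ξ‖ * ‖e‖ := norm_inner_le_norm ξ e
  have h3 : ‖(2 * Real.pi) • ξ‖ = 2 * Real.pi * ‖ξ‖ := by
    rw [norm_smul, Real.norm_of_nonneg (by positivity)]
  rw [norm_smul, norm_smul]
  have h4 : ‖(2 * Real.pi * Complex.I : ℂ)‖ = 2 * Real.pi := by
    simp [abs_of_pos Real.pi_pos]
  rw [h4, h3]
  rw [h3] at h1
  calc 2 * Real.pi * (‖(inner ℝ ξ e : ℝ)‖ * ‖truncSymbol hφ hN J ξ‖)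
      ≤ 2 * Real.pi * ((‖ξ‖ * ‖e‖) * φ (2 * Real.pi * ‖ξ‖ / N)) := by gcongr
    _ = _ := by ring

theorem eLpNorm_deriv_truncKernel_le_bracket (hφ : IsIProfile s φ) (hN : 1 ≤ N) (J : ℕ)
    {f v : L2Plane}
    (hv : ∀ᵐ ξ, (𝓕 v : L2Plane) ξ = (bracketISymbol φ N ξ : ℂ) * (𝓕 f : L2Plane) ξ) {e : Plane}
    (he : ‖e‖ = 1) :
    eLpNorm (schwartzConv (∂_{e} (truncKernel hφ hN J)) f) 2 ≤ eLpNorm v 2 := by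
  obtain ⟨σ, hσ, h⟩ := eLpNorm_deriv_truncKernel hφ hN J f e
  rw [h, ← eLpNorm_fourier v]
  refine eLpNorm_mono_ae (hv.mono fun ξ h1 => ?_)
  rw [h1, norm_mul, norm_mul]
  gcongr
  refine (hσ ξ).trans ?_
  rw [he, one_mul, bracketISymbol, Complex.norm_real]
  refine le_trans ?_ (le_abs_self _)
  have := (hφ.pos (‖(2 * Real.pi) • ξ‖ / N)).le
  gcongr
  exact norm_le_japaneseBracket _

theorem eLpNorm_deriv_truncKernel_le_homSobolev (hs1 : s < 1) (hφ : IsIProfile s φ) (hN : 1 ≤ N)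
    (J : ℕ) (f : L2Plane) {e : Plane} (he : ‖e‖ = 1) :
    eLpNorm (schwartzConv (∂_{e} (truncKernel hφ hN J)) f) 2 ≤
      homSobolevNormOne (iOperator φ N f) := by
  obtain ⟨σ, hσ, h⟩ := eLpNorm_deriv_truncKernel hφ hN J f e
  rw [h, homSobolevNormOne]
  refine eLpNorm_mono_ae ((fourier_iOperator hs1 hφ N f).mono fun ξ h1 => ?_)
  rw [symbolMul, h1, norm_mul, norm_mul, norm_mul, ← mul_assoc, Complex.norm_real,
    Complex.norm_real, norm_norm, Real.norm_of_nonneg (hφ.pos _).le]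
  gcongr
  simpa [he] using hσ ξ

end Truncated

end

/-! ### Lebesgue norms of curves in `L²` -/

/-- The norms of `L^p` are lower semicontinuous on `L²`, which makes `t ↦ ‖U t‖_p` measurable for
continuous curves in `L²`. -/
theorem lowerSemicontinuous_eLpNorm (p : ℝ≥0∞) :
    LowerSemicontinuous fun f : L2Plane => eLpNorm f p := by
  rw [lowerSemicontinuous_iff_isClosed_preimage]
  intro B
  refine isClosed_of_closure_subset fun f hf => ?_
  obtain ⟨F, hF, hlim⟩ := mem_closure_iff_seq_limit.1 hf
  exact eLpNorm_le_of_tendsto (fun J => Lp.aestronglyMeasurable (F J)) (Lp.aestronglyMeasurable f)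
    ((Lp.tendsto_Lp_iff_tendsto_eLpNorm' F f).1 hlim) hF

theorem measurable_eLpNorm_of_continuous {U : ℝ → L2Plane} (hU : Continuous U) (p : ℝ≥0∞) :
    Measurable fun t => eLpNorm (U t) p :=
  ((lowerSemicontinuous_eLpNorm p).comp hU).measurable

theorem eLpNorm_cubic (f : Plane → ℂ) :
    eLpNorm (fun x => ((‖f x‖ ^ 2 : ℝ) : ℂ) * f x) 2 = eLpNorm f 6 ^ 3 := by
  have h := eLpNorm_norm_rpow (μ := (volume : Measure Plane)) (p := 2) f (q := 3) (by norm_num)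
  have e6 : (2 : ℝ≥0∞) * ENNReal.ofReal 3 = 6 := by
    rw [ENNReal.ofReal_ofNat]; norm_num
  rw [e6] at h
  rw [← ENNReal.rpow_ofNat, ← h]
  refine eLpNorm_congr_norm_ae (Eventually.of_forall fun x => ?_)
  rw [Real.rpow_ofNat, norm_mul, Complex.norm_real, norm_pow, norm_norm, norm_pow, norm_norm]
  ring

theorem mixedNorm_pow_eq_lintegral {p : ℕ} (hp : p ≠ 0) (r : ℝ≥0∞) (J : Set ℝ) (f : ℝ → L2Plane) :
    mixedNorm p r J f ^ p = ∫⁻ t in J, eLpNorm (f t) r ^ p := by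
  have := eLpNorm_nnreal_pow_eq_lintegral (f := fun t => eLpNorm (f t) r (volume : Measure Plane))
    (p := (p : ℝ≥0)) (μ := volume.restrict J) (by exact_mod_cast hp)
  simpa [mixedNorm] using this

theorem mixedNorm_le_strichartzZ (φ : ℝ → ℝ) (N : ℝ) (u : ℝ → L2Plane) (J : Set ℝ) {q r : ℝ≥0∞}
    (h : IsAdmissible q r) :
    mixedNorm q r J (fun t => fourierMul japaneseBracket (iOperator φ N (u t))) ≤
      strichartzZ φ N u J :=
  le_iSup₂_of_le q r (le_iSup_of_le h le_rfl)

/-- The admissible pair `(3, 6)`. -/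
theorem lintegral_le_strichartzZ (φ : ℝ → ℝ) (N : ℝ) (u : ℝ → L2Plane) (J : Set ℝ) :
    ∫⁻ t in J, eLpNorm (fourierMul japaneseBracket (iOperator φ N (u t))) 6 ^ 3 ≤
      strichartzZ φ N u J ^ 3 := by
  rw [← mixedNorm_pow_eq_lintegral (by norm_num) 6 J
    (fun t => fourierMul japaneseBracket (iOperator φ N (u t)))]
  refine pow_le_pow_left' (mixedNorm_le_strichartzZ φ N u J ⟨by norm_num, ?_⟩) 3
  have h6 : (2 : ℝ≥0∞) / 6 = 1 / 3 := by
    rw [ENNReal.div_eq_div_iff] <;> norm_num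
  push_cast
  rw [h6, ENNReal.div_add_div_same]
  norm_num
  exact ENNReal.div_self (by norm_num) (by norm_num)

/-- The admissible pair `(∞, 2)`. -/
theorem ae_le_strichartzZ (φ : ℝ → ℝ) (N : ℝ) (u : ℝ → L2Plane) (J : Set ℝ) :
    ∀ᵐ t ∂volume.restrict J, eLpNorm (fourierMul japaneseBracket (iOperator φ N (u t))) 2 ≤
      strichartzZ φ N u J := by
  have h := mixedNorm_le_strichartzZ φ N u J (q := ⊤) (r := 2)
    ⟨by norm_num, by simp [ENNReal.div_self]⟩
  refine (enorm_ae_le_eLpNormEssSup (fun t => eLpNorm (fourierMul japaneseBracket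
    (iOperator φ N (u t))) 2 (volume : Measure Plane)) (volume.restrict J)).mono fun t ht => ?_
  refine le_trans ?_ h
  simpa [mixedNorm] using ht

/-! ### Partitions -/

theorem Icc_subset_iUnion_Icc_of_monotone {α : Type*} [LinearOrder α] {n : ℕ} (hn : n ≠ 0)
    (τ : Fin (n + 1) → α) :
    Icc (τ 0) (τ (Fin.last n)) ⊆ ⋃ k : Fin n, Icc (τ k.castSucc) (τ k.succ) := by
  intro t ht
  have key : ∀ k : Fin (n + 1), k ≠ 0 → t ≤ τ k →
      t ∈ ⋃ k : Fin n, Icc (τ k.castSucc) (τ k.succ) := by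
    intro k
    induction k using Fin.induction with
    | zero => exact fun h => absurd rfl h
    | succ k ih =>
      intro _ hk
      rcases le_or_gt (τ k.castSucc) t with h | h
      · exact mem_iUnion.2 ⟨k, h, hk⟩
      · refine ih ?_ h.le
        intro h0
        rw [h0] at h
        exact h.not_ge ht.1
  exact key (Fin.last n) (by simpa [Fin.ext_iff] using hn) ht.2

theorem lintegral_Icc_le_sum {n : ℕ} (hn : n ≠ 0) (τ : Fin (n + 1) → ℝ) (f : ℝ → ℝ≥0∞) :
    ∫⁻ t in Icc (τ 0) (τ (Fin.last n)), f t ≤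
      ∑ k : Fin n, ∫⁻ t in Icc (τ k.castSucc) (τ k.succ), f t :=
  (lintegral_mono_set (Icc_subset_iUnion_Icc_of_monotone hn τ)).trans
    ((lintegral_iUnion_le _ _).trans_eq (tsum_fintype _))

theorem Icc_castSucc_succ_subset {n : ℕ} {τ : Fin (n + 1) → ℝ} (hτ : Monotone τ) (k : Fin n) :
    Icc (τ k.castSucc) (τ k.succ) ⊆ Icc (τ 0) (τ (Fin.last n)) :=
  Icc_subset_Icc (hτ (Fin.zero_le _)) (hτ (Fin.le_last _))

/-! ### Solutions in the sense of distributions are mild solutions -/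

theorem IsCubicNLSSolution.continuousOn {s T : ℝ} (hs0 : 0 ≤ s) {u₀ : L2Plane} {u : ℝ → L2Plane}
    (h : IsCubicNLSSolution s T u₀ u) : ContinuousOn u (Icc 0 T) := by
  intro t ht
  rw [ContinuousWithinAt, tendsto_iff_edist_tendsto_0]
  refine tendsto_of_tendsto_of_tendsto_of_le_of_le tendsto_const_nhds (h.continuous_sobolev t ht)
    (fun _ => zero_le) fun t' => ?_
  rw [edist_eq_enorm_sub]
  exact enorm_le_sobolevNorm hs0 _

/-- The restriction to `[0, T]` of `u`, extended to a function on `ℝ` that is constant on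
`(-∞, 0]` and on `[T, ∞)`. -/
noncomputable def clampIcc {T : ℝ} (hT : 0 ≤ T) (u : ℝ → L2Plane) : ℝ → L2Plane :=
  IccExtend hT ((Icc 0 T).domRestrict u)

theorem clampIcc_of_mem {T : ℝ} (hT : 0 ≤ T) (u : ℝ → L2Plane) {t : ℝ} (ht : t ∈ Icc 0 T) :
    clampIcc hT u t = u t := by
  rw [clampIcc, IccExtend_of_mem hT _ ht, domRestrict_apply]

/-- The bound in `L³ L⁶` makes `|u|² u` a Bochner integrable function of time with values in `L²`,
so that the time integral in the distributional equation can be taken in `L²`. -/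
theorem IsCubicNLSSolution.isMildSolution {s T : ℝ} (hs0 : 0 ≤ s) (hT : 0 ≤ T) {u₀ : L2Plane}
    {u : ℝ → L2Plane} (h : IsCubicNLSSolution s T u₀ u)
    (h6 : ∫⁻ t in Icc 0 T, eLpNorm (u t) 6 ^ 3 < ⊤) :
    IsMildSolution T (clampIcc hT u) fun t => cubicLp (clampIcc hT u t) := by
  have hcont : Continuous (clampIcc hT u) :=
    continuous_IccExtend_iff.2 (continuousOn_iff_continuous_domRestrict.1 (h.continuousOn hs0))
  have h6' : ∫⁻ t in Icc 0 T, eLpNorm (clampIcc hT u t) 6 ^ 3 < ⊤ := by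
    refine (setLIntegral_congr_fun measurableSet_Icc fun t ht => ?_).trans_lt h6
    simp only [clampIcc_of_mem hT u ht]
  have hmeas : Measurable fun t => eLpNorm (clampIcc hT u t) 6 ^ 3 :=
    (measurable_eLpNorm_of_continuous hcont 6).pow_const 3
  have hmem : ∀ᵐ t ∂volume.restrict (Icc 0 T),
      MemLp (fun x => ((‖clampIcc hT u t x‖ ^ 2 : ℝ) : ℂ) * clampIcc hT u t x) 2 := by
    filter_upwards [ae_lt_top hmeas h6'.ne] with t ht
    refine ⟨?_, (eLpNorm_cubic _).trans_lt ht⟩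
    have := Lp.aestronglyMeasurable (clampIcc hT u t)
    exact (Complex.continuous_ofReal.comp_aestronglyMeasurable (this.norm.pow 2)).mul this
  have hae : ∀ᵐ t ∂volume.restrict (Icc 0 T), cubicLp (clampIcc hT u t) =ᵐ[volume]
      fun x => ((‖clampIcc hT u t x‖ ^ 2 : ℝ) : ℂ) * clampIcc hT u t x :=
    hmem.mono fun t ht => coeFn_cubicLp ht
  refine ⟨hcont, ?_, hae, fun ψ t ht => ?_⟩
  · rw [intervalIntegrable_iff_integrableOn_Icc_of_le hT]
    refine ⟨aestronglyMeasurable_cubicLp hcont hmem, ?_⟩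
    refine (lintegral_congr_ae (hae.mono fun t ht => ?_)).trans_lt h6'
    rw [Lp.enorm_def, eLpNorm_congr_ae ht, eLpNorm_cubic]
  · rw [← h.equation ψ t ht, clampIcc_of_mem hT u ht, clampIcc_of_mem hT u ⟨le_rfl, hT⟩, h.initial,
      schwartzPairing_apply, schwartzPairing_apply]
    congr 1
    refine intervalIntegral.integral_congr_ae ?_
    rw [uIoc_of_le ht.1, ← ae_restrict_iff' measurableSet_Ioc]
    have hsub : Ioc 0 t ⊆ Icc 0 T := fun τ hτ => ⟨hτ.1.le, hτ.2.trans ht.2⟩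
    filter_upwards [ae_restrict_of_ae_restrict_of_subset hsub hae,
      ae_restrict_mem measurableSet_Ioc] with τ h1 h2
    rw [clampIcc_of_mem hT u (hsub h2)] at h1 ⊢
    rw [schwartzPairing_apply, schwartzPairing_apply]
    congr 1
    exact integral_congr_ae (h1.mono fun x hx => congrArg (· * ψ x) hx)

/-! ### The almost Morawetz estimate -/

section

open LineDeriv

variable {s : ℝ} {φ : ℝ → ℝ} {N : ℝ}

/-- Bounds that hold almost everywhere hold everywhere, the endpoints included, for continuous
functions. -/
theorem le_of_ae_le_of_continuous {f : ℝ → ℝ≥0∞} (hf : Continuous f) {T : ℝ} (hT : 0 < T)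
    {K : ℝ≥0∞} (h : ∀ᵐ t ∂volume.restrict (Icc 0 T), f t ≤ K) {t : ℝ} (ht : t ∈ Icc 0 T) :
    f t ≤ K := by
  have := Measure.eqOn_Icc_of_ae_eq volume hT.ne (f := fun t => max (f t) K) (g := fun _ => K)
    (h.mono fun t ht => max_eq_right ht) (by fun_prop) (by fun_prop) ht
  exact max_eq_right_iff.1 this

/-- The bounds of `exists_cubic_commutator_bound`, which hold trivially for `v ∉ L⁶` when the
constant is positive. -/
theorem exists_cubic_commutator_bound_top (hs0 : 0 < s) (hs1 : s < 1) (hφ : IsIProfile s φ) {ε : ℝ}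
    (hε : 0 < ε) :
    ∃ C : ℝ≥0, ∀ (N : ℝ) (hN : 1 ≤ N) (J : ℕ) (f v : L2Plane),
      (∀ᵐ ξ, (𝓕 v : L2Plane) ξ = (bracketISymbol φ N ξ : ℂ) * (𝓕 f : L2Plane) ξ) →
      eLpNorm f 6 ≤ C * eLpNorm v 6 ∧
      eLpNorm (mollifierError (truncKernel hφ hN J) f
        (fun y => ((‖f y‖ ^ 2 : ℝ) : ℂ) * f y)) 2 ≤
      C * ENNReal.ofReal (N ^ (-2 + ε)) * eLpNorm v 6 ^ 3 := by
  obtain ⟨C, hC⟩ := exists_cubic_commutator_bound hs0 hs1 hφ hε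
  refine ⟨C + 1, fun N hN J f v hv => ?_⟩
  rcases eq_or_ne (eLpNorm v 6) ⊤ with h6 | h6
  · have hN0 : ENNReal.ofReal (N ^ (-2 + ε)) ≠ 0 := by
      rw [Ne, ENNReal.ofReal_eq_zero, not_le]
      positivity
    have hC0 : ((C + 1 : ℝ≥0) : ℝ≥0∞) ≠ 0 := by
      rw [Ne, ENNReal.coe_eq_zero]
      positivity
    rw [h6, ENNReal.mul_top hC0, ENNReal.top_pow (by norm_num),
      ENNReal.mul_top (mul_ne_zero hC0 hN0)]
    exact ⟨le_top, le_top⟩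
  · have hle : (C : ℝ≥0∞) ≤ (C + 1 : ℝ≥0) := by
      rw [ENNReal.coe_le_coe]
      exact le_self_add
    have h := hC N hN J f v hv (lt_top_iff_ne_top.2 h6)
    refine ⟨h.1.trans (by gcongr), h.2.trans (by gcongr)⟩

/-- Hölder's inequality in time for the error term: `L³ L⁶` three times and `L^∞ L²` three times. -/
theorem lintegral_mul_sq_mul_le {α : Type*} [MeasurableSpace α] {μ : Measure α}
    {a b c v : α → ℝ≥0∞} {A Z : ℝ≥0∞} (hA : A ≠ ⊤) (hZ : Z ≠ ⊤) (ha : ∀ᵐ t ∂μ, a t ≤ A * v t ^ 3)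
    (hb : ∀ᵐ t ∂μ, b t ≤ Z) (hc : ∀ᵐ t ∂μ, c t ≤ Z) (hv : ∫⁻ t, v t ^ 3 ∂μ ≤ Z ^ 3) :
    ∫⁻ t, a t * b t ^ 2 * c t ∂μ ≤ A * Z ^ 6 := by
  calc _ ≤ ∫⁻ t, A * Z ^ 3 * v t ^ 3 ∂μ := by
        refine lintegral_mono_ae ?_
        filter_upwards [ha, hb, hc] with t ha hb hc
        refine (mul_le_mul' (mul_le_mul' ha (pow_le_pow_left' hb 2)) hc).trans_eq ?_
        ring
    _ = A * Z ^ 3 * ∫⁻ t, v t ^ 3 ∂μ :=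
        lintegral_const_mul' _ _ (ENNReal.mul_ne_top hA (ENNReal.pow_ne_top hZ))
    _ ≤ A * Z ^ 3 * Z ^ 3 := by gcongr
    _ = A * Z ^ 6 := by ring

theorem lintegral_pow_three_lt_top {α : Type*} [MeasurableSpace α] {μ : Measure α}
    {a v : α → ℝ≥0∞} {C : ℝ≥0} {Z : ℝ≥0∞} (hZ : Z ≠ ⊤) (ha : ∀ᵐ t ∂μ, a t ≤ C * v t)
    (hv : ∫⁻ t, v t ^ 3 ∂μ ≤ Z ^ 3) : ∫⁻ t, a t ^ 3 ∂μ < ⊤ := by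
  calc _ ≤ ∫⁻ t, (C : ℝ≥0∞) ^ 3 * v t ^ 3 ∂μ := by
        refine lintegral_mono_ae (ha.mono fun t ha => ?_)
        rw [← mul_pow]
        exact pow_le_pow_left' ha 3
    _ = (C : ℝ≥0∞) ^ 3 * ∫⁻ t, v t ^ 3 ∂μ :=
        lintegral_const_mul' _ _ (ENNReal.pow_ne_top ENNReal.coe_ne_top)
    _ ≤ (C : ℝ≥0∞) ^ 3 * Z ^ 3 := by gcongr
    _ < ⊤ := ENNReal.mul_lt_top (ENNReal.pow_lt_top ENNReal.coe_lt_top)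
          (ENNReal.pow_lt_top (lt_top_iff_ne_top.2 hZ))

theorem lintegral_mollifierError_le (hφ : IsIProfile s φ) (hN : 1 ≤ N) (J : ℕ) {U F v : ℝ → L2Plane}
    {S : Set ℝ} {A Z : ℝ≥0∞} (hA : A ≠ ⊤) (hZ : Z ≠ ⊤)
    (hF : ∀ᵐ t ∂volume.restrict S, F t =ᵐ[volume] fun x => ((‖U t x‖ ^ 2 : ℝ) : ℂ) * U t x)
    (hv : ∀ᵐ t ∂volume.restrict S, ∀ᵐ ξ,
      (𝓕 (v t) : L2Plane) ξ = (bracketISymbol φ N ξ : ℂ) * (𝓕 (U t) : L2Plane) ξ)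
    (hE : ∀ f v : L2Plane,
      (∀ᵐ ξ, (𝓕 v : L2Plane) ξ = (bracketISymbol φ N ξ : ℂ) * (𝓕 f : L2Plane) ξ) →
      eLpNorm (mollifierError (truncKernel hφ hN J) f
        (fun y => ((‖f y‖ ^ 2 : ℝ) : ℂ) * f y)) 2 ≤ A * eLpNorm v 6 ^ 3)
    (h6 : ∫⁻ t in S, eLpNorm (v t) 6 ^ 3 ≤ Z ^ 3)
    (h2 : ∀ᵐ t ∂volume.restrict S, eLpNorm (v t) 2 ≤ Z) {e : Plane} (he : ‖e‖ = 1) :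
    ∫⁻ t in S, eLpNorm (mollifierError (truncKernel hφ hN J) (U t) (F t)) 2 *
        eLpNorm (schwartzConv (truncKernel hφ hN J) (U t)) 2 ^ 2 *
        eLpNorm (schwartzConv (∂_{e} (truncKernel hφ hN J)) (U t)) 2 ≤ A * Z ^ 6 := by
  refine lintegral_mul_sq_mul_le hA hZ ?_ ?_ ?_ h6
  · filter_upwards [hF, hv] with t hF hv
    have e1 : mollifierError (truncKernel hφ hN J) (U t) (F t) =
        mollifierError (truncKernel hφ hN J) (U t) (fun y => ((‖U t y‖ ^ 2 : ℝ) : ℂ) * U t y) := by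
      ext x
      rw [mollifierError, mollifierError, schwartzConv_congr _ hF]
    rw [e1]
    exact hE _ _ hv
  · filter_upwards [hv, h2] with t hv h2
    exact (eLpNorm_truncKernel_le_bracket hφ hN J hv).trans h2
  · filter_upwards [hv, h2] with t hv h2
    exact (eLpNorm_deriv_truncKernel_le_bracket hφ hN J hv he).trans h2

theorem eLpNorm_iOperator_four_pow_le (hs1 : s < 1) (hφ : IsIProfile s φ) (hN : 1 ≤ N)
    (f : L2Plane) :
    eLpNorm (iOperator φ N f) 4 ^ 4 ≤
      liminf (fun J => eLpNorm (schwartzConvL (truncKernel hφ hN J) f) 4 ^ 4) atTop := by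
  have h := eLpNorm_le_liminf_of_tendsto (p := 4)
    (fun J => Lp.aestronglyMeasurable (schwartzConvL (truncKernel hφ hN J) f))
    (Lp.aestronglyMeasurable (iOperator φ N f))
    ((Lp.tendsto_Lp_iff_tendsto_eLpNorm' _ _).1 (tendsto_truncKernel hs1 hφ hN f))
  have hmono : Monotone fun x : ℝ≥0∞ => x ^ 4 := fun a b hab => pow_le_pow_left' hab 4
  refine (pow_le_pow_left' h 4).trans_eq ?_
  exact hmono.map_liminf_of_continuousAt (F := atTop)
    (fun J => eLpNorm (schwartzConvL (truncKernel hφ hN J) f) 4 volume)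
    (ENNReal.continuous_pow 4).continuousAt

/-- It suffices to bound the truncated operators, uniformly in the truncation. -/
theorem mixedNorm_iOperator_le (hs1 : s < 1) (hφ : IsIProfile s φ) (hN : 1 ≤ N) {T : ℝ}
    {U u : ℝ → L2Plane} (hU : Continuous U) (huU : ∀ t ∈ Icc 0 T, U t = u t) {B : ℝ≥0∞}
    (hB : ∀ J, ∫⁻ t in Icc 0 T, eLpNorm (schwartzConv (truncKernel hφ hN J) (U t)) 4 ^ 4 ≤ B) :
    mixedNorm 4 4 (Icc 0 T) (fun t => iOperator φ N (u t)) ^ 4 ≤ B := by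
  have e4 := mixedNorm_pow_eq_lintegral (p := 4) (by norm_num) 4 (Icc 0 T)
    (fun t => iOperator φ N (u t))
  rw [Nat.cast_ofNat] at e4
  rw [e4]
  calc _ ≤ ∫⁻ t in Icc 0 T,
        liminf (fun J => eLpNorm (schwartzConvL (truncKernel hφ hN J) (U t)) 4 ^ 4) atTop := by
        refine setLIntegral_mono' measurableSet_Icc fun t ht => ?_
        rw [← huU t ht]
        exact eLpNorm_iOperator_four_pow_le hs1 hφ hN (U t)
    _ ≤ liminf (fun J => ∫⁻ t in Icc 0 T,
          eLpNorm (schwartzConvL (truncKernel hφ hN J) (U t)) 4 ^ 4) atTop := by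
        refine lintegral_liminf_le fun J => ?_
        exact (measurable_eLpNorm_of_continuous
          ((schwartzConvL _).continuous.comp hU) 4).pow_const 4
    _ ≤ B := by
        refine liminf_le_of_le (by isBoundedDefault) fun b hb => ?_
        obtain ⟨J, hJ⟩ := hb.exists
        refine hJ.trans (le_trans (le_of_eq ?_) (hB J))
        refine lintegral_congr fun t => ?_
        rw [eLpNorm_congr_ae (coeFn_schwartzConvL _ _)]

/-- The almost Morawetz estimate when all the quantities `Z_I(J_k)` are finite, with `A` the
constant of the cubic commutator estimate and `M` a bound for the profile. -/
theorem mixedNorm_iOperator_le_of_ne_top (hs0 : 0 < s) (hs1 : s < 1) (hφ : IsIProfile s φ)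
    (hN : 1 ≤ N) {T : ℝ} (hT : 0 < T) {u₀ : L2Plane} {u : ℝ → L2Plane}
    (hu : IsCubicNLSSolution s T u₀ u) {n : ℕ} {τ : Fin (n + 1) → ℝ} (hτ : Monotone τ)
    (hτ0 : τ 0 = 0) (hτT : τ (Fin.last n) = T)
    (hZ : ∀ k : Fin n, strichartzZ φ N u (Icc (τ k.castSucc) (τ k.succ)) ≠ ⊤)
    {C M : ℝ≥0} {A : ℝ≥0∞} (hA : A ≠ ⊤) (hM : ∀ r, φ r ≤ M)
    (hC : ∀ f v : L2Plane,
      (∀ᵐ ξ, (𝓕 v : L2Plane) ξ = (bracketISymbol φ N ξ : ℂ) * (𝓕 f : L2Plane) ξ) →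
      eLpNorm f 6 ≤ C * eLpNorm v 6 ∧ ∀ J, eLpNorm (mollifierError (truncKernel hφ hN J) f
        (fun y => ((‖f y‖ ^ 2 : ℝ) : ℂ) * f y)) 2 ≤ A * eLpNorm v 6 ^ 3) :
    mixedNorm 4 4 (Icc 0 T) (fun t => iOperator φ N (u t)) ^ 4 ≤
      ENNReal.ofReal (T ^ (1 / 3 : ℝ)) * ((2 * ((M * ‖u₀‖ₑ) ^ 3 *
          eLpNorm (fun t => homSobolevNormOne (iOperator φ N (u t))) ⊤
              (volume.restrict (Icc 0 T))) +
        6 * ∑ k : Fin n, A * strichartzZ φ N u (Icc (τ k.castSucc) (τ k.succ)) ^ 6) *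
          (volume : Measure Plane).toSphere univ +
        volume (Metric.ball (0 : Plane) 1) * (M * ‖u₀‖ₑ) ^ 4) := by
  have hn : n ≠ 0 := by
    rintro rfl
    exact hT.ne (hτ0.symm.trans hτT)
  have hsub (k : Fin n) : Icc (τ k.castSucc) (τ k.succ) ⊆ Icc 0 T := by
    simpa only [hτ0, hτT] using Icc_castSucc_succ_subset hτ k
  have hsum (f : ℝ → ℝ≥0∞) :
      ∫⁻ t in Icc 0 T, f t ≤ ∑ k : Fin n, ∫⁻ t in Icc (τ k.castSucc) (τ k.succ), f t := by
    simpa only [hτ0, hτT] using lintegral_Icc_le_sum hn τ f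
  have hv (t : ℝ) (ht : t ∈ Icc 0 T) :=
    fourier_bracket_iOperator hs0 hs1 hφ hN (hu.mem_sobolev t ht)
  have h6 : ∫⁻ t in Icc 0 T, eLpNorm (u t) 6 ^ 3 < ⊤ := by
    refine (hsum _).trans_lt (ENNReal.sum_lt_top.2 fun k _ => ?_)
    refine lintegral_pow_three_lt_top (C := C) (hZ k) ?_ (lintegral_le_strichartzZ φ N u _)
    filter_upwards [ae_restrict_mem measurableSet_Icc] with t ht
    exact (hC _ _ (hv t (hsub k ht))).1
  have hmild := hu.isMildSolution hs0.le hT.le h6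
  have hU (t : ℝ) (ht : t ∈ Icc 0 T) : clampIcc hT.le u t = u t := clampIcc_of_mem hT.le u ht
  have hU0 : clampIcc hT.le u 0 = u₀ := (hU 0 ⟨le_rfl, hT.le⟩).trans hu.initial
  have hnorm (t : ℝ) (ht : t ∈ Icc 0 T) : ‖clampIcc hT.le u t‖ₑ = ‖u₀‖ₑ := by
    rw [← ofReal_norm, hmild.norm_eq hT.le ht, hU0, ofReal_norm]
  refine mixedNorm_iOperator_le hs1 hφ hN hmild.continuous hU fun J => ?_
  have hm (t : ℝ) (ht : t ∈ Icc 0 T) :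
      eLpNorm (schwartzConv (truncKernel hφ hN J) (clampIcc hT.le u t)) 2 ≤ M * ‖u₀‖ₑ := by
    rw [← hnorm t ht]
    exact eLpNorm_truncKernel_le hφ hN J _ hM
  refine hmild.lintegral_eLpNorm_four_le (truncKernel hφ hN J) hT (fun e he t ht => ?_)
    (fun e he => ?_) hm
  · refine mul_le_mul' (pow_le_pow_left' (hm t ht) 3) ?_
    rw [← enorm_schwartzConvL]
    refine le_of_ae_le_of_continuous
      (f := fun t => ‖schwartzConvL (∂_{e} (truncKernel hφ hN J)) (clampIcc hT.le u t)‖ₑ)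
      (((schwartzConvL _).continuous.comp hmild.continuous).enorm) hT ?_ ht
    filter_upwards [enorm_ae_le_eLpNormEssSup (fun t => homSobolevNormOne (iOperator φ N (u t)))
      (volume.restrict (Icc 0 T)), ae_restrict_mem measurableSet_Icc] with t h1 h2
    rw [enorm_schwartzConvL, hU t h2, eLpNorm_exponent_top]
    exact (eLpNorm_deriv_truncKernel_le_homSobolev hs1 hφ hN J (u t) he).trans h1
  · refine (hsum _).trans (Finset.sum_le_sum fun k _ => ?_)
    refine lintegral_mollifierError_le hφ hN J
      (v := fun t => fourierMul japaneseBracket (iOperator φ N (u t))) hA (hZ k)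
      (ae_restrict_of_ae_restrict_of_subset (hsub k) hmild.nonlinearity) ?_
      (fun f v hfv => (hC f v hfv).2 J) (lintegral_le_strichartzZ φ N u _)
      (ae_le_strichartzZ φ N u _) he
    filter_upwards [ae_restrict_mem measurableSet_Icc] with t ht
    rw [hU t (hsub k ht)]
    exact hv t (hsub k ht)

end

theorem proposition4p1 (s : ℝ) (hs0 : 0 < s) (hs1 : s < 1) (φ : ℝ → ℝ) (hφ : IsIProfile s φ)
    (ε : ℝ) (hε : 0 < ε) :
    ∃ C : ℝ≥0, ∀ (N T : ℝ), 1 ≤ N → 0 < T →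
      ∀ (u₀ : L2Plane) (u : ℝ → L2Plane), IsCubicNLSSolution s T u₀ u →
      ∀ (n : ℕ) (τ : Fin (n + 1) → ℝ), Monotone τ → τ 0 = 0 → τ (Fin.last n) = T →
        mixedNorm 4 4 (Icc 0 T) (fun t => iOperator φ N (u t)) ^ 4 ≤
          C * (ENNReal.ofReal (T ^ (1 / 3 : ℝ)) * ‖u₀‖ₑ ^ 3 *
                eLpNorm (fun t => homSobolevNormOne (iOperator φ N (u t))) ∞
                  (volume.restrict (Icc 0 T))
            + ENNReal.ofReal (T ^ (1 / 3 : ℝ)) * ‖u₀‖ₑ ^ 4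
            + ENNReal.ofReal (T ^ (1 / 3 : ℝ)) *
                ∑ k : Fin n, strichartzZ φ N u (Icc (τ k.castSucc) (τ k.succ)) ^ 6 /
                  ENNReal.ofReal (N ^ (2 - ε))) := by
  obtain ⟨C₁, hC₁⟩ := exists_cubic_commutator_bound_top hs0 hs1 hφ hε
  obtain ⟨M, -, hM⟩ := hφ.exists_le hs1
  obtain ⟨S, hS⟩ : ∃ S : ℝ≥0, (S : ℝ≥0∞) = (volume : Measure Plane).toSphere univ :=
    ⟨_, ENNReal.coe_toNNReal (measure_ne_top _ _)⟩
  obtain ⟨B, hB⟩ : ∃ B : ℝ≥0, (B : ℝ≥0∞) = volume (Metric.ball (0 : Plane) 1) :=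
    ⟨_, ENNReal.coe_toNNReal measure_ball_lt_top.ne⟩
  refine ⟨2 * M ^ 3 * S + 6 * C₁ * S + B * M ^ 4 + 1,
    fun N T hN hT u₀ u hu n τ hτ hτ0 hτT => ?_⟩
  have hT' : ENNReal.ofReal (T ^ (1 / 3 : ℝ)) ≠ 0 := by
    rw [Ne, ENNReal.ofReal_eq_zero, not_le]
    positivity
  have hN0 : 0 < N := by linarith
  by_cases hZ : ∀ k : Fin n, strichartzZ φ N u (Icc (τ k.castSucc) (τ k.succ)) ≠ ⊤
  · have key := mixedNorm_iOperator_le_of_ne_top hs0 hs1 hφ hN hT hu hτ hτ0 hτT hZ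
      (A := C₁ * ENNReal.ofReal (N ^ (-2 + ε)))
      (ENNReal.mul_ne_top ENNReal.coe_ne_top ENNReal.ofReal_ne_top) hM
      fun f v hfv => ⟨(hC₁ N hN 0 f v hfv).1, fun J => (hC₁ N hN J f v hfv).2⟩
    refine key.trans ?_
    have hdiv (x : ℝ≥0∞) : x / ENNReal.ofReal (N ^ (2 - ε)) =
        ENNReal.ofReal (N ^ (-2 + ε)) * x := by
      rw [show -2 + ε = -(2 - ε) by ring, Real.rpow_neg hN0.le,
        ENNReal.ofReal_inv_of_pos (by positivity), mul_comm]
      rfl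
    simp_rw [hdiv, mul_assoc, ← Finset.mul_sum]
    rw [← hS, ← hB]
    generalize ENNReal.ofReal (T ^ (1 / 3 : ℝ)) = t
    generalize ‖u₀‖ₑ = y
    generalize eLpNorm (fun t => homSobolevNormOne (iOperator φ N (u t))) ⊤
      (volume.restrict (Icc 0 T)) = K
    generalize ENNReal.ofReal (N ^ (-2 + ε)) * ∑ k : Fin n,
      strichartzZ φ N u (Icc (τ k.castSucc) (τ k.succ)) ^ 6 = X
    push_cast
    set a : ℝ≥0∞ := 2 * (M : ℝ≥0∞) ^ 3 * S
    set b : ℝ≥0∞ := 6 * (C₁ : ℝ≥0∞) * S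
    set c : ℝ≥0∞ := (B : ℝ≥0∞) * (M : ℝ≥0∞) ^ 4
    calc _ = a * (t * (y ^ 3 * K)) + c * (t * y ^ 4) + b * (t * X) := by
          simp only [a, b, c]; ring
      _ ≤ (a + b + c + 1) * (t * (y ^ 3 * K)) + (a + b + c + 1) * (t * y ^ 4) +
          (a + b + c + 1) * (t * X) := by
          gcongr
          · exact le_add_right (le_add_right le_self_add)
          · exact le_add_right le_add_self
          · exact le_add_right (le_add_right le_add_self)
      _ = _ := by simp only [a, b, c]; ring
  -- if some `Z_I(J_k)` is infinite, so is the right side, since the summand `1` makes `C` positive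
  · push Not at hZ
    obtain ⟨k, hk⟩ := hZ
    refine le_top.trans_eq (Eq.symm ?_)
    have hsum : ∑ k : Fin n, strichartzZ φ N u (Icc (τ k.castSucc) (τ k.succ)) ^ 6 /
        ENNReal.ofReal (N ^ (2 - ε)) = ⊤ := by
      refine ENNReal.sum_eq_top.2 ⟨k, Finset.mem_univ k, ?_⟩
      rw [hk, ENNReal.top_pow (by norm_num), ENNReal.top_div_of_ne_top ENNReal.ofReal_ne_top]
    rw [hsum, ENNReal.mul_top hT', add_top, ENNReal.mul_top]
    rw [Ne, ENNReal.coe_eq_zero]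
    positivity
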